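/- Let $1<p<\infty$, $\frac1p+\frac1{p'}=1$, $s>0$, and let $\psi$ be a continuous function on $[1,\infty)$ with $\psi(k)>0$ for $k\in\mathbb N$. Put $g_{s,p}(t):=\psi(t)\,t^{s+1/p}$, $t\ge 1$. **Notation.** All functions $f,\varphi,\Psi_\beta$ are real-valued and $2\pi$-periodic; $\|\varphi\|_p=\big(\int_0^{2\pi}|\varphi|^p\,dt\big)^{1/p}$ and $\|f\|_C=\max_t|f(t)|$. For $\beta\in\mathbb R$, $C^\psi_{\beta,p}$ is the class of functions $$f(x)=\frac{a_0}{2}+\frac1\pi\int_{-\pi}^{\pi}\Psi_\beta(x-t)\varphi(t)\,dt,\qquad x\in\mathbb R,\quad a_0\in\mathbb R,\quad \|\varphi\|_p\le 1,\quad \int_{-\pi}^{\pi}\varphi\,dt=0,$$ where $\Psi_\beta\in L_{p'}$ has the Fourier series $\sum_{k\ge1}\psi(k)\cos\big(kt-\frac{\beta\pi}{2}\big)$. With $a_k(f),b_k(f)$ the Fourier coefficients of $f$, the Zygmund sums are $$Z_n^s(f;t)=\frac{a_0(f)}2+\sum_{k=1}^{n-1}\Big(1-\Big(\frac kn\Big)^s\Big)\big(a_k(f)\cos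 kt+b_k(f)\sin kt\big),$$ and $$\mathcal E_n(C^\psi_{\beta,p};Z_n^s)_C=\sup_{f\in C^\psi_{\beta,p}}\|f-Z_n^s(f)\|_C,\qquad E_n(C^\psi_{\beta,p})_C=\sup_{f\in C^\psi_{\beta,p}}\inf_{t_{n-1}}\|f-t_{n-1}\|_C,$$ the infimum being over trigonometric polynomials of order at most $n-1$. * $\Theta_p$: functions $\psi$ nonincreasing on $[1,\infty)$ for which there are $\alpha>\frac1p$ and $K>0$ with $t_1^\alpha\psi(t_1)\le K t_2^\alpha\psi(t_2)$ for all $t_1>t_2\ge1$. * $A^+$ (resp. $A^-$): positive functions $g$ on $[1,\infty)$ such that for some $\varepsilon>0$ the function $g(t)t^{-\varepsilon}$ is nondecreasing (resp. $g(t)t^{\varepsilon}$ is nonincreasing) on $[1,\infty)$. * $\mathcal Z$: positive continuous functions $g$ on $[1,\infty)$ such that for every $\delta>0$, for all sufficiently large $t$, $g(t)t^\delta$ is nondecreasing and $g(t)t^{-\delta}$ is nonincreasing. * For $\rho>1$, $\mathcal Z_\rho^+$: nondecreasing $g\in\mathcal Z$ with $g^\rho(n)\ln n=O\big(\int_1^n\frac{g^\rho(t)}t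 dt\big)$, $n\in\mathbb N$; $\mathcal Z_\rho^-$: nonincreasing $g\in\mathcal Z$ with $\int_1^n\frac{g^\rho(t)}t dt=O\big(g^\rho(n)\ln n\big)$, $n\in\mathbb N$. $A\asymp B$ means $K_1B\le A\le K_2B$ with constants $K_1,K_2>0$ that do not depend on $n$ or $\beta$ (they may depend on $\psi,p,s$). **Theorem.** 1. If $\psi\in\Theta_p$ and $g_{s,p}\in A^+$, then for all $\beta\in\mathbb R$ and $n\in\mathbb N$ $$\mathcal E_n(C^\psi_{\beta,p};Z_n^s)_C\asymp E_n(C^\psi_{\beta,p})_C\asymp\psi(n)\,n^{1/p}.$$ 2. If $g_{s,p}\in\mathcal Z^+_{p'}$, or if $g_{s,p}\in\mathcal Z^-_{p'}$ and $\int_1^n\frac{g_{s,p}^{p'}(t)}t dt\ne O(1)$, then for all $\beta\in\mathbb R$ and all integers $n\ge2$ $$\mathcal E_n(C^\psi_{\beta,p};Z_n^s)_C\asymp\frac1{n^s}\left(\int_1^n\frac{\big(\psi(t)t^{s+1/p}\big)^{p'}}t\,dt\right)^{1/p'}.$$ 3. If $g_{s,p}\in A^-$, or if $g_{s,p}\in\mathcal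 Z^-_{p'}$ and $\int_1^n\frac{g_{s,p}^{p'}(t)}t dt=O(1)$, then for all $\beta\in\mathbb R$ and $n\in\mathbb N$ $$\mathcal E_n(C^\psi_{\beta,p};Z_n^s)_C\asymp\frac1{n^s}.$$ -/

import Mathlib

open scoped NNReal ENNReal

noncomputable section

namespace ZygmundSums

open MeasureTheory Set Real

/-- The Fourier cosine coefficient `a_k(f) = (1/π) ∫_{-π}^{π} f(t) cos kt dt`. -/
def fourierCos (f : ℝ → ℝ) (k : ℕ) : ℝ :=
  (1 / π) * ∫ t in (-π)..π, f t * cos (k * t)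

/-- The Fourier sine coefficient `b_k(f) = (1/π) ∫_{-π}^{π} f(t) sin kt dt`. -/
def fourierSin (f : ℝ → ℝ) (k : ℕ) : ℝ :=
  (1 / π) * ∫ t in (-π)..π, f t * sin (k * t)

/-- `f` is a `2π`-periodic function belonging to `L_q` on a period. -/
def MemLpPeriodic (f : ℝ → ℝ) (q : ℝ) : Prop :=
  Function.Periodic f (2 * π) ∧ MemLp f (ENNReal.ofReal q) (volume.restrict (Ioc (-π) π))

/-- The (unnormalised) norm of `L_q` on a period. -/
def periodNorm (f : ℝ → ℝ) (q : ℝ) : ℝ≥0∞ :=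
  eLpNorm f (ENNReal.ofReal q) (volume.restrict (Ioc (-π) π))

/-- `Ψ ∈ L_q` is a kernel with the Fourier series `∑_{k ≥ 1} ψ(k) cos (kt - βπ/2)`. -/
def IsKernel (ψ : ℝ → ℝ) (β q : ℝ) (Ψ : ℝ → ℝ) : Prop :=
  MemLpPeriodic Ψ q ∧ fourierCos Ψ 0 = 0 ∧
    ∀ k : ℕ, 1 ≤ k →
      fourierCos Ψ k = ψ k * cos (β * π / 2) ∧ fourierSin Ψ k = ψ k * sin (β * π / 2)

/-- The class `C^ψ_{β,p}`: the functions `f = a₀/2 + (1/π) ∫_{-π}^{π} Ψ_β(· - t) φ(t) dt` with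
`‖φ‖_p ≤ 1`, `φ ⊥ 1`, and kernel `Ψ_β ∈ L_{p'}`. -/
def convClass (ψ : ℝ → ℝ) (β p : ℝ) : Set (ℝ → ℝ) :=
  {f | ∃ (Ψ φ : ℝ → ℝ) (a₀ : ℝ), IsKernel ψ β (Real.conjExponent p) Ψ ∧
    MemLpPeriodic φ p ∧ periodNorm φ p ≤ 1 ∧ ∫ t in (-π)..π, φ t = 0 ∧
    ∀ x, f x = a₀ / 2 + (1 / π) * ∫ t in (-π)..π, Ψ (x - t) * φ t}

/-- The Zygmund sum `Z_n^s(f; t)`. -/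
def zygmundSum (s : ℝ) (n : ℕ) (f : ℝ → ℝ) (t : ℝ) : ℝ :=
  fourierCos f 0 / 2 + ∑ k ∈ Finset.Ico 1 n,
    (1 - ((k : ℝ) / n) ^ s) * (fourierCos f k * cos (k * t) + fourierSin f k * sin (k * t))

/-- The trigonometric polynomials `t_{n-1}` of order (at most) `n - 1`. -/
def trigPolys (n : ℕ) : Set (ℝ → ℝ) :=
  {T | ∃ a b : ℕ → ℝ, ∀ t, T t = a 0 / 2 +
    ∑ k ∈ Finset.Ico 1 n, (a k * cos (k * t) + b k * sin (k * t))}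

/-- The uniform norm, as an extended nonnegative number. -/
def supNorm (f : ℝ → ℝ) : ℝ≥0∞ := ⨆ t, ‖f t‖ₑ

/-- `𝓔_n(C^ψ_{β,p}; Z_n^s)_C`, the supremum over the class of `‖f - Z_n^s(f)‖_C`. -/
def zygmundError (ψ : ℝ → ℝ) (p s β : ℝ) (n : ℕ) : ℝ≥0∞ :=
  ⨆ f ∈ convClass ψ β p, supNorm (fun t => f t - zygmundSum s n f t)

/-- `E_n(C^ψ_{β,p})_C`, the best uniform approximation of the class by `t_{n-1}`. -/
def bestApprox (ψ : ℝ → ℝ) (p β : ℝ) (n : ℕ) : ℝ≥0∞ :=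
  ⨆ f ∈ convClass ψ β p, ⨅ T ∈ trigPolys n, supNorm (fun t => f t - T t)

/-- The set `Θ_p`: `ψ` is nonincreasing on `[1, ∞)` and `t^α ψ(t)` is almost decreasing
for some `α > 1/p`. -/
def MemTheta (p : ℝ) (ψ : ℝ → ℝ) : Prop :=
  AntitoneOn ψ (Ici 1) ∧
    ∃ α : ℝ, 1 / p < α ∧ ∃ K : ℝ, 0 < K ∧ ∀ t₁ t₂ : ℝ, 1 ≤ t₂ → t₂ < t₁ → t₁ ^ α * ψ t₁ ≤ K * (t₂ ^ α * ψ t₂)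

/-- The set `A⁺`. -/
def MemAPlus (g : ℝ → ℝ) : Prop :=
  (∀ t, 1 ≤ t → 0 < g t) ∧ ∃ ε : ℝ, 0 < ε ∧ MonotoneOn (fun t : ℝ => g t * t ^ (-ε)) (Ici 1)

/-- The set `A⁻`. -/
def MemAMinus (g : ℝ → ℝ) : Prop :=
  (∀ t, 1 ≤ t → 0 < g t) ∧ ∃ ε : ℝ, 0 < ε ∧ AntitoneOn (fun t : ℝ => g t * t ^ ε) (Ici 1)

/-- The set `𝓩` of continuous functions on `[1, ∞)` slowly varying in the sense of Zygmund. -/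
def MemZ (g : ℝ → ℝ) : Prop :=
  ContinuousOn g (Ici 1) ∧ (∀ t, 1 ≤ t → 0 < g t) ∧
    ∀ δ : ℝ, 0 < δ → ∃ T : ℝ, 1 ≤ T ∧ MonotoneOn (fun t : ℝ => g t * t ^ δ) (Ici T) ∧
      AntitoneOn (fun t : ℝ => g t * t ^ (-δ)) (Ici T)

/-- `∫_1^n g^ρ(t) / t dt`. -/
def logIntegral (ρ : ℝ) (g : ℝ → ℝ) (n : ℕ) : ℝ := ∫ t in (1 : ℝ)..n, g t ^ ρ / t

/-- The set `𝓩⁺_ρ`. -/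
def MemZPlus (ρ : ℝ) (g : ℝ → ℝ) : Prop :=
  MemZ g ∧ MonotoneOn g (Ici 1) ∧
    ∃ K : ℝ, 0 < K ∧ ∀ n : ℕ, 1 ≤ n → g n ^ ρ * log n ≤ K * logIntegral ρ g n

/-- The set `𝓩⁻_ρ`. -/
def MemZMinus (ρ : ℝ) (g : ℝ → ℝ) : Prop :=
  MemZ g ∧ AntitoneOn g (Ici 1) ∧
    ∃ K : ℝ, 0 < K ∧ ∀ n : ℕ, 1 ≤ n → logIntegral ρ g n ≤ K * (g n ^ ρ * log n)

/-- `∫_1^n g^ρ(t) / t dt = O(1)`. -/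
def LogIntegralBounded (ρ : ℝ) (g : ℝ → ℝ) : Prop :=
  ∃ K : ℝ, ∀ n : ℕ, 1 ≤ n → logIntegral ρ g n ≤ K

/-- The function `g_{s,p}(t) = ψ(t) t^{s + 1/p}`. -/
def gFun (ψ : ℝ → ℝ) (s p t : ℝ) : ℝ := ψ t * t ^ (s + 1 / p)

/-- `A = O(B)` for all `n ≥ N` and all `β ∈ ℝ`, with one constant for all of them. -/
def BigO (N : ℕ) (A B : ℝ → ℕ → ℝ≥0∞) : Prop :=
  ∃ K : ℝ≥0, 0 < K ∧ ∀ β : ℝ, ∀ n : ℕ, N ≤ n → A β n ≤ K * B β n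

/-- The order equality `A ≍ B` for all `n ≥ N` and all `β ∈ ℝ`. -/
def OrderEq (N : ℕ) (A B : ℝ → ℕ → ℝ≥0∞) : Prop := BigO N A B ∧ BigO N B A

end ZygmundSums

end

namespace ZygmundSums

open MeasureTheory Set Real Filter Topology

/-! Write q for p' and θ for βπ/2. Up to a constant, f is the convolution of φ with the kernel, and
f - Z_n^s(f) is the convolution of φ with the series of coefficients λ_k ψ(k), where λ_k = (k/n)^s
for k < n and λ_k = 1 for k ≥ n. By Hölder the error is at most the sum of two L_q norms: that of
the tail ∑_{k≥n} ψ(k) cos(kx - θ), and n^{-s} times that of ∑_{k<n} k^s ψ(k) cos(kx - θ)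
(`zygmundError_le`). Only partial sums are ever estimated, uniformly in their length; their
convergence in L_q also produces the kernel (`exists_kernel`).

These norms come from one pointwise bound. For |x| of order π/M, the terms with k < M are summed
trivially and the rest by Abel summation, which costs M times the variation of the coefficients
beyond M. Integration over the annuli gives Hardy–Littlewood type sums (`eLpNorm_cosSum_le`). The
phase never enters, whence the uniformity in β. The tail is O(ψ(n) n^{1/p}) = O(n^{-s} g(n)) with g
= g_{s,p}. The low part has coefficients g(k) k^{-1+1/q}, and the q-th power of its norm behaves
like ∑_{k<n} g(k)^q / k: of order g(n)^q when g grows like a power, bounded when g decays like a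
power, and comparable with the logarithmic integral when g varies slowly.

For lower bounds, φ is a normalised cosine polynomial of phase -θ. The phases cancel, and the
resulting f is a cosine sum of phase 0 with explicit nonnegative coefficients
(`cosSum_mem_convClass`). Its deviation is evaluated at 0 (`le_zygmundError`). Frequencies 1 and 2
give n^{-s}; the coefficients g^{q-1}(k) k^{-1+1/p}, extremal in Hölder's inequality, give the
integral. For the best approximation, φ is the block n ≤ k < 3n, and f is paired with `testPoly n`,
which annihilates polynomials of order below n (`le_bestApprox`). -/

/-! ### Cosine sums and Abel summation -/

lemma abs_le_pi_mul_sin_half {x : ℝ} (hx : |x| ≤ π) : |x| / π ≤ |sin (x / 2)| := by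
  have h0 : 0 ≤ |x| / 2 := by positivity
  have h1 : |x| / 2 ≤ π / 2 := by linarith
  have h2 := mul_le_sin h0 h1
  have h3 : |sin (x / 2)| = sin (|x| / 2) := by
    rcases abs_cases x with ⟨h, h'⟩ | ⟨h, h'⟩
    · rw [h] at h0 h1 ⊢
      exact abs_of_nonneg (sin_nonneg_of_nonneg_of_le_pi h0 (by linarith [pi_pos]))
    · rw [h] at h0 h1 ⊢
      rw [neg_div, sin_neg]
      refine abs_of_nonpos ?_
      have := sin_nonneg_of_nonneg_of_le_pi h0 (by linarith [pi_pos])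
      rw [neg_div, sin_neg] at this
      linarith
  rw [h3]
  calc |x| / π = 2 / π * (|x| / 2) := by ring
    _ ≤ _ := h2

lemma two_mul_sin_half_mul_sum_cos (x θ : ℝ) {a b : ℕ} (hab : a ≤ b) :
    2 * sin (x / 2) * ∑ k ∈ Finset.Ico a b, cos (k * x - θ) =
      sin ((b - 1 / 2) * x - θ) - sin ((a - 1 / 2) * x - θ) := by
  induction b, hab using Nat.le_induction with
  | base => simp
  | succ b hab ih =>
    rw [Finset.sum_Ico_succ_top hab, mul_add, ih]
    have e1 : ((b + 1 : ℕ) - 1 / 2 : ℝ) * x - θ = (b * x - θ) + x / 2 := by push_cast; ring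
    have e2 : ((b : ℝ) - 1 / 2) * x - θ = (b * x - θ) - x / 2 := by ring
    rw [e1, e2, sin_add, sin_sub]
    ring

/-- Multiplying by 2 sin(x/2) telescopes the sum to a difference of two sines, and Jordan's
inequality bounds |sin(x/2)| below. The bound depends neither on the phase nor on the range. -/
lemma abs_sum_cos_le {x : ℝ} (hx0 : x ≠ 0) (hx : |x| ≤ π) (θ : ℝ) (a b : ℕ) :
    |∑ k ∈ Finset.Ico a b, cos (k * x - θ)| ≤ π / |x| := by
  have hx' : 0 < |x| := abs_pos.2 hx0
  rcases le_total b a with hab | hab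
  · rw [Finset.Ico_eq_empty (by omega)]
    simp only [Finset.sum_empty, abs_zero]
    positivity
  have h := congrArg abs (two_mul_sin_half_mul_sum_cos x θ hab)
  rw [abs_mul, abs_mul, abs_two] at h
  have h1 := abs_le_pi_mul_sin_half hx
  have h2 : |sin ((b - 1 / 2) * x - θ) - sin ((a - 1 / 2) * x - θ)| ≤ 2 := by
    refine (abs_sub _ _).trans ?_
    linarith [abs_sin_le_one ((b - 1 / 2) * x - θ), abs_sin_le_one ((a - 1 / 2) * x - θ)]
  rw [← h] at h2
  rw [le_div_iff₀ hx']
  set S := |∑ k ∈ Finset.Ico a b, cos (k * x - θ)|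
  have hS : 0 ≤ S := abs_nonneg _
  have h3 : |x| / π * S ≤ |sin (x / 2)| * S := mul_le_mul_of_nonneg_right h1 hS
  have h4 : |x| / π * S ≤ 1 := by nlinarith
  rw [div_mul_eq_mul_div, div_le_one pi_pos] at h4
  linarith

/-- Summation by parts. -/
lemma abs_sum_mul_sub_le (ν z : ℕ → ℝ) {c : ℝ} {M B : ℕ} (hMB : M ≤ B)
    (hz : ∀ b, |∑ k ∈ Finset.Ico M b, z k| ≤ c) :
    |∑ k ∈ Finset.Ico M B, ν k * z k - ν B * ∑ k ∈ Finset.Ico M B, z k| ≤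
      c * ∑ k ∈ Finset.Ico M B, |ν (k + 1) - ν k| := by
  induction B, hMB using Nat.le_induction with
  | base => simp
  | succ B hMB ih =>
    have e : ∑ k ∈ Finset.Ico M (B + 1), ν k * z k
          - ν (B + 1) * ∑ k ∈ Finset.Ico M (B + 1), z k =
        (∑ k ∈ Finset.Ico M B, ν k * z k - ν B * ∑ k ∈ Finset.Ico M B, z k)
          - (ν (B + 1) - ν B) * ∑ k ∈ Finset.Ico M (B + 1), z k := by
      rw [Finset.sum_Ico_succ_top hMB, Finset.sum_Ico_succ_top hMB]
      ring
    rw [e, Finset.sum_Ico_succ_top (f := fun k => |ν (k + 1) - ν k|) hMB, mul_add]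
    refine (abs_sub _ _).trans (add_le_add ih ?_)
    rw [abs_mul, mul_comm]
    exact mul_le_mul_of_nonneg_right (hz _) (abs_nonneg _)

/-- The variation of `ν` from `M` to `B`, including the final drop to zero. -/
noncomputable def tailVar (ν : ℕ → ℝ) (M B : ℕ) : ℝ := |ν B| + ∑ k ∈ Finset.Ico M B, |ν (k + 1) - ν k|

lemma tailVar_nonneg (ν : ℕ → ℝ) (M B : ℕ) : 0 ≤ tailVar ν M B :=
  add_nonneg (abs_nonneg _) (Finset.sum_nonneg fun _ _ => abs_nonneg _)

/-- The trigonometric polynomial `∑_{a ≤ k < b} ν(k) cos (kx - θ)`. -/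
noncomputable def cosSum (ν : ℕ → ℝ) (θ : ℝ) (a b : ℕ) (x : ℝ) : ℝ :=
  ∑ k ∈ Finset.Ico a b, ν k * cos (k * x - θ)

lemma abs_cosSum_le_sum (ν : ℕ → ℝ) (θ : ℝ) (a b : ℕ) (x : ℝ) :
    |cosSum ν θ a b x| ≤ ∑ k ∈ Finset.Ico a b, |ν k| := by
  refine (Finset.abs_sum_le_sum_abs _ _).trans (Finset.sum_le_sum fun k _ => ?_)
  rw [abs_mul]
  exact mul_le_of_le_one_right (abs_nonneg _) (abs_cos_le_one _)

lemma abs_cosSum_le_tailVar (ν : ℕ → ℝ) (θ : ℝ) {M B : ℕ} (hMB : M ≤ B) {x : ℝ} (hx0 : x ≠ 0)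
    (hx : |x| ≤ π) : |cosSum ν θ M B x| ≤ π / |x| * tailVar ν M B := by
  have hz := fun b => abs_sum_cos_le hx0 hx θ M b
  have h := abs_sum_mul_sub_le ν (fun k => cos (k * x - θ)) hMB hz
  have h2 : |ν B * ∑ k ∈ Finset.Ico M B, cos (k * x - θ)| ≤ π / |x| * |ν B| := by
    rw [abs_mul, mul_comm]
    exact mul_le_mul_of_nonneg_right (hz B) (abs_nonneg _)
  have h3 := abs_add_le (∑ k ∈ Finset.Ico M B, ν k * cos (k * x - θ)
    - ν B * ∑ k ∈ Finset.Ico M B, cos (k * x - θ)) (ν B * ∑ k ∈ Finset.Ico M B, cos (k * x - θ))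
  rw [sub_add_cancel] at h3
  rw [tailVar, mul_add, cosSum]
  linarith

/-- The cut M is free: trivial estimate below it, Abel summation above it. The choice M of order
π/|x| balances the two. -/
lemma abs_cosSum_le (ν : ℕ → ℝ) (θ : ℝ) {a M B : ℕ} (haM : a ≤ M) (hMB : M ≤ B) {x : ℝ}
    (hx0 : x ≠ 0) (hx : |x| ≤ π) :
    |cosSum ν θ a B x| ≤ ∑ k ∈ Finset.Ico a M, |ν k| + π / |x| * tailVar ν M B := by
  have e : cosSum ν θ a B x = cosSum ν θ a M x + cosSum ν θ M B x :=
    (Finset.sum_Ico_consecutive _ haM hMB).symm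
  rw [e]
  exact (abs_add_le _ _).trans
    (add_le_add (abs_cosSum_le_sum _ _ _ _ _) (abs_cosSum_le_tailVar _ _ hMB hx0 hx))

lemma continuous_cosSum (ν : ℕ → ℝ) (θ : ℝ) (a b : ℕ) : Continuous (cosSum ν θ a b) := by
  unfold cosSum
  fun_prop

lemma periodic_cosSum (ν : ℕ → ℝ) (θ : ℝ) (a b : ℕ) :
    Function.Periodic (cosSum ν θ a b) (2 * π) := by
  intro x
  refine Finset.sum_congr rfl fun k _ => ?_
  rw [show (k : ℝ) * (x + 2 * π) - θ = (k * x - θ) + k * (2 * π) by ring,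
    cos_add_nat_mul_two_pi]

/-! ### Norms from step majorants on annuli -/

/-- Lebesgue measure on a period. -/
noncomputable abbrev periodMeasure : Measure ℝ := volume.restrict (Ioc (-π) π)

lemma volume_annulus_le {a b : ℝ} (hab : a ≤ b) :
    volume {x : ℝ | a < |x| ∧ |x| ≤ b} ≤ ENNReal.ofReal (2 * (b - a)) := by
  have hsub : {x : ℝ | a < |x| ∧ |x| ≤ b} ⊆ Ioc a b ∪ Ico (-b) (-a) := by
    rintro x ⟨h1, h2⟩
    rcases abs_cases x with ⟨h, -⟩ | ⟨h, -⟩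
    · left; rw [h] at h1 h2; exact ⟨h1, h2⟩
    · right; rw [h] at h1 h2; constructor <;> linarith
  refine (measure_mono hsub).trans ((measure_union_le _ _).trans ?_)
  rw [Real.volume_Ioc, Real.volume_Ico, ← ENNReal.ofReal_add (by linarith) (by linarith)]
  exact ENNReal.ofReal_le_ofReal (by linarith)

/-- The scale of x is M = ⌊π/|x|⌋, truncated at B. -/
lemma exists_scale {x : ℝ} (hx0 : x ≠ 0) (hx : |x| ≤ π) {B : ℕ} (hB : 1 ≤ B) :
    (|x| ≤ π / B) ∨ ∃ M ∈ Finset.Ico 1 B, π / (M + 1 : ℝ) < |x| ∧ |x| ≤ π / M := by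
  have hx' : 0 < |x| := abs_pos.2 hx0
  by_cases h : |x| ≤ π / B
  · exact Or.inl h
  right
  have hB' : (0 : ℝ) < B := by exact_mod_cast hB
  rw [not_le, div_lt_iff₀ hB'] at h
  refine ⟨⌊π / |x|⌋₊, ?_, ?_, ?_⟩
  · rw [Finset.mem_Ico]
    constructor
    · rw [Nat.one_le_floor_iff, le_div_iff₀ hx']; linarith
    · rw [Nat.floor_lt (by positivity), div_lt_iff₀ hx']; linarith
  · have := Nat.lt_floor_add_one (π / |x|)
    rw [div_lt_iff₀ hx'] at this
    rw [div_lt_iff₀ (by positivity)]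
    linarith
  · have h1 : 1 ≤ ⌊π / |x|⌋₊ := by
      rw [Nat.one_le_floor_iff, le_div_iff₀ hx']; linarith
    have := Nat.floor_le (show 0 ≤ π / |x| by positivity)
    rw [le_div_iff₀ hx'] at this
    rw [le_div_iff₀ (by exact_mod_cast h1)]
    linarith

/-- A function with a step majorant `D(M)` on the scale `|x| ∼ π / M`, `1 ≤ M < B`, and `D(B)` on
`|x| ≤ π / B`. -/
lemma eLpNorm_le_of_step {r : ℝ} (hr : 1 ≤ r) {B : ℕ} (hB : 1 ≤ B) {F : ℝ → ℝ} {D : ℕ → ℝ}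
    (hD : ∀ M, 0 ≤ D M)
    (h1 : ∀ M x, 1 ≤ M → M < B → π / (M + 1 : ℝ) < |x| → |x| ≤ π / M → |F x| ≤ D M)
    (h2 : ∀ x, |x| ≤ π / B → |F x| ≤ D B) :
    eLpNorm F (ENNReal.ofReal r) periodMeasure ≤
      ENNReal.ofReal ((2 * π * (∑ M ∈ Finset.Ico 1 B, D M ^ r / (M * (M + 1)) + D B ^ r / B))
        ^ (1 / r)) := by
  have hr0 : 0 < r := by linarith
  have hB' : (0 : ℝ) < B := by exact_mod_cast hB
  have hsum : 0 ≤ ∑ M ∈ Finset.Ico 1 B, D M ^ r / ((M : ℝ) * (M + 1)) :=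
    Finset.sum_nonneg fun M _ => div_nonneg (rpow_nonneg (hD M) _) (by positivity)
  have hDB : 0 ≤ D B ^ r / B := div_nonneg (rpow_nonneg (hD B) _) hB'.le
  rw [eLpNorm_eq_lintegral_rpow_enorm_toReal (by simpa using hr0) ENNReal.ofReal_ne_top,
    ENNReal.toReal_ofReal hr0.le,
    ← ENNReal.ofReal_rpow_of_nonneg (by positivity) (by positivity)]
  refine ENNReal.rpow_le_rpow ?_ (by positivity)
  let A : ℕ → Set ℝ := fun M => {x : ℝ | π / (M + 1 : ℝ) < |x| ∧ |x| ≤ π / M}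
  let A' : Set ℝ := {x : ℝ | |x| ≤ π / B}
  have hA : ∀ M, MeasurableSet (A M) := fun M =>
    (measurableSet_lt measurable_const measurable_norm).inter
      (measurableSet_le measurable_norm measurable_const)
  have hA' : MeasurableSet A' := measurableSet_le measurable_norm measurable_const
  have hpt : ∀ᵐ x ∂periodMeasure, ‖F x‖ₑ ^ r ≤
      ∑ M ∈ Finset.Ico 1 B, (A M).indicator (fun _ => ENNReal.ofReal (D M ^ r)) x
        + A'.indicator (fun _ => ENNReal.ofReal (D B ^ r)) x := by
    have hne : ∀ᵐ x ∂periodMeasure, x ≠ 0 :=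
      ae_restrict_of_ae (by simp [ae_iff])
    filter_upwards [hne, ae_restrict_mem measurableSet_Ioc] with x hx0 hx
    have hxpi : |x| ≤ π := abs_le.2 ⟨hx.1.le, hx.2⟩
    have conv : ∀ d, 0 ≤ d → |F x| ≤ d → ‖F x‖ₑ ^ r ≤ ENNReal.ofReal (d ^ r) := by
      intro d hd h
      rw [← ENNReal.ofReal_rpow_of_nonneg hd hr0.le, Real.enorm_eq_ofReal_abs]
      exact ENNReal.rpow_le_rpow (ENNReal.ofReal_le_ofReal h) hr0.le
    rcases exists_scale hx0 hxpi hB with h | ⟨M, hM, h, h'⟩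
    · refine le_add_left ?_
      rw [indicator_of_mem (show x ∈ A' from h)]
      exact conv _ (hD _) (h2 x h)
    · refine le_add_right ?_
      refine le_trans ?_ (Finset.single_le_sum
        (f := fun M => (A M).indicator (fun _ => ENNReal.ofReal (D M ^ r)) x)
        (fun _ _ => zero_le) hM)
      rw [indicator_of_mem (show x ∈ A M from ⟨h, h'⟩)]
      rw [Finset.mem_Ico] at hM
      exact conv _ (hD _) (h1 M x hM.1 hM.2 h h')
  refine (lintegral_mono_ae hpt).trans ?_
  rw [lintegral_add_right _ (measurable_const.indicator hA'), lintegral_finsetSum _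
    (fun M _ => measurable_const.indicator (hA M)), mul_add,
    ENNReal.ofReal_add (by positivity) (by positivity), Finset.mul_sum,
    ENNReal.ofReal_sum_of_nonneg
      (fun M _ => mul_nonneg (by positivity) (div_nonneg (rpow_nonneg (hD M) _) (by positivity)))]
  have hres : ∀ s : Set ℝ, MeasurableSet s → periodMeasure s ≤ volume s := fun s _ =>
    Measure.restrict_apply_le _ _
  refine add_le_add (Finset.sum_le_sum fun M hM => ?_) ?_
  · have hM' : (0 : ℝ) < M := by exact_mod_cast (Finset.mem_Ico.1 hM).1
    rw [lintegral_indicator_const (hA M)]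
    -- The annulus has measure at most 2(π/M - π/(M+1)) = 2π/(M(M+1)), which is the weight in the
    -- sum.
    refine (mul_le_mul_right ((hres _ (hA M)).trans (volume_annulus_le ?_)) _).trans ?_
    · exact div_le_div_of_nonneg_left pi_pos.le hM' (by linarith)
    rw [← ENNReal.ofReal_mul (rpow_nonneg (hD M) _)]
    refine ENNReal.ofReal_le_ofReal (le_of_eq ?_)
    field_simp
    ring
  · rw [lintegral_indicator_const hA']
    have hv : volume A' ≤ ENNReal.ofReal (2 * (π / B)) := by
      have : A' = Icc (-(π / B)) (π / B) := by
        ext x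
        exact abs_le (a := x)
      rw [this, Real.volume_Icc]
      exact ENNReal.ofReal_le_ofReal (by linarith)
    refine (mul_le_mul_right ((hres _ hA').trans hv) _).trans ?_
    rw [← ENNReal.ofReal_mul (rpow_nonneg (hD B) _)]
    refine ENNReal.ofReal_le_ofReal (le_of_eq ?_)
    ring

/-! ### Sums of powers by telescoping -/

/-- From (1 + 1/k)^s ≤ e^{s/k} and e^z - 1 ≤ z e^z. The exponential form treats s < 1 and s ≥ 1
alike. -/
lemma rpow_add_one_sub_le {s : ℝ} (hs : 0 < s) {k : ℝ} (hk : 1 ≤ k) :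
    (k + 1) ^ s - k ^ s ≤ s * exp s * k ^ (s - 1) := by
  have hk0 : 0 < k := by linarith
  have e : (k + 1) ^ s = k ^ s * (1 + 1 / k) ^ s := by
    rw [← mul_rpow hk0.le (by positivity)]
    congr 1
    field_simp
  have h1 : (1 + 1 / k) ^ s ≤ exp (s / k) := by
    rw [rpow_def_of_pos (by positivity)]
    refine exp_le_exp.2 ?_
    have := log_le_sub_one_of_pos (show 0 < 1 + 1 / k by positivity)
    calc log (1 + 1 / k) * s ≤ (1 / k) * s := by
          refine mul_le_mul_of_nonneg_right (by linarith) hs.le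
      _ = s / k := by ring
  have h2 : exp (s / k) - 1 ≤ s / k * exp (s / k) := by
    have := add_one_le_exp (-(s / k))
    have h3 : exp (s / k) * exp (-(s / k)) = 1 := by rw [← exp_add]; simp
    nlinarith [exp_pos (s / k)]
  have h3 : exp (s / k) ≤ exp s := exp_le_exp.2 (div_le_self hs.le hk)
  have h4 : (1 + 1 / k) ^ s - 1 ≤ s / k * exp s := by
    have : s / k * exp (s / k) ≤ s / k * exp s := mul_le_mul_of_nonneg_left h3 (by positivity)
    linarith
  rw [e, rpow_sub_one hk0.ne']
  calc k ^ s * (1 + 1 / k) ^ s - k ^ s = k ^ s * ((1 + 1 / k) ^ s - 1) := by ring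
    _ ≤ k ^ s * (s / k * exp s) := mul_le_mul_of_nonneg_left h4 (by positivity)
    _ = _ := by ring

lemma half_inv_le_log {k : ℝ} (hk : 1 ≤ k) : 1 / (2 * k) ≤ log (1 + 1 / k) := by
  have hk0 : 0 < k := by linarith
  have h1 := one_sub_inv_le_log_of_pos (show 0 < 1 + 1 / k by positivity)
  have h2 : 1 - (1 + 1 / k)⁻¹ = 1 / (k + 1) := by
    field_simp
    ring
  rw [h2] at h1
  refine le_trans ?_ h1
  exact div_le_div_of_nonneg_left zero_le_one (by linarith) (by linarith)

lemma rpow_add_one_eq {k : ℝ} (hk : 1 ≤ k) (c : ℝ) :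
    (k + 1) ^ c = k ^ c * exp (log (1 + 1 / k) * c) := by
  have hk0 : 0 < k := by linarith
  rw [← rpow_def_of_pos (by positivity), ← mul_rpow hk0.le (by positivity)]
  congr 1
  field_simp

/-- Makes ∑ k^{c-1} telescope for every c > 0 at once, although k^{c-1} may increase or decrease: (1
+ 1/k)^c - 1 ≥ c log(1 + 1/k) ≥ c/(2k). -/
lemma rpow_sub_one_le_sub {c : ℝ} (hc : 0 < c) {k : ℝ} (hk : 1 ≤ k) :
    k ^ (c - 1) ≤ 2 / c * ((k + 1) ^ c - k ^ c) := by
  have hk0 : 0 < k := by linarith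
  rw [rpow_add_one_eq hk, rpow_sub_one hk0.ne']
  have h1 := half_inv_le_log hk
  have h2 := add_one_le_exp (log (1 + 1 / k) * c)
  have h3 : 1 / (2 * k) * c ≤ exp (log (1 + 1 / k) * c) - 1 := by nlinarith
  calc k ^ c / k = 2 / c * (k ^ c * (1 / (2 * k) * c)) := by field_simp
    _ ≤ 2 / c * (k ^ c * (exp (log (1 + 1 / k) * c) - 1)) := by gcongr
    _ = _ := by ring

lemma sum_rpow_le {c : ℝ} (hc : 0 < c) (M : ℕ) :
    ∑ k ∈ Finset.Ico 1 M, (k : ℝ) ^ (c - 1) ≤ 2 / c * (M : ℝ) ^ c := by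
  rcases Nat.eq_zero_or_pos M with rfl | hM
  · simp
    positivity
  calc ∑ k ∈ Finset.Ico 1 M, (k : ℝ) ^ (c - 1)
      ≤ ∑ k ∈ Finset.Ico 1 M, 2 / c * (((k + 1 : ℕ) : ℝ) ^ c - (k : ℝ) ^ c) := by
        refine Finset.sum_le_sum fun k hk => ?_
        push_cast
        exact rpow_sub_one_le_sub hc (by exact_mod_cast (Finset.mem_Ico.1 hk).1)
    _ = 2 / c * ((M : ℝ) ^ c - 1) := by
        rw [← Finset.mul_sum, Finset.sum_Ico_sub (fun k : ℕ => (k : ℝ) ^ c) hM]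
        simp
    _ ≤ _ := by
        have : 0 < 2 / c := by positivity
        nlinarith

/-- The decaying counterpart. With z = c/(2k) ≤ c one has 1 - e^{-z} ≥ z e^{-z} ≥ z e^{-c}, which is
where the factor e^c arises. -/
lemma rpow_neg_sub_one_le_sub {c : ℝ} (hc : 0 < c) {k : ℝ} (hk : 1 ≤ k) :
    k ^ (-c - 1) ≤ 2 * exp c / c * (k ^ (-c) - (k + 1) ^ (-c)) := by
  have hk0 : 0 < k := by linarith
  rw [rpow_add_one_eq hk, rpow_sub_one hk0.ne']
  have h1 := half_inv_le_log hk
  set z := c / (2 * k) with hz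
  have hz0 : 0 < z := by positivity
  have hzc : z ≤ c := div_le_self hc.le (by linarith)
  have h2 : exp (log (1 + 1 / k) * -c) ≤ exp (-z) := by
    refine exp_le_exp.2 ?_
    have : z = 1 / (2 * k) * c := by rw [hz]; ring
    rw [this]
    nlinarith
  have h3 : z * exp (-z) ≤ 1 - exp (-z) := by
    have := add_one_le_exp z
    have h4 : exp z * exp (-z) = 1 := by rw [← exp_add]; simp
    nlinarith [exp_pos (-z)]
  have h5 : exp (-c) ≤ exp (-z) := exp_le_exp.2 (by linarith)
  have h6 : z * exp (-c) ≤ 1 - exp (log (1 + 1 / k) * -c) := by nlinarith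
  calc k ^ (-c) / k = 2 * exp c / c * (k ^ (-c) * (z * exp (-c))) := by
        rw [hz, exp_neg c]
        field_simp
    _ ≤ 2 * exp c / c * (k ^ (-c) * (1 - exp (log (1 + 1 / k) * -c))) := by gcongr
    _ = _ := by ring

lemma sum_rpow_tail_le {c : ℝ} (hc : 0 < c) {M : ℕ} (hM : 1 ≤ M) (N : ℕ) :
    ∑ k ∈ Finset.Ico M N, (k : ℝ) ^ (-c - 1) ≤ 2 * exp c / c * (M : ℝ) ^ (-c) := by
  rcases le_total N M with h | h
  · rw [Finset.Ico_eq_empty (by omega), Finset.sum_empty]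
    positivity
  calc ∑ k ∈ Finset.Ico M N, (k : ℝ) ^ (-c - 1)
      ≤ ∑ k ∈ Finset.Ico M N, 2 * exp c / c * ((k : ℝ) ^ (-c) - ((k + 1 : ℕ) : ℝ) ^ (-c)) := by
        refine Finset.sum_le_sum fun k hk => ?_
        push_cast
        exact rpow_neg_sub_one_le_sub hc (by exact_mod_cast hM.trans (Finset.mem_Ico.1 hk).1)
    _ = 2 * exp c / c * ((M : ℝ) ^ (-c) - (N : ℝ) ^ (-c)) := by
        rw [← Finset.mul_sum, ← neg_sub ((N : ℝ) ^ (-c)),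
          ← Finset.sum_Ico_sub (fun k : ℕ => (k : ℝ) ^ (-c)) h, ← Finset.sum_neg_distrib]
        simp
    _ ≤ _ := by
        have h1 : 0 < 2 * exp c / c := by positivity
        have h2 : 0 ≤ (N : ℝ) ^ (-c) := by positivity
        nlinarith

/-! ### Periodic convolution and Hölder's inequality -/

lemma periodMeasure_integral (f : ℝ → ℝ) : ∫ t, f t ∂periodMeasure = ∫ t in (-π)..π, f t := by
  rw [intervalIntegral.integral_of_le (by linarith [pi_pos])]

lemma memLp_periodMeasure_of_continuous {f : ℝ → ℝ} (hf : Continuous f) (r : ℝ≥0∞) :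
    MemLp f r periodMeasure := by
  obtain ⟨C, hC⟩ := isCompact_Icc.exists_bound_of_continuousOn (s := Icc (-π) π) hf.continuousOn
  refine MemLp.of_bound hf.aestronglyMeasurable C ?_
  filter_upwards [ae_restrict_mem measurableSet_Ioc] with x hx
  exact hC x ⟨hx.1.le, hx.2⟩

lemma reflect_measurePreserving (x : ℝ) :
    MeasurePreserving (fun t => x - t) periodMeasure
      (volume.restrict (Ioc (x - π) (x - π + 2 * π))) := by
  have h := (Measure.measurePreserving_sub_left volume x).restrict_preimage
    (s := Ico (x - π) (x - π + 2 * π)) measurableSet_Ico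
  have e : (fun t => x - t) ⁻¹' Ico (x - π) (x - π + 2 * π) = Ioc (-π) π := by
    ext t
    simp only [mem_preimage, mem_Ico, mem_Ioc]
    constructor <;> rintro ⟨h1, h2⟩ <;> constructor <;> linarith
  -- Reflection exchanges the open and the closed endpoint; the two half-open intervals agree up to
  -- a null set.
  rw [e, Measure.restrict_congr_set Ico_ae_eq_Ioc] at h
  exact h

/-- Periodicity as invariance under the group of translations by multiples of 2π, the form in which
periods are compared as fundamental domains. -/
lemma periodic_vadd {F : ℝ → ℝ} (hF : Function.Periodic F (2 * π))
    (g : AddSubgroup.zmultiples (2 * π)) (x : ℝ) : F (g +ᵥ x) = F x := by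
  obtain ⟨g, n, rfl⟩ := g
  rw [AddSubgroup.vadd_def]
  simp only [vadd_eq_add]
  rw [add_comm]
  exact hF.zsmul n x

lemma aestronglyMeasurable_reflect {F : ℝ → ℝ} (hF : Function.Periodic F (2 * π))
    (hm : AEStronglyMeasurable F periodMeasure) (x : ℝ) :
    AEStronglyMeasurable F (volume.restrict (Ioc (x - π) (x - π + 2 * π))) := by
  refine ((isAddFundamentalDomain_Ioc two_pi_pos (x - π)).aestronglyMeasurable_on_iff
    (isAddFundamentalDomain_Ioc two_pi_pos (-π)) (periodic_vadd hF)).2 ?_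
  rwa [show -π + 2 * π = π by ring]

lemma eLpNorm_comp_sub {F : ℝ → ℝ} (hF : Function.Periodic F (2 * π))
    (hm : AEStronglyMeasurable F periodMeasure) {r : ℝ} (hr : 1 ≤ r) (x : ℝ) :
    eLpNorm (fun t => F (x - t)) (ENNReal.ofReal r) periodMeasure =
      eLpNorm F (ENNReal.ofReal r) periodMeasure := by
  have h1 := eLpNorm_comp_measurePreserving (p := ENNReal.ofReal r)
    (aestronglyMeasurable_reflect hF hm x) (reflect_measurePreserving x)
  refine Eq.trans h1 ?_
  have hr0 : 0 < r := by linarith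
  rw [eLpNorm_eq_lintegral_rpow_enorm_toReal (by simpa using hr0) ENNReal.ofReal_ne_top,
    eLpNorm_eq_lintegral_rpow_enorm_toReal (by simpa using hr0) ENNReal.ofReal_ne_top]
  congr 1
  have := (isAddFundamentalDomain_Ioc two_pi_pos (x - π)).setLIntegral_eq
    (isAddFundamentalDomain_Ioc two_pi_pos (-π))
    (fun t => ‖F t‖ₑ ^ (ENNReal.ofReal r).toReal) (fun g t => by rw [periodic_vadd hF])
  rwa [show -π + 2 * π = π by ring] at this

lemma memLp_comp_sub {F : ℝ → ℝ} (hF : Function.Periodic F (2 * π)) {r : ℝ} (hr : 1 ≤ r)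
    (hm : MemLp F (ENNReal.ofReal r) periodMeasure) (x : ℝ) :
    MemLp (fun t => F (x - t)) (ENNReal.ofReal r) periodMeasure := by
  refine ⟨(aestronglyMeasurable_reflect hF hm.1 x).comp_measurePreserving
    (reflect_measurePreserving x), ?_⟩
  rw [eLpNorm_comp_sub hF hm.1 hr]
  exact hm.2

/-- The convolution `(1/π) ∫_{-π}^{π} F(x - t) φ(t) dt`. -/
noncomputable def conv (F φ : ℝ → ℝ) (x : ℝ) : ℝ := 1 / π * ∫ t in (-π)..π, F (x - t) * φ t

section Holder

variable {p q : ℝ} {F φ : ℝ → ℝ}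

lemma conv_integrable (hpq : q.HolderConjugate p) (hF : Function.Periodic F (2 * π))
    (hFm : MemLp F (ENNReal.ofReal q) periodMeasure)
    (hφ : MemLp φ (ENNReal.ofReal p) periodMeasure) (x : ℝ) :
    IntervalIntegrable (fun t => F (x - t) * φ t) volume (-π) π := by
  rw [intervalIntegrable_iff_integrableOn_Ioc_of_le (by linarith [pi_pos])]
  have : ENNReal.HolderConjugate (ENNReal.ofReal q) (ENNReal.ofReal p) := hpq.ennrealOfReal
  exact (memLp_comp_sub hF hpq.lt.le hFm x).integrable_mul hφ

/-- Hölder's inequality together with the translation and reflection invariance of the norm on a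
period. The prefactor 1/π is merely bounded by 1. -/
lemma abs_conv_le (hpq : q.HolderConjugate p) (hF : Function.Periodic F (2 * π))
    (hFm : MemLp F (ENNReal.ofReal q) periodMeasure)
    (hφ : MemLp φ (ENNReal.ofReal p) periodMeasure)
    (hφ1 : eLpNorm φ (ENNReal.ofReal p) periodMeasure ≤ 1) {X : ℝ} (hX : 0 ≤ X)
    (hFX : eLpNorm F (ENNReal.ofReal q) periodMeasure ≤ ENNReal.ofReal X) (x : ℝ) :
    |conv F φ x| ≤ X := by
  have : ENNReal.HolderConjugate (ENNReal.ofReal q) (ENNReal.ofReal p) := hpq.ennrealOfReal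
  have hmem := memLp_comp_sub hF hpq.lt.le hFm x
  have h1 : ‖∫ t in (-π)..π, F (x - t) * φ t‖ₑ ≤ ENNReal.ofReal X := by
    rw [← periodMeasure_integral]
    refine (enorm_integral_le_lintegral_enorm _).trans ?_
    rw [← eLpNorm_one_eq_lintegral_enorm]
    have h2 := eLpNorm_smul_le_mul_eLpNorm (p := ENNReal.ofReal q) (q := ENNReal.ofReal p) (r := 1)
      hφ.1 hmem.1
    refine h2.trans ?_
    rw [eLpNorm_comp_sub hF hFm.1 hpq.lt.le]
    exact (mul_le_mul' hFX hφ1).trans (mul_one _).le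
  rw [Real.enorm_eq_ofReal_abs, ENNReal.ofReal_le_ofReal_iff hX] at h1
  rw [conv, abs_mul, abs_of_pos (by positivity)]
  calc 1 / π * |∫ t in (-π)..π, F (x - t) * φ t| ≤ 1 * X := by
        gcongr
        rw [div_le_one pi_pos]
        linarith [pi_gt_three]
    _ = X := one_mul X

lemma conv_sub {G : ℝ → ℝ} (hpq : q.HolderConjugate p) (hF : Function.Periodic F (2 * π))
    (hFm : MemLp F (ENNReal.ofReal q) periodMeasure) (hG : Function.Periodic G (2 * π))
    (hGm : MemLp G (ENNReal.ofReal q) periodMeasure)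
    (hφ : MemLp φ (ENNReal.ofReal p) periodMeasure) (x : ℝ) :
    conv (fun t => F t - G t) φ x = conv F φ x - conv G φ x := by
  rw [conv, conv, conv, ← mul_sub, ← intervalIntegral.integral_sub
    (conv_integrable hpq hF hFm hφ x) (conv_integrable hpq hG hGm hφ x)]
  simp only [sub_mul]

end Holder

lemma conv_comm {F φ : ℝ → ℝ} (hF : Function.Periodic F (2 * π))
    (hφ : Function.Periodic φ (2 * π)) (x : ℝ) : conv F φ x = conv φ F x := by
  have hper : Function.Periodic (fun u => φ (x - u) * F u) (2 * π) := by
    intro u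
    change φ (x - (u + 2 * π)) * F (u + 2 * π) = _
    rw [hF, show x - (u + 2 * π) = x - u - 2 * π by ring, hφ.sub_eq]
  have h1 := intervalIntegral.integral_comp_sub_left (a := -π) (b := π)
    (fun u => φ (x - u) * F u) x
  have h2 := hper.intervalIntegral_add_eq (x - π) (-π)
  rw [show x - π + 2 * π = x - -π by ring, show -π + 2 * π = π by ring] at h2
  rw [conv, conv, ← h2, ← h1]
  congr 1
  refine intervalIntegral.integral_congr fun t _ => ?_
  simp only [sub_sub_cancel]
  ring

/-! ### Orthogonality and trigonometric polynomials -/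

lemma integral_cos_add {m : ℤ} (hm : m ≠ 0) (c : ℝ) :
    ∫ x in (-π)..π, cos (m * x - c) = 0 := by
  have hm' : (m : ℝ) ≠ 0 := by exact_mod_cast hm
  rw [intervalIntegral.integral_comp_mul_sub (fun y => cos y) hm', integral_cos,
    show (m : ℝ) * π - c = m * -π - c + m * (2 * π) by ring, sin_add_int_mul_two_pi]
  simp

/-- Orthogonality of the trigonometric system. -/
lemma integral_cos_mul_cos (j k : ℕ) (hjk : 1 ≤ j + k) (η ζ : ℝ) :
    ∫ x in (-π)..π, cos (j * x - η) * cos (k * x - ζ) =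
      if j = k then π * cos (η - ζ) else 0 := by
  have e : ∀ x : ℝ, cos (j * x - η) * cos (k * x - ζ) =
      1 / 2 * cos (((j : ℤ) - k : ℤ) * x - (η - ζ)) +
        1 / 2 * cos (((j : ℤ) + k : ℤ) * x - (η + ζ)) := by
    intro x
    push_cast
    rw [show ((j : ℝ) - k) * x - (η - ζ) = (j * x - η) - (k * x - ζ) by ring,
      show ((j : ℝ) + k) * x - (η + ζ) = (j * x - η) + (k * x - ζ) by ring,
      cos_add (_ - _), cos_sub (_ - _)]
    ring
  simp only [e]
  rw [intervalIntegral.integral_add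
    (Continuous.intervalIntegrable (by fun_prop) _ _) (Continuous.intervalIntegrable (by fun_prop) _ _),
    intervalIntegral.integral_const_mul, intervalIntegral.integral_const_mul,
    integral_cos_add (m := (j : ℤ) + k) (by omega)]
  split_ifs with h
  · subst h
    simp [cos_sub]
    ring
  · rw [integral_cos_add (by omega)]
    simp

/-- The trigonometric polynomial with given coefficients. -/
noncomputable def trigPoly (a b : ℕ → ℝ) (N : ℕ) (x : ℝ) : ℝ :=
  a 0 / 2 + ∑ k ∈ Finset.Ico 1 N, (a k * cos (k * x) + b k * sin (k * x))

lemma continuous_trigPoly (a b : ℕ → ℝ) (N : ℕ) : Continuous (trigPoly a b N) := by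
  unfold trigPoly
  fun_prop

/-- Integration of a trigonometric polynomial against `cos (kx - ζ)`, `k ≥ 1`. -/
lemma integral_trigPoly_mul_cos (a b : ℕ → ℝ) (N k : ℕ) (hk : 1 ≤ k) (ζ : ℝ) :
    ∫ x in (-π)..π, trigPoly a b N x * cos (k * x - ζ) =
      if k < N then π * (a k * cos ζ + b k * sin ζ) else 0 := by
  -- The constant is a cosine of frequency 0 and each sine a cosine of phase π/2, so a single
  -- orthogonality relation covers all terms.
  have e : ∀ x : ℝ, trigPoly a b N x * cos (k * x - ζ) =
      a 0 / 2 * (cos ((0 : ℕ) * x - 0) * cos (k * x - ζ)) + ∑ j ∈ Finset.Ico 1 N,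
        (a j * (cos (j * x - 0) * cos (k * x - ζ)) +
          b j * (cos (j * x - π / 2) * cos (k * x - ζ))) := by
    intro x
    simp only [trigPoly, cos_sub_pi_div_two, sub_zero, Nat.cast_zero, zero_mul, cos_zero]
    rw [add_mul, Finset.sum_mul]
    congr 1
    · ring
    · exact Finset.sum_congr rfl fun j _ => by ring
  simp only [e]
  have hc : ∀ j : ℕ, ∀ η : ℝ, Continuous fun x : ℝ => cos (j * x - η) * cos (k * x - ζ) := by
    intro j η
    fun_prop
  have hci : ∀ (A : ℝ) (j : ℕ) (η : ℝ), IntervalIntegrable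
      (fun x : ℝ => A * (cos (j * x - η) * cos (k * x - ζ))) volume (-π) π := fun A j η =>
    (continuous_const.mul (hc j η)).intervalIntegrable _ _
  have hcj : ∀ j ∈ Finset.Ico 1 N, IntervalIntegrable
      (fun x : ℝ => a j * (cos (j * x - 0) * cos (k * x - ζ)) +
        b j * (cos (j * x - π / 2) * cos (k * x - ζ))) volume (-π) π := fun j _ =>
    (hci _ _ _).add (hci _ _ _)
  rw [intervalIntegral.integral_add (hci _ _ _)
    (Continuous.intervalIntegrable (by fun_prop) _ _),
    intervalIntegral.integral_finsetSum hcj,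
    intervalIntegral.integral_const_mul, integral_cos_mul_cos 0 k (by omega),
    if_neg (by omega : 0 ≠ k), mul_zero, zero_add]
  have hj : ∀ j ∈ Finset.Ico 1 N, ∫ x in (-π)..π, (a j * (cos (j * x - 0) * cos (k * x - ζ)) +
      b j * (cos (j * x - π / 2) * cos (k * x - ζ))) =
      if j = k then π * (a k * cos ζ + b k * sin ζ) else 0 := by
    intro j _
    rw [intervalIntegral.integral_add (hci _ _ _) (hci _ _ _),
      intervalIntegral.integral_const_mul, intervalIntegral.integral_const_mul,
      integral_cos_mul_cos j k (by omega), integral_cos_mul_cos j k (by omega)]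
    split_ifs with h
    · subst h
      rw [zero_sub, cos_neg, cos_pi_div_two_sub]
      ring
    · simp
  rw [Finset.sum_congr rfl hj, Finset.sum_ite_eq']
  simp [Finset.mem_Ico, hk]

lemma fourierCos_trigPoly (a b : ℕ → ℝ) (N k : ℕ) (hk : 1 ≤ k) :
    fourierCos (trigPoly a b N) k = if k < N then a k else 0 := by
  have := integral_trigPoly_mul_cos a b N k hk 0
  simp only [sub_zero] at this
  rw [fourierCos, this]
  split_ifs
  · simp
  · simp

lemma fourierSin_trigPoly (a b : ℕ → ℝ) (N k : ℕ) (hk : 1 ≤ k) :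
    fourierSin (trigPoly a b N) k = if k < N then b k else 0 := by
  have := integral_trigPoly_mul_cos a b N k hk (π / 2)
  simp only [cos_sub_pi_div_two] at this
  rw [fourierSin, this]
  split_ifs
  · simp
  · simp

lemma integral_trigPoly (a b : ℕ → ℝ) (N : ℕ) :
    ∫ x in (-π)..π, trigPoly a b N x = π * a 0 := by
  have hc : ∀ j ∈ Finset.Ico 1 N,
      ∫ x in (-π)..π, (a j * cos (j * x) + b j * sin (j * x)) = 0 := by
    intro j hj
    have hj1 := (Finset.mem_Ico.1 hj).1
    have h1 := integral_cos_add (m := j) (by omega) 0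
    have h2 := integral_cos_add (m := j) (by omega) (π / 2)
    simp only [sub_zero, cos_sub_pi_div_two, Int.cast_natCast] at h1 h2
    rw [intervalIntegral.integral_add (Continuous.intervalIntegrable (by fun_prop) _ _)
      (Continuous.intervalIntegrable (by fun_prop) _ _), intervalIntegral.integral_const_mul,
      intervalIntegral.integral_const_mul, h1, h2]
    simp
  simp only [trigPoly]
  rw [intervalIntegral.integral_add (Continuous.intervalIntegrable (by fun_prop) _ _)
      (Continuous.intervalIntegrable (by fun_prop) _ _), intervalIntegral.integral_finsetSum
      (fun j _ => Continuous.intervalIntegrable (by fun_prop) _ _), Finset.sum_congr rfl hc]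
  simp
  ring

lemma fourierCos_zero_trigPoly (a b : ℕ → ℝ) (N : ℕ) :
    fourierCos (trigPoly a b N) 0 = a 0 := by
  simp only [fourierCos, Nat.cast_zero, zero_mul, cos_zero, mul_one]
  rw [integral_trigPoly]
  field_simp

/-! ### Deviation of Zygmund sums and convolution with polynomials -/

/-- The multipliers of the deviation `f - Z_n^s(f)`. -/
noncomputable def zygmundMult (s : ℝ) (n k : ℕ) : ℝ := if k < n then ((k : ℝ) / n) ^ s else 1

/-- No order between n and N is needed: the coefficients of the polynomial vanish from N on, so both
cut-offs reduce to k < min(n, N). -/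
lemma sub_zygmundSum_trigPoly (a b : ℕ → ℝ) (N : ℕ) (s : ℝ) (n : ℕ) (x : ℝ) :
    trigPoly a b N x - zygmundSum s n (trigPoly a b N) x =
      ∑ k ∈ Finset.Ico 1 N, zygmundMult s n k * (a k * cos (k * x) + b k * sin (k * x)) := by
  rw [zygmundSum, fourierCos_zero_trigPoly, trigPoly, add_sub_add_left_eq_sub, sub_eq_iff_eq_add]
  have e1 : ∑ k ∈ Finset.Ico 1 n, (1 - ((k : ℝ) / n) ^ s) *
      (fourierCos (trigPoly a b N) k * cos (k * x) + fourierSin (trigPoly a b N) k * sin (k * x)) =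
      ∑ k ∈ (Finset.Ico 1 N) with k < n, (1 - ((k : ℝ) / n) ^ s) *
        (a k * cos (k * x) + b k * sin (k * x)) := by
    have hset : (Finset.Ico 1 N).filter (· < n) = (Finset.Ico 1 n).filter (· < N) := by
      ext k
      simp only [Finset.mem_filter, Finset.mem_Ico]
      omega
    rw [hset, Finset.sum_filter]
    refine Finset.sum_congr rfl fun k hk => ?_
    have hk1 := (Finset.mem_Ico.1 hk).1
    rw [fourierCos_trigPoly a b N k hk1, fourierSin_trigPoly a b N k hk1]
    split_ifs <;> simp
  rw [e1, Finset.sum_filter, ← Finset.sum_add_distrib]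
  refine Finset.sum_congr rfl fun k _ => ?_
  rw [zygmundMult]
  split_ifs <;> ring

lemma cos_sub_eq (k x θ : ℝ) : cos (k * x - θ) = cos θ * cos (k * x) + sin θ * sin (k * x) := by
  rw [cos_sub]; ring

/-- Convolution of a trigonometric polynomial with an integrable function. -/
lemma conv_cosSum {φ : ℝ → ℝ} (hφ : IntervalIntegrable φ volume (-π) π) (ν : ℕ → ℝ) (θ : ℝ)
    (N : ℕ) (x : ℝ) :
    conv (cosSum ν θ 1 N) φ x = ∑ k ∈ Finset.Ico 1 N, ν k *
      ((fourierCos φ k * cos θ - fourierSin φ k * sin θ) * cos (k * x) +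
        (fourierCos φ k * sin θ + fourierSin φ k * cos θ) * sin (k * x)) := by
  have e : ∀ t : ℝ, cosSum ν θ 1 N (x - t) * φ t = ∑ k ∈ Finset.Ico 1 N,
      (ν k * cos (k * x - θ) * (φ t * cos (k * t)) +
        ν k * sin (k * x - θ) * (φ t * sin (k * t))) := by
    intro t
    rw [cosSum, Finset.sum_mul]
    refine Finset.sum_congr rfl fun k _ => ?_
    rw [show (k : ℝ) * (x - t) - θ = (k * x - θ) - k * t by ring, cos_sub (_ - _)]
    ring
  have hc : ∀ k : ℕ, IntervalIntegrable (fun t => φ t * cos (k * t)) volume (-π) π := fun k =>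
    hφ.mul_continuousOn (Continuous.continuousOn (by fun_prop))
  have hs : ∀ k : ℕ, IntervalIntegrable (fun t => φ t * sin (k * t)) volume (-π) π := fun k =>
    hφ.mul_continuousOn (Continuous.continuousOn (by fun_prop))
  simp only [conv, e]
  rw [intervalIntegral.integral_finsetSum fun k _ => ((hc k).const_mul _).add ((hs k).const_mul _),
    Finset.mul_sum]
  refine Finset.sum_congr rfl fun k _ => ?_
  rw [intervalIntegral.integral_add ((hc k).const_mul _) ((hs k).const_mul _),
    intervalIntegral.integral_const_mul, intervalIntegral.integral_const_mul, fourierCos,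
    fourierSin, cos_sub, sin_sub]
  ring

lemma memLpPeriodic_intervalIntegrable {f : ℝ → ℝ} {r : ℝ} (hr : 1 ≤ r)
    (hf : MemLpPeriodic f r) : IntervalIntegrable f volume (-π) π := by
  rw [intervalIntegrable_iff_integrableOn_Ioc_of_le (by linarith [pi_pos])]
  exact hf.2.integrable (by simpa using hr)

/-- Convolution of a kernel with a trigonometric polynomial. -/
lemma conv_kernel_cosSum {ψ Ψ : ℝ → ℝ} {β q : ℝ} (hq : 1 ≤ q) (hΨ : IsKernel ψ β q Ψ)
    (c : ℕ → ℝ) (a N : ℕ) (ha : 1 ≤ a) (x : ℝ) :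
    conv Ψ (cosSum c (-(β * π / 2)) a N) x =
      ∑ k ∈ Finset.Ico a N, c k * ψ k * cos (k * x) := by
  have hcut : cosSum c (-(β * π / 2)) a N =
      cosSum (fun k => if a ≤ k then c k else 0) (-(β * π / 2)) 1 N := by
    ext t
    rw [cosSum, cosSum]
    simp only [ite_mul, zero_mul]
    rw [← Finset.sum_filter]
    refine Finset.sum_congr ?_ fun _ _ => rfl
    ext k
    simp only [Finset.mem_filter, Finset.mem_Ico]
    omega
  rw [hcut, conv_comm hΨ.1.1 (periodic_cosSum _ _ _ _),
    conv_cosSum (memLpPeriodic_intervalIntegrable hq hΨ.1)]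
  have hset : Finset.Ico a N = (Finset.Ico 1 N).filter (a ≤ ·) := by
    ext k
    simp only [Finset.mem_filter, Finset.mem_Ico]
    omega
  rw [hset, Finset.sum_filter]
  refine Finset.sum_congr rfl fun k hk => ?_
  obtain ⟨h1, h2⟩ := hΨ.2.2 k (Finset.mem_Ico.1 hk).1
  rw [h1, h2, cos_neg, sin_neg]
  split_ifs
  -- The opposite phases of the kernel and of the polynomial cancel: the cosine coefficient carries
  -- cos² + sin² = 1 and the sine coefficient is 0.
  · have := cos_sq_add_sin_sq (β * π / 2)
    linear_combination (c k * ψ k * cos (k * x)) * this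
  · simp

/-! ### Fourier uniqueness and existence of the kernel -/

/-- An integrable function all of whose Fourier coefficients vanish is zero almost everywhere. -/
theorem ae_eq_zero_of_fourier_eq_zero {h : ℝ → ℝ} (hh : Integrable h periodMeasure)
    (hc : ∀ k, fourierCos h k = 0) (hs : ∀ k, fourierSin h k = 0) : h =ᵐ[periodMeasure] 0 := by
  have : Fact (0 < 2 * π) := ⟨two_pi_pos⟩
  have hmeas : ∀ u : C(AddCircle (2 * π), ℂ),
      Continuous fun t : ℝ => u (t : AddCircle (2 * π)) := fun u =>
    u.continuous.comp (AddCircle.continuous_mk' _)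
  have hint : ∀ u : C(AddCircle (2 * π), ℂ),
      Integrable (fun t : ℝ => u (t : AddCircle (2 * π)) * (h t : ℂ)) periodMeasure := fun u =>
    hh.ofReal.bdd_mul (hmeas u).aestronglyMeasurable
      (c := ‖u‖) (ae_of_all _ fun t => u.norm_coe_le_norm _)
  let Φ₀ : C(AddCircle (2 * π), ℂ) →ₗ[ℂ] ℂ :=
    { toFun := fun u => ∫ t, u (t : AddCircle (2 * π)) * (h t : ℂ) ∂periodMeasure
      map_add' := fun u v => by
        rw [← integral_add (hint u) (hint v)]
        simp only [ContinuousMap.add_apply, add_mul]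
      map_smul' := fun c u => by
        rw [RingHom.id_apply, smul_eq_mul, ← integral_const_mul]
        simp only [ContinuousMap.smul_apply, smul_eq_mul, mul_assoc] }
  let Φ : C(AddCircle (2 * π), ℂ) →L[ℂ] ℂ := Φ₀.mkContinuous (∫ t, ‖h t‖ ∂periodMeasure) (by
    intro u
    refine (norm_integral_le_integral_norm _).trans ?_
    rw [mul_comm (∫ t, ‖h t‖ ∂periodMeasure), ← integral_const_mul]
    refine integral_mono (hint u).norm (hh.norm.const_mul _) fun t => ?_
    simp only [norm_mul, Complex.norm_real]
    exact mul_le_mul_of_nonneg_right (u.norm_coe_le_norm _) (norm_nonneg _))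
  have hC : ∀ k : ℕ, ∫ t, h t * cos (k * t) ∂periodMeasure = 0 := by
    intro k
    have := hc k
    rw [fourierCos, intervalIntegral.integral_of_le (by linarith [pi_pos])] at this
    exact (mul_eq_zero.1 this).resolve_left (by positivity)
  have hS : ∀ k : ℕ, ∫ t, h t * sin (k * t) ∂periodMeasure = 0 := by
    intro k
    have := hs k
    rw [fourierSin, intervalIntegral.integral_of_le (by linarith [pi_pos])] at this
    exact (mul_eq_zero.1 this).resolve_left (by positivity)
  have hCi : ∀ k : ℕ, Integrable (fun t => h t * cos (k * t)) periodMeasure := fun k =>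
    hh.mul_bdd (c := 1) (Continuous.aestronglyMeasurable (by fun_prop))
      (ae_of_all _ fun t => abs_cos_le_one _)
  have hSi : ∀ k : ℕ, Integrable (fun t => h t * sin (k * t)) periodMeasure := fun k =>
    hh.mul_bdd (c := 1) (Continuous.aestronglyMeasurable (by fun_prop))
      (ae_of_all _ fun t => abs_sin_le_one _)
  have hfour : ∀ m : ℤ, Φ (fourier m) = 0 := by
    intro m
    -- The exponential of index m reduces to the cosine and sine of frequency |m|, with the sign of
    -- m moved to the sine.
    obtain ⟨σ, k, hσ⟩ : ∃ (σ : ℝ) (k : ℕ), (m : ℝ) = σ * k ∧ (σ = 1 ∨ σ = -1) := by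
      rcases Int.natAbs_eq m with hm | hm
      · refine ⟨1, m.natAbs, ?_, Or.inl rfl⟩
        rw [one_mul]
        nth_rewrite 1 [hm]
        exact Int.cast_natCast _
      · refine ⟨-1, m.natAbs, ?_, Or.inr rfl⟩
        rw [neg_one_mul]
        nth_rewrite 1 [hm]
        rw [Int.cast_neg, Int.cast_natCast]
    have e : ∀ t : ℝ, (fourier m (t : AddCircle (2 * π)) : ℂ) * (h t : ℂ) =
        ((h t * cos (k * t) : ℝ) : ℂ) + (σ * Complex.I) * ((h t * sin (k * t) : ℝ) : ℂ) := by
      intro t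
      rw [fourier_coe_apply]
      have h1 : 2 * π * Complex.I * m * t / ((2 * π : ℝ) : ℂ) = ((m * t : ℝ) : ℂ) * Complex.I := by
        push_cast
        field_simp
      rw [h1, Complex.exp_mul_I, ← Complex.ofReal_cos, ← Complex.ofReal_sin, hσ.1]
      rcases hσ.2 with rfl | rfl
      · push_cast
        simp only [one_mul]
        ring
      · rw [show -1 * (k : ℝ) * t = -(k * t) by ring, cos_neg, sin_neg]
        push_cast
        ring
    change ∫ t, (fourier m (t : AddCircle (2 * π)) : ℂ) * (h t : ℂ) ∂periodMeasure = 0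
    simp only [e]
    rw [integral_add (hCi k).ofReal ((hSi k).ofReal.const_mul _), integral_const_mul,
      integral_complex_ofReal, integral_complex_ofReal, hC, hS]
    simp
  have hker : ∀ u, Φ u = 0 := by
    -- The exponentials span a dense subspace of the continuous functions on the circle, so the
    -- continuous functional `Φ` vanishes identically.
    have h1 : Submodule.span ℂ (range (@fourier (2 * π))) ≤ LinearMap.ker Φ.toLinearMap := by
      rw [Submodule.span_le]
      rintro _ ⟨m, rfl⟩
      exact hfour m
    have h2 := Submodule.topologicalClosure_minimal _ h1 Φ.isClosed_ker
    rw [span_fourier_closure_eq_top] at h2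
    exact fun u => h2 (Submodule.mem_top (x := u))
  -- A smooth function supported in the open interval vanishes at ±π and hence descends to a
  -- continuous function on the circle, to which the vanishing of `Φ` applies.
  have hloc : ∀ᵐ x ∂volume, x ∈ Ioo (-π) π → h x = 0 := by
    refine isOpen_Ioo.ae_eq_zero_of_integral_contDiff_smul_eq_zero
      ((IntegrableOn.mono_set hh Ioo_subset_Ioc_self).locallyIntegrableOn) ?_
    intro g hg _ hsupp
    have hz : ∀ x, x ∉ Ioo (-π) π → g x = 0 := fun x hx =>
      image_eq_zero_of_notMem_tsupport fun h => hx (hsupp h)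
    have hπ : -π + 2 * π = π := by ring
    have hends : ((g (-π) : ℝ) : ℂ) = ((g (-π + 2 * π) : ℝ) : ℂ) := by
      rw [hπ, hz _ (by simp), hz _ (by simp)]
    let u : C(AddCircle (2 * π), ℂ) := ⟨AddCircle.liftIoc (2 * π) (-π) (fun t => (g t : ℂ)),
      AddCircle.liftIoc_continuous hends
        (Complex.continuous_ofReal.comp hg.continuous).continuousOn⟩
    have hu := hker u
    change ∫ t in Ioc (-π) π, AddCircle.liftIoc (2 * π) (-π) (fun t => (g t : ℂ))
      (t : AddCircle (2 * π)) * (h t : ℂ) = 0 at hu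
    have hu2 : ∫ t in Ioc (-π) π, ((g t * h t : ℝ) : ℂ) = 0 := by
      rw [← hu]
      refine setIntegral_congr_fun measurableSet_Ioc fun t ht => ?_
      rw [AddCircle.liftIoc_coe_apply (by rwa [hπ])]
      push_cast
      rfl
    rw [integral_complex_ofReal, Complex.ofReal_eq_zero] at hu2
    simp only [smul_eq_mul]
    rw [← hu2, setIntegral_eq_integral_of_forall_compl_eq_zero]
    intro x hx
    rw [hz x fun h => hx (Ioo_subset_Ioc_self h), zero_mul]
  rw [periodMeasure, Measure.restrict_congr_set Ioo_ae_eq_Ioc.symm]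
  exact (ae_restrict_iff' measurableSet_Ioo).2 hloc

lemma fourier_tendsto {F : ℕ → ℝ → ℝ} {f : ℝ → ℝ} (hF : ∀ N, Integrable (F N) periodMeasure)
    (hf : Integrable f periodMeasure)
    (h : Tendsto (fun N => eLpNorm (F N - f) 1 periodMeasure) atTop (𝓝 0)) (k : ℕ) :
    Tendsto (fun N => fourierCos (F N) k) atTop (𝓝 (fourierCos f k)) ∧
      Tendsto (fun N => fourierSin (F N) k) atTop (𝓝 (fourierSin f k)) := by
  have key : ∀ c : ℝ → ℝ, Continuous c → (∀ t, |c t| ≤ 1) →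
      Tendsto (fun N => 1 / π * ∫ t in (-π)..π, F N t * c t) atTop
        (𝓝 (1 / π * ∫ t in (-π)..π, f t * c t)) := by
    intro c hc hc1
    refine Tendsto.const_mul _ ?_
    simp only [← periodMeasure_integral]
    have hmul : ∀ g : ℝ → ℝ, Integrable g periodMeasure →
        Integrable (fun t => g t * c t) periodMeasure := fun g hg =>
      hg.mul_bdd (c := 1) hc.aestronglyMeasurable (ae_of_all _ hc1)
    refine tendsto_integral_of_L1' _ (hmul f hf).1 (Eventually.of_forall fun N => hmul _ (hF N)) ?_
    refine tendsto_of_tendsto_of_tendsto_of_le_of_le tendsto_const_nhds h (fun _ => zero_le) ?_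
    intro N
    refine eLpNorm_mono fun t => ?_
    simp only [Pi.sub_apply, ← sub_mul, norm_mul]
    exact mul_le_of_le_one_right (norm_nonneg _) (hc1 t)
  exact ⟨key _ (by fun_prop) fun t => abs_cos_le_one _,
    key _ (by fun_prop) fun t => abs_sin_le_one _⟩

lemma tendsto_eLpNorm_one {F : ℕ → ℝ → ℝ} {q : ℝ} (hq : 1 ≤ q)
    (hm : ∀ N, AEStronglyMeasurable (F N) periodMeasure)
    (h : Tendsto (fun N => eLpNorm (F N) (ENNReal.ofReal q) periodMeasure) atTop (𝓝 0)) :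
    Tendsto (fun N => eLpNorm (F N) 1 periodMeasure) atTop (𝓝 0) := by
  have hq' : (1 : ℝ≥0∞) ≤ ENNReal.ofReal q := by simpa using hq
  set C := periodMeasure univ ^ (1 / (1 : ℝ≥0∞).toReal - 1 / (ENNReal.ofReal q).toReal) with hC
  have hCtop : C ≠ ∞ := by
    refine ENNReal.rpow_ne_top_of_nonneg ?_ (measure_ne_top _ _)
    rw [ENNReal.toReal_one, ENNReal.toReal_ofReal (by linarith), sub_nonneg]
    simpa using inv_le_one_of_one_le₀ hq
  have h0 := ENNReal.Tendsto.mul_const h (Or.inr hCtop)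
  rw [zero_mul] at h0
  exact tendsto_of_tendsto_of_tendsto_of_le_of_le tendsto_const_nhds h0 (fun _ => zero_le)
    fun N => eLpNorm_le_eLpNorm_mul_rpow_measure_univ hq' (hm N)

lemma cosSum_eq_trigPoly (ν : ℕ → ℝ) (θ : ℝ) {a : ℕ} (ha : 1 ≤ a) (N : ℕ) :
    cosSum ν θ a N = trigPoly (fun k => if a ≤ k then ν k * cos θ else 0)
      (fun k => if a ≤ k then ν k * sin θ else 0) N := by
  ext x
  have h0 : ¬ a ≤ 0 := by omega
  have hset : Finset.Ico a N = (Finset.Ico 1 N).filter (a ≤ ·) := by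
    ext k
    simp only [Finset.mem_filter, Finset.mem_Ico]
    omega
  rw [cosSum, trigPoly, hset, Finset.sum_filter, if_neg h0, zero_div, zero_add]
  refine Finset.sum_congr rfl fun k _ => ?_
  rw [cos_sub_eq]
  split_ifs
  · ring
  · simp

/-- The partial sums of the kernel are Cauchy in `L_q` with rate `τ`. -/
structure HasTailBound (u : ℕ → ℝ) (q : ℝ) (τ : ℕ → ℝ) : Prop where
  tendsto : Tendsto τ atTop (𝓝 0)
  nonneg : ∀ n, 1 ≤ n → 0 ≤ τ n
  bound : ∀ (θ : ℝ) (n N : ℕ), 1 ≤ n → n ≤ N →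
    eLpNorm (cosSum u θ n N) (ENNReal.ofReal q) periodMeasure ≤ ENNReal.ofReal (τ n)

lemma cosSum_sub_cosSum (u : ℕ → ℝ) (θ : ℝ) {a n N : ℕ} (h1 : a ≤ n) (h2 : n ≤ N) :
    cosSum u θ a N - cosSum u θ a n = cosSum u θ n N := by
  ext x
  rw [Pi.sub_apply, sub_eq_iff_eq_add', cosSum, cosSum, cosSum]
  exact (Finset.sum_Ico_consecutive _ h1 h2).symm

/-- The tail bound makes the partial sums Cauchy in L_q. The limit inherits their Fourier
coefficients, because L_q convergence on a period implies L_1 convergence. -/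
theorem exists_kernel {ψ : ℝ → ℝ} {q : ℝ} (hq : 1 ≤ q) {τ : ℕ → ℝ}
    (hτ : HasTailBound (fun k => ψ k) q τ) (β : ℝ) : ∃ Ψ, IsKernel ψ β q Ψ ∧
      Tendsto (fun N : ℕ => eLpNorm (Ψ - cosSum (fun k => ψ k) (β * π / 2) 1 N)
        (ENNReal.ofReal q) periodMeasure) atTop (𝓝 0) := by
  set θ := β * π / 2
  set u : ℕ → ℝ := fun k => ψ k with hu
  have : Fact (1 ≤ ENNReal.ofReal q) := ⟨by simpa using hq⟩
  have hmem : ∀ N, MemLp (cosSum u θ 1 N) (ENNReal.ofReal q) periodMeasure := fun N =>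
    memLp_periodMeasure_of_continuous (continuous_cosSum _ _ _ _) _
  -- The index is shifted by one since the tail bound is available only from 1 on.
  let f : ℕ → Lp ℝ (ENNReal.ofReal q) periodMeasure := fun N => (hmem (N + 1)).toLp _
  have hdist : ∀ n m, n ≤ m → dist (f m) (f n) ≤ τ (n + 1) := by
    intro n m hnm
    rw [dist_eq_norm, ← MemLp.toLp_sub, Lp.norm_toLp, cosSum_sub_cosSum u θ (by omega) (by omega)]
    exact ENNReal.toReal_le_of_le_ofReal (hτ.nonneg _ (by omega))
      (hτ.bound θ _ _ (by omega) (by omega))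
  have hcau : CauchySeq f := by
    refine cauchySeq_of_le_tendsto_0 (fun N => 2 * τ (N + 1)) (fun n m N hn hm => ?_) ?_
    · have := dist_triangle_right (f n) (f m) (f N)
      linarith [hdist N n hn, hdist N m hm]
    · simpa using ((tendsto_add_atTop_iff_nat 1).2 hτ.tendsto).const_mul 2
  obtain ⟨G, hG⟩ := cauchySeq_tendsto_of_complete hcau
  -- The limit class lives on one period; its representative is extended periodically to the line.
  let Ψ : ℝ → ℝ := fun x => G (toIocMod two_pi_pos (-π) x)
  have hΨG : Ψ =ᵐ[periodMeasure] G := by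
    filter_upwards [ae_restrict_mem measurableSet_Ioc] with x hx
    have : toIocMod two_pi_pos (-π) x = x := by
      rw [toIocMod_eq_self, show -π + 2 * π = π by ring]
      exact hx
    simp only [Ψ, this]
  have hper : Function.Periodic Ψ (2 * π) := fun x => by
    simp only [Ψ, toIocMod_add_right]
  have hΨm : MemLp Ψ (ENNReal.ofReal q) periodMeasure := (memLp_congr_ae hΨG).2 (Lp.memLp G)
  have hlim : Tendsto (fun N : ℕ => eLpNorm (cosSum u θ 1 N - Ψ)
      (ENNReal.ofReal q) periodMeasure) atTop (𝓝 0) := by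
    rw [← tendsto_add_atTop_iff_nat 1]
    refine (Lp.tendsto_Lp_iff_tendsto_eLpNorm' f G).1 hG |>.congr fun N => ?_
    refine eLpNorm_congr_ae ?_
    filter_upwards [hΨG, (hmem (N + 1)).coeFn_toLp] with x h1 h2
    simp only [Pi.sub_apply, h1]
    rw [h2]
  have hint : ∀ N, Integrable (cosSum u θ 1 N) periodMeasure := fun N =>
    (hmem N).integrable (by simpa using hq)
  have hcoef := fourier_tendsto hint (hΨm.integrable (by simpa using hq))
    (tendsto_eLpNorm_one hq (fun N => (hint N).1.sub hΨm.1) hlim)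
  refine ⟨Ψ, ⟨⟨hper, hΨm⟩, ?_, fun k hk => ⟨?_, ?_⟩⟩, ?_⟩
  · refine tendsto_nhds_unique (hcoef 0).1 ?_
    simp only [cosSum_eq_trigPoly u θ le_rfl, fourierCos_zero_trigPoly]
    simp
  · refine tendsto_nhds_unique (hcoef k).1 ?_
    refine tendsto_const_nhds.congr' ?_
    filter_upwards [eventually_gt_atTop k] with N hN
    rw [cosSum_eq_trigPoly u θ le_rfl, fourierCos_trigPoly _ _ _ _ hk, if_pos hN, if_pos hk]
  · refine tendsto_nhds_unique (hcoef k).2 ?_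
    refine tendsto_const_nhds.congr' ?_
    filter_upwards [eventually_gt_atTop k] with N hN
    rw [cosSum_eq_trigPoly u θ le_rfl, fourierSin_trigPoly _ _ _ _ hk, if_pos hN, if_pos hk]
  · refine hlim.congr fun N => ?_
    exact eLpNorm_sub_comm _ _ _ _

lemma kernel_unique {ψ : ℝ → ℝ} {β q : ℝ} (hq : 1 ≤ q) {Ψ₁ Ψ₂ : ℝ → ℝ} (h₁ : IsKernel ψ β q Ψ₁)
    (h₂ : IsKernel ψ β q Ψ₂) : Ψ₁ =ᵐ[periodMeasure] Ψ₂ := by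
  have i₁ : Integrable Ψ₁ periodMeasure := h₁.1.2.integrable (by simpa using hq)
  have i₂ : Integrable Ψ₂ periodMeasure := h₂.1.2.integrable (by simpa using hq)
  have j₁ := memLpPeriodic_intervalIntegrable hq h₁.1
  have j₂ := memLpPeriodic_intervalIntegrable hq h₂.1
  have hc : ∀ k, fourierCos (Ψ₁ - Ψ₂) k = fourierCos Ψ₁ k - fourierCos Ψ₂ k := by
    intro k
    have hk : ContinuousOn (fun t : ℝ => cos (k * t)) (uIcc (-π) π) :=
      Continuous.continuousOn (by fun_prop)
    simp only [fourierCos, Pi.sub_apply, sub_mul]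
    rw [intervalIntegral.integral_sub (j₁.mul_continuousOn hk) (j₂.mul_continuousOn hk), mul_sub]
  have hs : ∀ k, fourierSin (Ψ₁ - Ψ₂) k = fourierSin Ψ₁ k - fourierSin Ψ₂ k := by
    intro k
    have hk : ContinuousOn (fun t : ℝ => sin (k * t)) (uIcc (-π) π) :=
      Continuous.continuousOn (by fun_prop)
    simp only [fourierSin, Pi.sub_apply, sub_mul]
    rw [intervalIntegral.integral_sub (j₁.mul_continuousOn hk) (j₂.mul_continuousOn hk), mul_sub]
  have h := ae_eq_zero_of_fourier_eq_zero (i₁.sub i₂) (fun k => ?_) (fun k => ?_)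
  · filter_upwards [h] with x hx
    exact sub_eq_zero.1 hx
  · rw [hc]
    rcases Nat.eq_zero_or_pos k with rfl | hk
    · rw [h₁.2.1, h₂.2.1, sub_zero]
    · rw [(h₁.2.2 k hk).1, (h₂.2.2 k hk).1, sub_self]
  · rw [hs]
    rcases Nat.eq_zero_or_pos k with rfl | hk
    · simp [fourierSin]
    · rw [(h₁.2.2 k hk).2, (h₂.2.2 k hk).2, sub_self]

/-- Membership in the class supplies some kernel, not the constructed one; by `kernel_unique` both
are almost everywhere equal, so the convergence transfers. -/
lemma kernel_tendsto {ψ : ℝ → ℝ} {β q : ℝ} (hq : 1 ≤ q) {τ : ℕ → ℝ}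
    (hτ : HasTailBound (fun k => ψ k) q τ) {Ψ : ℝ → ℝ} (hΨ : IsKernel ψ β q Ψ) :
    Tendsto (fun N : ℕ => eLpNorm (Ψ - cosSum (fun k => ψ k) (β * π / 2) 1 N)
        (ENNReal.ofReal q) periodMeasure) atTop (𝓝 0) := by
  obtain ⟨Ψ', h', hlim⟩ := exists_kernel hq hτ β
  have hae := kernel_unique hq hΨ h'
  refine hlim.congr fun N => eLpNorm_congr_ae ?_
  filter_upwards [hae] with x hx
  simp only [Pi.sub_apply, hx]

/-- A Zygmund sum at a point is a finite combination of Fourier coefficients, which are continuous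
under L_1 and hence under uniform convergence. -/
lemma zygmundSum_tendsto {F : ℕ → ℝ → ℝ} {f : ℝ → ℝ} (hF : ∀ N, Continuous (F N))
    (h : TendstoUniformly F f atTop) (s : ℝ) (n : ℕ) (x : ℝ) :
    Tendsto (fun N => zygmundSum s n (F N) x) atTop (𝓝 (zygmundSum s n f x)) := by
  have hf : Continuous f := h.continuous (Frequently.of_forall hF)
  have hint : ∀ g : ℝ → ℝ, Continuous g → Integrable g periodMeasure := fun g hg =>
    memLp_one_iff_integrable.1 (memLp_periodMeasure_of_continuous hg 1)
  have hL1 : Tendsto (fun N => eLpNorm (F N - f) 1 periodMeasure) atTop (𝓝 0) := by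
    rw [ENNReal.tendsto_nhds_zero]
    intro ε hε
    have hC : periodMeasure univ ≠ ∞ := measure_ne_top _ _
    obtain ⟨δ, hδ, hδε⟩ : ∃ δ : ℝ, 0 < δ ∧ periodMeasure univ * ENNReal.ofReal δ ≤ ε := by
      have h1 : Tendsto (fun δ : ℝ => periodMeasure univ * ENNReal.ofReal δ) (𝓝[>] 0) (𝓝 0) := by
        have := ENNReal.Tendsto.const_mul (a := periodMeasure univ)
          (ENNReal.continuous_ofReal.tendsto 0) (Or.inr hC)
        rw [ENNReal.ofReal_zero, mul_zero] at this
        exact this.mono_left nhdsWithin_le_nhds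
      obtain ⟨δ, h2, h3⟩ := ((ENNReal.tendsto_nhds_zero.1 h1 ε hε).and self_mem_nhdsWithin).exists
      exact ⟨δ, h3, h2⟩
    filter_upwards [Metric.tendstoUniformly_iff.1 h δ hδ] with N hN
    refine le_trans (eLpNorm_le_of_ae_bound (C := δ) (ae_of_all _ fun t => ?_)) ?_
    · have := (hN t).le
      rwa [dist_comm, dist_eq_norm] at this
    · simpa using hδε
  have hcoef := fourier_tendsto (fun N => hint _ (hF N)) (hint _ hf) hL1
  refine ((hcoef 0).1.div_const 2).add (tendsto_finsetSum _ fun k _ => Tendsto.const_mul _ ?_)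
  exact ((hcoef k).1.mul_const _).add ((hcoef k).2.mul_const _)

/-! ### Error bounds in terms of norms of polynomials -/

section Bounds

variable {p s : ℝ} {ψ : ℝ → ℝ} {τ : ℕ → ℝ}

/-- The `L_q` bound of the partial sums of the deviation kernel. -/
lemma eLpNorm_deviation_le {u : ℕ → ℝ} {q : ℝ} (hq : 1 ≤ q) (hτ : HasTailBound u q τ) {n : ℕ}
    (hn : 1 ≤ n) {L : ℝ} (hL : 0 ≤ L) {θ : ℝ}
    (hlow : eLpNorm (cosSum (fun k => (k : ℝ) ^ s * u k) θ 1 n) (ENNReal.ofReal q)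
      periodMeasure ≤ ENNReal.ofReal L) {N : ℕ} (hN : n ≤ N) :
    eLpNorm (cosSum (fun k => zygmundMult s n k * u k) θ 1 N) (ENNReal.ofReal q) periodMeasure ≤
      ENNReal.ofReal (τ n + 1 / (n : ℝ) ^ s * L) := by
  have hn0 : (0 : ℝ) < n := by exact_mod_cast hn
  have hq' : (1 : ℝ≥0∞) ≤ ENNReal.ofReal q := by simpa using hq
  have hsplit : cosSum (fun k => zygmundMult s n k * u k) θ 1 N =
      cosSum u θ n N + (1 / (n : ℝ) ^ s) • cosSum (fun k => (k : ℝ) ^ s * u k) θ 1 n := by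
    ext x
    simp only [Pi.add_apply, Pi.smul_apply, smul_eq_mul, cosSum]
    rw [← Finset.sum_Ico_consecutive _ hn hN, add_comm, Finset.mul_sum]
    congr 1
    · refine Finset.sum_congr rfl fun k hk => ?_
      rw [zygmundMult, if_neg (by have := Finset.mem_Ico.1 hk; omega), one_mul]
    · refine Finset.sum_congr rfl fun k hk => ?_
      rw [zygmundMult, if_pos (Finset.mem_Ico.1 hk).2, div_rpow (by positivity) hn0.le]
      ring
  rw [hsplit, ENNReal.ofReal_add (hτ.nonneg n hn) (by positivity), ENNReal.ofReal_mul (by positivity)]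
  refine (eLpNorm_add_le (continuous_cosSum _ _ _ _).aestronglyMeasurable
    ((continuous_cosSum _ _ _ _).const_smul _).aestronglyMeasurable hq').trans ?_
  refine add_le_add (hτ.bound θ n N hn hN) ?_
  rw [eLpNorm_const_smul, Real.enorm_eq_ofReal_abs, abs_of_pos (by positivity)]
  exact mul_le_mul_right hlow _

/-- Every f in the class is a uniform limit of polynomials whose deviation is explicitly the
convolution of φ with a finite multiplier sum. Hölder bounds these deviations uniformly in N, and
the bound survives the limit. -/
theorem zygmundError_le (hp : 1 < p) (hτ : HasTailBound (fun k => ψ k) p.conjExponent τ) {n : ℕ}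
    (hn : 1 ≤ n) {L : ℝ} (hL : 0 ≤ L) (β : ℝ)
    (hlow : eLpNorm (cosSum (fun k => (k : ℝ) ^ s * ψ k) (β * π / 2) 1 n)
      (ENNReal.ofReal p.conjExponent) periodMeasure ≤ ENNReal.ofReal L) :
    zygmundError ψ p s β n ≤ ENNReal.ofReal (τ n + 1 / (n : ℝ) ^ s * L) := by
  set q := p.conjExponent
  have hpq : q.HolderConjugate p := (HolderConjugate.conjExponent hp).symm
  have hq : 1 ≤ q := hpq.lt.le
  set θ := β * π / 2
  set u : ℕ → ℝ := fun k => ψ k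
  set X := τ n + 1 / (n : ℝ) ^ s * L
  have hX : 0 ≤ X := add_nonneg (hτ.nonneg n hn) (by positivity)
  refine iSup₂_le ?_
  rintro f ⟨Ψ, φ, a₀, hΨ, hφ, hφ1, -, hf⟩
  have hmemS : ∀ (v : ℕ → ℝ) (N : ℕ), MemLp (cosSum v θ 1 N) (ENNReal.ofReal q) periodMeasure :=
    fun v N => memLp_periodMeasure_of_continuous (continuous_cosSum _ _ _ _) _
  have hφi := memLpPeriodic_intervalIntegrable hp.le hφ
  let a : ℕ → ℝ := fun k => if k = 0 then a₀ else
    u k * (fourierCos φ k * cos θ - fourierSin φ k * sin θ)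
  let b : ℕ → ℝ := fun k => u k * (fourierCos φ k * sin θ + fourierSin φ k * cos θ)
  have hab : ∀ (lam : ℕ → ℝ) (N : ℕ) (x : ℝ), conv (cosSum (fun k => lam k * u k) θ 1 N) φ x =
      ∑ k ∈ Finset.Ico 1 N, lam k * (a k * cos (k * x) + b k * sin (k * x)) := by
    intro lam N x
    rw [conv_cosSum hφi]
    refine Finset.sum_congr rfl fun k hk => ?_
    have hk0 : k ≠ 0 := by have := Finset.mem_Ico.1 hk; omega
    simp only [a, b, if_neg hk0]
    ring
  have hTN : ∀ N x, trigPoly a b N x = a₀ / 2 + conv (cosSum u θ 1 N) φ x := by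
    intro N x
    have := hab (fun _ => 1) N x
    simp only [one_mul] at this
    rw [this, trigPoly]
    simp [a]
  -- Hölder turns the L_q convergence of the kernel sums into convergence uniform in x.
  have hunif : TendstoUniformly (fun N => trigPoly a b N) f atTop := by
    rw [Metric.tendstoUniformly_iff]
    intro ε hε
    have hlim := ENNReal.tendsto_nhds_zero.1 (kernel_tendsto hq hτ hΨ) (ENNReal.ofReal (ε / 2))
      (by simpa using hε)
    filter_upwards [hlim] with N hN x
    have hsub := conv_sub hpq hΨ.1.1 hΨ.1.2 (periodic_cosSum u θ 1 N) (hmemS u N) hφ.2 x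
    have hle := abs_conv_le hpq (hΨ.1.1.sub (periodic_cosSum u θ 1 N))
      (hΨ.1.2.sub (hmemS u N)) hφ.2 hφ1 (by positivity) hN x
    have e : f x - trigPoly a b N x = conv (Ψ - cosSum u θ 1 N) φ x := by
      rw [hf, hTN, add_sub_add_left_eq_sub]
      exact hsub.symm
    rw [dist_eq_norm, e, Real.norm_eq_abs]
    linarith
  refine iSup_le fun x => ?_
  rw [Real.enorm_eq_ofReal_abs]
  refine ENNReal.ofReal_le_ofReal ?_
  have hlim : Tendsto (fun N => |trigPoly a b N x - zygmundSum s n (trigPoly a b N) x|) atTop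
      (𝓝 |f x - zygmundSum s n f x|) :=
    ((hunif.tendsto_at x).sub (zygmundSum_tendsto (fun N => continuous_trigPoly a b N) hunif
      s n x)).abs
  refine le_of_tendsto hlim ?_
  filter_upwards [eventually_ge_atTop n] with N hN
  rw [sub_zygmundSum_trigPoly, ← hab]
  exact abs_conv_le hpq (periodic_cosSum _ _ _ _) (hmemS _ _) hφ.2 hφ1 hX
    (eLpNorm_deviation_le hq hτ hn hL hlow hN) x

/-- The density is the polynomial of phase -βπ/2 divided by the bound Y of its norm. It has mean
zero as a ≥ 1, and its phase cancels that of the kernel. -/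
lemma cosSum_mem_convClass (hp : 1 < p) (hτ : HasTailBound (fun k => ψ k) p.conjExponent τ) (β : ℝ)
    {c : ℕ → ℝ} {a N : ℕ} (ha : 1 ≤ a) {Y : ℝ} (hY : 0 < Y)
    (hc : eLpNorm (cosSum c (-(β * π / 2)) a N) (ENNReal.ofReal p) periodMeasure ≤
      ENNReal.ofReal Y) :
    cosSum (fun k => c k * ψ k / Y) 0 a N ∈ convClass ψ β p := by
  set q := p.conjExponent with hq_def
  have hpq : q.HolderConjugate p := (HolderConjugate.conjExponent hp).symm
  have hq : 1 ≤ q := hpq.lt.le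
  set θ := β * π / 2
  obtain ⟨Ψ, hΨ, -⟩ := exists_kernel hq hτ β
  have hscale : cosSum (fun k => c k / Y) (-θ) a N = (1 / Y) • cosSum c (-θ) a N := by
    ext x
    simp only [cosSum, Pi.smul_apply, smul_eq_mul, Finset.mul_sum]
    exact Finset.sum_congr rfl fun k _ => by ring
  refine ⟨Ψ, cosSum (fun k => c k / Y) (-θ) a N, 0, hΨ, ⟨periodic_cosSum _ _ _ _,
    memLp_periodMeasure_of_continuous (continuous_cosSum _ _ _ _) _⟩, ?_, ?_, fun x => ?_⟩
  · rw [periodNorm, hscale, eLpNorm_const_smul, Real.enorm_eq_ofReal_abs,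
      abs_of_pos (by positivity)]
    refine (mul_le_mul_right hc _).trans ?_
    rw [← ENNReal.ofReal_mul (by positivity), one_div_mul_cancel hY.ne', ENNReal.ofReal_one]
  · rw [cosSum_eq_trigPoly _ _ ha, integral_trigPoly, if_neg (by omega), mul_zero]
  · have h := conv_kernel_cosSum hq hΨ (fun k => c k / Y) a N ha x
    rw [conv] at h
    rw [h, zero_div, zero_add, cosSum]
    refine Finset.sum_congr rfl fun k _ => ?_
    rw [sub_zero]
    ring

lemma le_zygmundError (hp : 1 < p) (hτ : HasTailBound (fun k => ψ k) p.conjExponent τ) (β : ℝ)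
    (n : ℕ) {c : ℕ → ℝ} {N : ℕ} {Y : ℝ} (hY : 0 < Y)
    (hc : eLpNorm (cosSum c (-(β * π / 2)) 1 N) (ENNReal.ofReal p) periodMeasure ≤
      ENNReal.ofReal Y) :
    ENNReal.ofReal ((∑ k ∈ Finset.Ico 1 N, zygmundMult s n k * (c k * ψ k)) / Y) ≤
      zygmundError ψ p s β n := by
  have hmem := cosSum_mem_convClass hp hτ β le_rfl hY hc
  refine le_trans ?_ (le_iSup₂ (f := fun f _ => supNorm (fun t => f t - zygmundSum s n f t)) _ hmem)
  -- At 0 all the cosines equal 1, so the deviation is the plain sum of its coefficients.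
  refine le_trans ?_ (le_iSup _ (0 : ℝ))
  rw [Real.enorm_eq_ofReal_abs]
  refine ENNReal.ofReal_le_ofReal (le_trans (le_of_eq ?_) (le_abs_self _))
  beta_reduce
  rw [cosSum_eq_trigPoly _ _ le_rfl, sub_zygmundSum_trigPoly, Finset.sum_div]
  refine Finset.sum_congr rfl fun k hk => ?_
  rw [if_pos (Finset.mem_Ico.1 hk).1]
  simp
  ring

/-- The Zygmund sum is itself a competitor of order at most n - 1. -/
lemma bestApprox_le_zygmundError (β : ℝ) (n : ℕ) :
    bestApprox ψ p β n ≤ zygmundError ψ p s β n := by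
  refine iSup₂_mono fun f _ => iInf₂_le _ ?_
  refine ⟨fun k => if k = 0 then fourierCos f 0 else (1 - ((k : ℝ) / n) ^ s) * fourierCos f k,
    fun k => (1 - ((k : ℝ) / n) ^ s) * fourierSin f k, fun t => ?_⟩
  beta_reduce
  rw [zygmundSum, if_pos rfl]
  congr 1
  refine Finset.sum_congr rfl fun k hk => ?_
  rw [if_neg (by have := Finset.mem_Ico.1 hk; omega)]
  ring

/-! ### Lower bound for the best approximation by duality -/

/-- A test polynomial orthogonal to the trigonometric polynomials of order at most `n`. -/
noncomputable def testPoly (n : ℕ) (t : ℝ) : ℝ :=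
  ∑ i ∈ Finset.range n, ∑ j ∈ Finset.range n, cos (((2 * n + i - j : ℕ) : ℝ) * t)

/-- With D = ∑_{i<n} e^{iit}, the first i in the exponent being the imaginary unit, the test
polynomial is the real part of e^{2nit}|D|², that is cos(2nt)|D|², while the right-hand side is |D|²
expanded. -/
lemma abs_testPoly_le (n : ℕ) (t : ℝ) :
    |testPoly n t| ≤ ∑ i ∈ Finset.range n, ∑ j ∈ Finset.range n, cos (((i - j : ℤ) : ℝ) * t) := by
  have hA : (∑ i ∈ Finset.range n, ∑ j ∈ Finset.range n, cos (((i - j : ℤ) : ℝ) * t)) =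
      (∑ i ∈ Finset.range n, cos (i * t)) ^ 2 + (∑ i ∈ Finset.range n, sin (i * t)) ^ 2 := by
    rw [sq, sq, Finset.sum_mul_sum, Finset.sum_mul_sum, ← Finset.sum_add_distrib]
    refine Finset.sum_congr rfl fun i _ => ?_
    rw [← Finset.sum_add_distrib]
    refine Finset.sum_congr rfl fun j _ => ?_
    push_cast
    rw [sub_mul, cos_sub]
  have hB : testPoly n t = cos (2 * n * t) *
      ((∑ i ∈ Finset.range n, cos (i * t)) ^ 2 + (∑ i ∈ Finset.range n, sin (i * t)) ^ 2) -
      sin (2 * n * t) * ((∑ i ∈ Finset.range n, sin (i * t)) * (∑ i ∈ Finset.range n, cos (i * t))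
        - (∑ i ∈ Finset.range n, cos (i * t)) * (∑ i ∈ Finset.range n, sin (i * t))) := by
    rw [sq, sq, Finset.sum_mul_sum, Finset.sum_mul_sum, Finset.sum_mul_sum, Finset.sum_mul_sum,
      ← Finset.sum_add_distrib, ← Finset.sum_sub_distrib, Finset.mul_sum, Finset.mul_sum,
      ← Finset.sum_sub_distrib, testPoly]
    refine Finset.sum_congr rfl fun i _ => ?_
    rw [← Finset.sum_add_distrib, ← Finset.sum_sub_distrib, Finset.mul_sum, Finset.mul_sum,
      ← Finset.sum_sub_distrib]
    refine Finset.sum_congr rfl fun j hj => ?_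
    have hj' := Finset.mem_range.1 hj
    rw [Nat.cast_sub (by omega)]
    push_cast
    rw [show (2 * (n : ℝ) + i - j) * t = 2 * n * t + (i * t - j * t) by ring, cos_add, cos_sub,
      sin_sub]
  rw [hA, hB, mul_comm (∑ i ∈ Finset.range n, sin (i * t)), sub_self, mul_zero, sub_zero, abs_mul,
    abs_of_nonneg (a := _ ^ 2 + _ ^ 2) (by positivity)]
  exact mul_le_of_le_one_left (by positivity) (abs_cos_le_one _)

lemma continuous_testPoly (n : ℕ) : Continuous (testPoly n) := by
  unfold testPoly
  fun_prop

/-- In the integral of the Fejér-type majorant only the n diagonal terms survive, each contributing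
2π. -/
lemma integral_abs_testPoly_le (n : ℕ) : ∫ t in (-π)..π, |testPoly n t| ≤ 2 * π * n := by
  have hle := intervalIntegral.integral_mono_on (μ := volume) (a := -π) (b := π)
    (by linarith [pi_pos]) ((continuous_testPoly n).abs.intervalIntegrable _ _)
    (Continuous.intervalIntegrable (by fun_prop) _ _) fun t _ => abs_testPoly_le n t
  refine hle.trans (le_of_eq ?_)
  have hij : ∀ i ∈ Finset.range n, ∑ j ∈ Finset.range n,
      ∫ t in (-π)..π, cos (((i - j : ℤ) : ℝ) * t) = 2 * π := by
    intro i hi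
    have h1 : ∀ j ∈ Finset.range n, ∫ t in (-π)..π, cos (((i - j : ℤ) : ℝ) * t) =
        if i = j then 2 * π else 0 := by
      intro j _
      split_ifs with h
      · subst h
        simp
        ring
      · have := integral_cos_add (m := (i - j : ℤ)) (by omega) 0
        simpa only [sub_zero] using this
    rw [Finset.sum_congr rfl h1, Finset.sum_ite_eq, if_pos hi]
  rw [intervalIntegral.integral_finsetSum
    fun i _ => Continuous.intervalIntegrable (by fun_prop) _ _]
  have hout : ∀ i ∈ Finset.range n, ∫ t in (-π)..π, ∑ j ∈ Finset.range n,
      cos (((i - j : ℤ) : ℝ) * t) = 2 * π := by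
    intro i hi
    rw [intervalIntegral.integral_finsetSum
      fun i _ => Continuous.intervalIntegrable (by fun_prop) _ _]
    exact hij i hi
  rw [Finset.sum_congr rfl hout]
  simp
  ring

lemma integral_trigPoly_mul_testPoly (a b : ℕ → ℝ) (N : ℕ) {n : ℕ} :
    ∫ t in (-π)..π, trigPoly a b N t * testPoly n t =
      ∑ i ∈ Finset.range n, ∑ j ∈ Finset.range n,
        if 2 * n + i - j < N then π * a (2 * n + i - j) else 0 := by
  have hc := continuous_trigPoly a b N
  simp only [testPoly, Finset.mul_sum]
  rw [intervalIntegral.integral_finsetSum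
    fun i _ => Continuous.intervalIntegrable (by fun_prop) _ _]
  refine Finset.sum_congr rfl fun i _ => ?_
  rw [intervalIntegral.integral_finsetSum
    fun i _ => Continuous.intervalIntegrable (by fun_prop) _ _]
  refine Finset.sum_congr rfl fun j hj => ?_
  have := integral_trigPoly_mul_cos a b N (2 * n + i - j)
    (by have := Finset.mem_range.1 hj; omega) 0
  simpa using this

/-- Duality with the test polynomial. -/
lemma le_of_abs_trigPoly_sub_le {a b a' b' : ℕ → ℝ} {n : ℕ} (hn : 1 ≤ n) {m Z : ℝ} (hZ0 : 0 ≤ Z)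
    (hm : ∀ k : ℕ, n ≤ k → k < 3 * n → m ≤ a' k)
    (hpt : ∀ t, |trigPoly a' b' (3 * n) t - trigPoly a b n t| ≤ Z) : n * m / 2 ≤ Z := by
  have hc1 := continuous_trigPoly a' b' (3 * n)
  have hc2 := continuous_trigPoly a b n
  have hc3 := continuous_testPoly n
  have hupper : ∫ t in (-π)..π, (trigPoly a' b' (3 * n) t - trigPoly a b n t) * testPoly n t ≤
      Z * (2 * π * n) := by
    calc _ ≤ ∫ t in (-π)..π, Z * |testPoly n t| := by
          refine intervalIntegral.integral_mono_on (by linarith [pi_pos])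
            (Continuous.intervalIntegrable (by fun_prop) _ _)
            (Continuous.intervalIntegrable (by fun_prop) _ _) fun t _ => ?_
          refine (le_abs_self _).trans ?_
          rw [abs_mul]
          exact mul_le_mul_of_nonneg_right (hpt t) (abs_nonneg _)
      _ ≤ _ := by
          rw [intervalIntegral.integral_const_mul]
          exact mul_le_mul_of_nonneg_left (integral_abs_testPoly_le n) hZ0
  -- All n² frequencies 2n + i - j lie strictly between n and 3n: the polynomial of order below n
  -- contributes nothing, and each pair (i, j) contributes at least πm. Comparison with 2πnZ gives
  -- nm/2 ≤ Z.
  have hlower : n * (n * (π * m)) ≤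
      ∫ t in (-π)..π, (trigPoly a' b' (3 * n) t - trigPoly a b n t) * testPoly n t := by
    simp only [sub_mul]
    rw [intervalIntegral.integral_sub (Continuous.intervalIntegrable (by fun_prop) _ _)
      (Continuous.intervalIntegrable (by fun_prop) _ _), integral_trigPoly_mul_testPoly,
      integral_trigPoly_mul_testPoly]
    have h0 : (∑ i ∈ Finset.range n, ∑ j ∈ Finset.range n,
        if 2 * n + i - j < n then π * a (2 * n + i - j) else 0) = 0 :=
      Finset.sum_eq_zero fun i _ => Finset.sum_eq_zero fun j hj =>
        if_neg (by have := Finset.mem_range.1 hj; omega)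
    rw [h0, sub_zero]
    have hconst : ∀ x : ℝ, (n : ℝ) * x = ∑ i ∈ Finset.range n, x := fun x => by simp
    rw [hconst, hconst]
    refine Finset.sum_le_sum fun i hi => Finset.sum_le_sum fun j hj => ?_
    have hi' := Finset.mem_range.1 hi
    have hj' := Finset.mem_range.1 hj
    rw [if_pos (by omega)]
    exact mul_le_mul_of_nonneg_left (hm _ (by omega) (by omega)) pi_pos.le
  have hn0 : (0 : ℝ) < n := by exact_mod_cast hn
  have hfin := hlower.trans hupper
  have e1 : n * (n * (π * m)) = (2 * π * n) * (n * m / 2) := by ring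
  rw [e1, mul_comm Z] at hfin
  exact le_of_mul_le_mul_left hfin (by positivity)

/-- The test function has coefficients ψ(k)/Y, each at least m/Y, on the block n ≤ k < 3n seen by
`testPoly n`. An infinite uniform norm makes the inequality trivial. -/
lemma le_bestApprox (hp : 1 < p) (hτ : HasTailBound (fun k => ψ k) p.conjExponent τ) (β : ℝ)
    {n : ℕ} (hn : 1 ≤ n) {Y m : ℝ} (hY : 0 < Y) (hm : ∀ k : ℕ, n ≤ k → k < 3 * n → m ≤ ψ k)
    (hc : eLpNorm (cosSum (fun _ => 1) (-(β * π / 2)) n (3 * n)) (ENNReal.ofReal p)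
      periodMeasure ≤ ENNReal.ofReal Y) :
    ENNReal.ofReal (n * (m / Y) / 2) ≤ bestApprox ψ p β n := by
  have hmem := cosSum_mem_convClass hp hτ β hn hY hc
  rw [bestApprox]
  refine le_trans ?_ (le_iSup₂ (cosSum (fun k => 1 * ψ k / Y) 0 n (3 * n)) hmem)
  refine le_iInf₂ fun T hT => ?_
  obtain ⟨a, b, hT⟩ := hT
  obtain rfl : T = trigPoly a b n := funext hT
  rw [cosSum_eq_trigPoly _ _ hn]
  generalize hV : supNorm _ = V
  by_cases htop : V = ∞
  · rw [htop]
    exact le_top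
  rw [← ENNReal.ofReal_toReal htop]
  refine ENNReal.ofReal_le_ofReal ?_
  have hpt : ∀ t, |trigPoly (fun k => if n ≤ k then 1 * ψ k / Y * cos 0 else 0)
      (fun k => if n ≤ k then 1 * ψ k / Y * sin 0 else 0) (3 * n) t - trigPoly a b n t| ≤
      V.toReal := by
    intro t
    rw [← ENNReal.ofReal_le_iff_le_toReal htop, ← Real.enorm_eq_ofReal_abs, ← hV]
    exact le_iSup (fun t => ‖trigPoly (fun k => if n ≤ k then 1 * ψ k / Y * cos 0 else 0)
      (fun k => if n ≤ k then 1 * ψ k / Y * sin 0 else 0) (3 * n) t - trigPoly a b n t‖ₑ) t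
  refine le_of_abs_trigPoly_sub_le hn ENNReal.toReal_nonneg (fun k hk1 hk2 => ?_) hpt
  rw [if_pos hk1, cos_zero, mul_one, one_mul]
  exact div_le_div_of_nonneg_right (hm k hk1 hk2) hY.le

end Bounds

/-! ### Norms of cosine sums from conditions on the coefficients -/

/-- The cut M' on the annulus of scale M may differ from M; this is needed when the sum starts at
some a > M. The quantity X is the expected size of the norm and E an absolute constant. -/
lemma eLpNorm_cosSum_le {r : ℝ} (hr : 1 ≤ r) {ν : ℕ → ℝ} (θ : ℝ) {a B : ℕ} (hB : 1 ≤ B)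
    {D : ℕ → ℝ} (hD : ∀ M, 0 ≤ D M)
    (h1 : ∀ M, 1 ≤ M → M < B → ∃ M', a ≤ M' ∧ M' ≤ B ∧
      ∑ k ∈ Finset.Ico a M', |ν k| + 2 * M * tailVar ν M' B ≤ D M)
    (h2 : ∑ k ∈ Finset.Ico a B, |ν k| ≤ D B) {E X : ℝ} (hE : 0 ≤ E) (hX : 0 ≤ X)
    (hsum : ∑ M ∈ Finset.Ico 1 B, D M ^ r / ((M : ℝ) * (M + 1)) + D B ^ r / B ≤ E * X ^ r) :
    eLpNorm (cosSum ν θ a B) (ENNReal.ofReal r) periodMeasure ≤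
      ENNReal.ofReal ((2 * π * E) ^ (1 / r) * X) := by
  have hr0 : 0 < r := by linarith
  refine (eLpNorm_le_of_step hr hB hD (fun M x hM1 hMB hx1 hx2 => ?_)
    fun x _ => (abs_cosSum_le_sum ν θ a B x).trans h2).trans (ENNReal.ofReal_le_ofReal ?_)
  · obtain ⟨M', haM, hMB', hle⟩ := h1 M hM1 hMB
    have hM1' : (1 : ℝ) ≤ M := by exact_mod_cast hM1
    have hx0 : 0 < |x| := lt_trans (by positivity) hx1
    have hxpi : |x| ≤ π := hx2.trans (div_le_self pi_pos.le hM1')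
    refine (abs_cosSum_le ν θ haM hMB' (abs_pos.1 hx0) hxpi).trans (le_trans ?_ hle)
    refine add_le_add_right (mul_le_mul_of_nonneg_right ?_ (tailVar_nonneg _ _ _)) _
    -- On this annulus π/|x| < M + 1 ≤ 2M, the source of the factor 2M.
    rw [div_lt_iff₀ (by positivity)] at hx1
    rw [div_le_iff₀ hx0]
    nlinarith
  · have hsum0 : 0 ≤ ∑ M ∈ Finset.Ico 1 B, D M ^ r / ((M : ℝ) * (M + 1)) + D B ^ r / B :=
      add_nonneg (Finset.sum_nonneg fun M _ => div_nonneg (rpow_nonneg (hD M) _) (by positivity))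
        (div_nonneg (rpow_nonneg (hD B) _) (by positivity))
    calc _ ≤ (2 * π * (E * X ^ r)) ^ (1 / r) := by
          refine rpow_le_rpow (by positivity) ?_ (by positivity)
          exact mul_le_mul_of_nonneg_left hsum (by positivity)
      _ = (2 * π * E) ^ (1 / r) * X := by
          rw [← mul_assoc, mul_rpow (by positivity) (by positivity), ← rpow_mul hX,
            mul_one_div_cancel hr0.ne', rpow_one]

lemma div_mul_succ_le {A : ℝ} (hA : 0 ≤ A) {M : ℕ} (hM : 1 ≤ M) :
    A / ((M : ℝ) * (M + 1)) ≤ A * (M : ℝ) ^ (-2 : ℝ) := by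
  have hM0 : (0 : ℝ) < M := by exact_mod_cast hM
  rw [rpow_neg hM0.le, ← div_eq_mul_inv, rpow_two]
  exact div_le_div_of_nonneg_left hA (by positivity) (by nlinarith)

/-- The finitely many indices below the threshold are absorbed into the constant. Slow variation
holds only from some point on, whereas the estimates are wanted from 1. -/
lemma eventually_to_uniform {P : ℕ → ℝ → Prop} (hP : ∀ m a b, a ≤ b → P m a → P m b) {w : ℕ → ℝ}
    (hw : ∀ m, 1 ≤ m → 0 < w m) (hev : ∃ (T : ℕ) (K : ℝ), ∀ m, T ≤ m → 1 ≤ m → P m (K * w m))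
    (hex : ∀ m, 1 ≤ m → ∃ c, P m c) : ∃ K, 0 < K ∧ ∀ m, 1 ≤ m → P m (K * w m) := by
  obtain ⟨T, K, hK⟩ := hev
  choose! c hc using hex
  have hS : ∀ m ∈ Finset.Ico 1 T, 0 ≤ |c m| / w m := fun m hm =>
    div_nonneg (abs_nonneg _) (hw m (Finset.mem_Ico.1 hm).1).le
  refine ⟨|K| + 1 + ∑ m ∈ Finset.Ico 1 T, |c m| / w m, ?_, fun m hm => ?_⟩
  · have := Finset.sum_nonneg hS
    positivity
  have hwm := hw m hm
  rcases le_or_gt T m with h | h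
  · refine hP m _ _ ?_ (hK m h hm)
    refine mul_le_mul_of_nonneg_right ?_ hwm.le
    linarith [le_abs_self K, Finset.sum_nonneg hS]
  · refine hP m _ _ ?_ (hc m hm)
    have h1 := Finset.single_le_sum hS (Finset.mem_Ico.2 ⟨hm, h⟩)
    rw [← div_le_iff₀ hwm]
    calc c m / w m ≤ |c m| / w m := div_le_div_of_nonneg_right (le_abs_self _) hwm.le
      _ ≤ _ := by linarith [abs_nonneg K]

/-- For a nonincreasing nonnegative sequence the variation telescopes, and the final drop to zero
completes it to ν(M). -/
lemma tailVar_eq_of_antitone {ν : ℕ → ℝ} {T : ℕ} (hpos : ∀ k, T ≤ k → 0 ≤ ν k)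
    (hanti : ∀ m k, T ≤ m → m ≤ k → ν k ≤ ν m) {M B : ℕ} (hM : T ≤ M) (hMB : M ≤ B) :
    tailVar ν M B = ν M := by
  have h1 : ∑ k ∈ Finset.Ico M B, |ν (k + 1) - ν k| = -∑ k ∈ Finset.Ico M B, (ν (k + 1) - ν k) := by
    rw [← Finset.sum_neg_distrib]
    refine Finset.sum_congr rfl fun k hk => abs_of_nonpos ?_
    linarith [hanti k (k + 1) (hM.trans (Finset.mem_Ico.1 hk).1) (by omega)]
  rw [tailVar, h1, Finset.sum_Ico_sub ν hMB, abs_of_nonneg (hpos B (hM.trans hMB))]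
  ring

lemma exists_tailVar_le {ν : ℕ → ℝ} (hpos : ∀ k, 1 ≤ k → 0 < ν k) {T : ℕ} (hT : 1 ≤ T)
    (hanti : ∀ m k, T ≤ m → m ≤ k → ν k ≤ ν m) :
    ∃ K, 0 < K ∧ ∀ M, 1 ≤ M → ∀ B, M ≤ B → tailVar ν M B ≤ K * ν M := by
  refine eventually_to_uniform (P := fun M c => ∀ B, M ≤ B → tailVar ν M B ≤ c)
    (fun m a b hab h B hB => (h B hB).trans hab) hpos ⟨T, 1, fun M hM hM1 B hB => ?_⟩
    fun M hM => ?_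
  · rw [tailVar_eq_of_antitone (fun k hk => (hpos k (hT.trans hk)).le) hanti hM hB, one_mul]
  -- For fixed M a bound independent of B: beyond M + T the sequence is monotone and its variation
  -- is ν(M + T), while the variation before that is a fixed finite sum.
  refine ⟨∑ k ∈ Finset.range (M + T + 1), |ν k| + ∑ k ∈ Finset.Ico M (M + T), |ν (k + 1) - ν k|,
    fun B hB => ?_⟩
  rcases le_total B (M + T) with h | h
  · refine add_le_add ?_ (Finset.sum_le_sum_of_subset_of_nonneg
      (Finset.Ico_subset_Ico le_rfl h) fun _ _ _ => abs_nonneg _)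
    exact Finset.single_le_sum (f := fun k => |ν k|) (fun _ _ => abs_nonneg _)
      (Finset.mem_range.2 (by omega))
  · have e := tailVar_eq_of_antitone (fun k hk => (hpos k (hT.trans hk)).le) hanti
      (show T ≤ M + T by omega) h
    have e2 : tailVar ν M B =
        tailVar ν (M + T) B + ∑ k ∈ Finset.Ico M (M + T), |ν (k + 1) - ν k| := by
      rw [tailVar, tailVar, ← Finset.sum_Ico_consecutive _ (show M ≤ M + T by omega) h]
      ring
    rw [e2, e]
    refine add_le_add_left ((le_abs_self _).trans ?_) _
    exact Finset.single_le_sum (f := fun k => |ν k|) (fun _ _ => abs_nonneg _)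
      (Finset.mem_range.2 (by omega))

lemma exists_almost_antitone {ν : ℕ → ℝ} (hpos : ∀ k, 1 ≤ k → 0 < ν k) {T : ℕ} (hT : 1 ≤ T)
    (hanti : ∀ m k, T ≤ m → m ≤ k → ν k ≤ ν m) :
    ∃ K, 0 < K ∧ ∀ m k, 1 ≤ m → m ≤ k → ν k ≤ K * ν m := by
  obtain ⟨K, hK, h⟩ := exists_tailVar_le hpos hT hanti
  refine ⟨K, hK, fun m k hm hk => le_trans ?_ (h m hm k hk)⟩
  exact (le_abs_self _).trans
    (le_add_of_nonneg_right (Finset.sum_nonneg fun _ _ => abs_nonneg _))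

/-- Sequences with rapid decay of order `α` and controlled variation. -/
structure IsTailSeq (u : ℕ → ℝ) (α K : ℝ) : Prop where
  K_pos : 0 < K
  pos : ∀ k, 1 ≤ k → 0 < u k
  decr : ∀ m k : ℕ, 1 ≤ m → m ≤ k → (k : ℝ) ^ α * u k ≤ K * ((m : ℝ) ^ α * u m)
  var : ∀ M, 1 ≤ M → ∀ B, M ≤ B → tailVar u M B ≤ K * u M

/-- On scales M < n only the variation from n counts, giving u(n) M. For M ≥ n the decay gives u(n)
n^α M^{1-α}; here α < 1 lets the partial sums grow like a power, and α > 1 - 1/r makes the r-th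
powers summable over the annuli. Both ranges contribute u(n)^r n^{r-1}. -/
theorem IsTailSeq.eLpNorm_le {u : ℕ → ℝ} {α K r : ℝ} (h : IsTailSeq u α K) (hr : 1 < r)
    (hα : 1 - 1 / r < α) (hα1 : α < 1) : ∃ C, 0 < C ∧ ∀ (θ : ℝ) (n N : ℕ), 1 ≤ n → n ≤ N →
      eLpNorm (cosSum u θ n N) (ENNReal.ofReal r) periodMeasure ≤
        ENNReal.ofReal (C * (u n * (n : ℝ) ^ (1 - 1 / r))) := by
  have hK := h.K_pos
  have hr0 : 0 < r := by linarith
  have hα0 : 0 < 1 - α := by linarith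
  set A : ℝ := 2 * K / (1 - α) * K + 2 * K * K + 2 * K with hA
  have hA0 : 0 < A := by positivity
  -- Positivity of c is exactly α > 1 - 1/r; the annuli with M ≥ n contribute ∑ M^{-c-1}.
  set c : ℝ := 1 - (1 - α) * r with hc
  have hc0 : 0 < c := by
    have : (1 - α) * r < 1 / r * r := mul_lt_mul_of_pos_right (by linarith) hr0
    rw [one_div_mul_cancel hr0.ne'] at this
    linarith
  set E : ℝ := A ^ r * (2 / (r - 1) + 2 * exp c / c + 1) with hE
  have hr1 : 0 < r - 1 := by linarith
  have hE0 : 0 < E := by positivity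
  refine ⟨(2 * π * E) ^ (1 / r), by positivity, fun θ n N hn hnN => ?_⟩
  have hn0 : (0 : ℝ) < n := by exact_mod_cast hn
  have hun := h.pos n hn
  let D : ℕ → ℝ := fun M => A * u n * (if M < n then (M : ℝ) else (n : ℝ) ^ α * (M : ℝ) ^ (1 - α))
  have hD : ∀ M, 0 ≤ D M := by
    intro M
    refine mul_nonneg (by positivity) ?_
    split_ifs <;> positivity
  have hpow : ∀ k : ℕ, n ≤ k → u k ≤ K * ((n : ℝ) ^ α * u n) * (k : ℝ) ^ ((1 - α) - 1) := by
    intro k hk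
    have hk0 : (0 : ℝ) < k := by exact_mod_cast hn.trans hk
    rw [show 1 - α - 1 = -α by ring, rpow_neg hk0.le, ← div_eq_mul_inv,
      le_div_iff₀ (by positivity), mul_comm]
    exact h.decr n k hn hk
  have hsumle : ∀ M, n ≤ M → ∑ k ∈ Finset.Ico n M, |u k| ≤
      2 * K / (1 - α) * u n * ((n : ℝ) ^ α * (M : ℝ) ^ (1 - α)) := by
    intro M _
    calc ∑ k ∈ Finset.Ico n M, |u k|
        ≤ ∑ k ∈ Finset.Ico n M, K * ((n : ℝ) ^ α * u n) * (k : ℝ) ^ ((1 - α) - 1) := by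
          refine Finset.sum_le_sum fun k hk => ?_
          have hk' := (Finset.mem_Ico.1 hk).1
          rw [abs_of_pos (h.pos k (hn.trans hk'))]
          exact hpow k hk'
      _ ≤ ∑ k ∈ Finset.Ico 1 M, K * ((n : ℝ) ^ α * u n) * (k : ℝ) ^ ((1 - α) - 1) :=
          Finset.sum_le_sum_of_subset_of_nonneg (Finset.Ico_subset_Ico hn le_rfl)
            fun _ _ _ => by positivity
      _ ≤ K * ((n : ℝ) ^ α * u n) * (2 / (1 - α) * (M : ℝ) ^ (1 - α)) := by
          rw [← Finset.mul_sum]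
          exact mul_le_mul_of_nonneg_left (sum_rpow_le hα0 M) (by positivity)
      _ = _ := by ring
  have hK1 : 1 ≤ K := by
    have := h.decr n n hn le_rfl
    have h2 : 0 < (n : ℝ) ^ α * u n := by positivity
    nlinarith
  have hAle : 2 * K / (1 - α) + 2 * K * K ≤ A := by
    rw [hA]
    have : 0 ≤ 2 * K / (1 - α) := by positivity
    nlinarith
  have hDge : ∀ M, n ≤ M → D M = A * u n * ((n : ℝ) ^ α * (M : ℝ) ^ (1 - α)) := fun M hM => by
    simp only [D, if_neg (not_lt.2 hM)]
  have hDlt : ∀ M, M < n → D M = A * u n * M := fun M hM => by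
    simp only [D, if_pos hM]
  refine eLpNorm_cosSum_le hr.le θ (hn.trans hnN) hD (fun M hM1 hMN => ?_) ?_ hE0.le
    (by positivity) ?_
  · have hM0 : (0 : ℝ) < M := by exact_mod_cast hM1
    rcases lt_or_ge M n with hMn | hMn
    -- No frequency lies below n, so the cut is at n and Abel summation applies to the whole sum.
    · refine ⟨n, le_rfl, hnN, ?_⟩
      rw [Finset.Ico_self, Finset.sum_empty, zero_add, hDlt M hMn]
      calc 2 * M * tailVar u n N ≤ 2 * M * (K * u n) :=
            mul_le_mul_of_nonneg_left (h.var n hn N hnN) (by positivity)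
        _ = 2 * K * (u n * M) := by ring
        _ ≤ A * (u n * M) := by
            refine mul_le_mul_of_nonneg_right ?_ (by positivity)
            rw [hA]
            have : 0 ≤ 2 * K / (1 - α) * K + 2 * K * K := by positivity
            linarith
        _ = _ := by ring
    · refine ⟨M, hMn, hMN.le, ?_⟩
      rw [hDge M hMn]
      have h2 : 2 * M * tailVar u M N ≤ 2 * K * K * (u n * ((n : ℝ) ^ α * (M : ℝ) ^ (1 - α))) := by
        calc 2 * M * tailVar u M N ≤ 2 * M * (K * u M) :=
              mul_le_mul_of_nonneg_left (h.var M hM1 N hMN.le) (by positivity)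
          _ ≤ 2 * M * (K * (K * ((n : ℝ) ^ α * u n) * (M : ℝ) ^ ((1 - α) - 1))) := by
              gcongr
              exact hpow M hMn
          _ = _ := by
              rw [rpow_sub_one hM0.ne']
              field_simp
      calc _ ≤ 2 * K / (1 - α) * u n * ((n : ℝ) ^ α * (M : ℝ) ^ (1 - α)) +
            2 * K * K * (u n * ((n : ℝ) ^ α * (M : ℝ) ^ (1 - α))) := add_le_add (hsumle M hMn) h2
        _ = (2 * K / (1 - α) + 2 * K * K) * (u n * ((n : ℝ) ^ α * (M : ℝ) ^ (1 - α))) := by ring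
        _ ≤ A * (u n * ((n : ℝ) ^ α * (M : ℝ) ^ (1 - α))) :=
            mul_le_mul_of_nonneg_right hAle (by positivity)
        _ = _ := by ring
  · rw [hDge N hnN]
    refine (hsumle N hnN).trans ?_
    refine mul_le_mul_of_nonneg_right (mul_le_mul_of_nonneg_right ?_ hun.le) (by positivity)
    have : 0 ≤ 2 * K * K := by positivity
    linarith
  · have hX : (u n * (n : ℝ) ^ (1 - 1 / r)) ^ r = u n ^ r * (n : ℝ) ^ (r - 1) := by
      rw [mul_rpow hun.le (by positivity), ← rpow_mul hn0.le]
      congr 2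
      field_simp
    have hexp : ∀ M : ℕ, 1 ≤ M → ((n : ℝ) ^ α * (M : ℝ) ^ (1 - α)) ^ r * (M : ℝ) ^ (-2 : ℝ) =
        (n : ℝ) ^ (α * r) * (M : ℝ) ^ (-c - 1) := by
      intro M hM
      have hM0 : (0 : ℝ) < M := by exact_mod_cast hM
      rw [mul_rpow (by positivity) (by positivity), ← rpow_mul hn0.le, ← rpow_mul hM0.le,
        mul_assoc, ← rpow_add hM0]
      congr 2
      rw [hc]
      ring
    have hcn : (n : ℝ) ^ (α * r) * (n : ℝ) ^ (-c) = (n : ℝ) ^ (r - 1) := by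
      rw [← rpow_add hn0]
      congr 1
      rw [hc]
      ring
    have hAu : 0 ≤ (A * u n) ^ r := by positivity
    have hlow : ∑ M ∈ Finset.Ico 1 n, D M ^ r / ((M : ℝ) * (M + 1)) ≤
        (A * u n) ^ r * (2 / (r - 1) * (n : ℝ) ^ (r - 1)) := by
      calc _ ≤ ∑ M ∈ Finset.Ico 1 n, (A * u n) ^ r * (M : ℝ) ^ ((r - 1) - 1) := by
            refine Finset.sum_le_sum fun M hM => ?_
            obtain ⟨hM1, hMn⟩ := Finset.mem_Ico.1 hM
            have hM0 : (0 : ℝ) < M := by exact_mod_cast hM1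
            refine (div_mul_succ_le (rpow_nonneg (hD M) _) hM1).trans (le_of_eq ?_)
            rw [hDlt M hMn, mul_rpow (by positivity) hM0.le, mul_assoc, ← rpow_add hM0]
            congr 2
            ring
        _ ≤ _ := by
            rw [← Finset.mul_sum]
            exact mul_le_mul_of_nonneg_left (sum_rpow_le hr1 n) hAu
    have hhigh : ∑ M ∈ Finset.Ico n N, D M ^ r / ((M : ℝ) * (M + 1)) ≤
        (A * u n) ^ r * (2 * exp c / c * (n : ℝ) ^ (r - 1)) := by
      calc _ ≤ ∑ M ∈ Finset.Ico n N, (A * u n) ^ r * (n : ℝ) ^ (α * r) * (M : ℝ) ^ (-c - 1) := by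
            refine Finset.sum_le_sum fun M hM => ?_
            obtain ⟨hMn, -⟩ := Finset.mem_Ico.1 hM
            have hM1 := hn.trans hMn
            refine (div_mul_succ_le (rpow_nonneg (hD M) _) hM1).trans (le_of_eq ?_)
            rw [hDge M hMn, mul_rpow (by positivity) (by positivity), mul_assoc, hexp M hM1,
              mul_assoc]
        _ ≤ (A * u n) ^ r * (n : ℝ) ^ (α * r) * (2 * exp c / c * (n : ℝ) ^ (-c)) := by
            rw [← Finset.mul_sum]
            exact mul_le_mul_of_nonneg_left (sum_rpow_tail_le hc0 hn N) (by positivity)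
        _ = _ := by
            rw [← hcn]
            ring
    have hlast : D N ^ r / N ≤ (A * u n) ^ r * (n : ℝ) ^ (r - 1) := by
      have hN0 : (0 : ℝ) < N := by exact_mod_cast hn.trans hnN
      have e : ((n : ℝ) ^ α * (N : ℝ) ^ (1 - α)) ^ r / N =
          (n : ℝ) ^ (α * r) * (N : ℝ) ^ (-c) := by
        rw [mul_rpow (by positivity) (by positivity), ← rpow_mul hn0.le, ← rpow_mul hN0.le,
          mul_div_assoc, ← rpow_sub_one hN0.ne']
        congr 2
        rw [hc]
        ring
      rw [hDge N hnN, mul_rpow (by positivity) (by positivity), mul_div_assoc, e, ← hcn]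
      have : (N : ℝ) ^ (-c) ≤ (n : ℝ) ^ (-c) :=
        rpow_le_rpow_of_nonpos hn0 (by exact_mod_cast hnN) (by linarith)
      gcongr
    rw [hX, ← Finset.sum_Ico_consecutive _ hn hnN, hE]
    rw [mul_rpow hA0.le hun.le] at hlow hhigh hlast
    nlinarith

/-- Sequences with a Hardy-type condition on partial sums and controlled variation. -/
theorem eLpNorm_cosSum_le_of_quasi {ν : ℕ → ℝ} {K r : ℝ} (hr : 1 < r) (hK : 0 < K)
    (hpos : ∀ k, 1 ≤ k → 0 < ν k)
    (hsum : ∀ M, 1 ≤ M → ∑ k ∈ Finset.Ico 1 M, ν k ≤ K * (M * ν M))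
    (hvar : ∀ M, 1 ≤ M → ∀ B, M ≤ B → tailVar ν M B ≤ K * ν M) :
    ∃ C, 0 < C ∧ ∀ (θ : ℝ) (B : ℕ), 1 ≤ B →
      eLpNorm (cosSum ν θ 1 B) (ENNReal.ofReal r) periodMeasure ≤
        ENNReal.ofReal (C * (∑ k ∈ Finset.Ico 1 B, ν k ^ r * (k : ℝ) ^ (r - 2) +
          ν B ^ r * (B : ℝ) ^ (r - 1)) ^ (1 / r)) := by
  have hr0 : 0 < r := by linarith
  refine ⟨(2 * π * (3 * K) ^ r) ^ (1 / r), by positivity, fun θ B hB => ?_⟩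
  have habs : ∀ M, ∑ k ∈ Finset.Ico 1 M, |ν k| = ∑ k ∈ Finset.Ico 1 M, ν k := fun M =>
    Finset.sum_congr rfl fun k hk => abs_of_pos (hpos k (Finset.mem_Ico.1 hk).1)
  have hterm : ∀ k, 1 ≤ k → 0 ≤ ν k ^ r * (k : ℝ) ^ (r - 2) := fun k hk =>
    mul_nonneg (rpow_nonneg (hpos k hk).le _) (by positivity)
  have hB0 : (0 : ℝ) < B := by exact_mod_cast hB
  have hνB := hpos B hB
  have hX0 : 0 ≤ ∑ k ∈ Finset.Ico 1 B, ν k ^ r * (k : ℝ) ^ (r - 2) +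
      ν B ^ r * (B : ℝ) ^ (r - 1) :=
    add_nonneg (Finset.sum_nonneg fun k hk => hterm k (Finset.mem_Ico.1 hk).1) (by positivity)
  have hpos' : ∀ M : ℕ, 0 ≤ (M : ℝ) * |ν M| := fun M => by positivity
  -- One K comes from the partial sum and 2K from the variation. The absolute value keeps the
  -- majorant nonnegative at the index 0, where ν is uncontrolled.
  refine eLpNorm_cosSum_le (D := fun M => 3 * K * (M * |ν M|)) hr.le θ hB
    (fun M => by positivity) (fun M hM1 hMB => ⟨M, hM1, hMB.le, ?_⟩) ?_ (by positivity)
    (by positivity) ?_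
  · rw [habs, abs_of_pos (hpos M hM1)]
    have h2 : 2 * M * tailVar ν M B ≤ 2 * M * (K * ν M) :=
      mul_le_mul_of_nonneg_left (hvar M hM1 B hMB.le) (by positivity)
    linarith [hsum M hM1]
  · rw [habs, abs_of_pos hνB]
    have : 0 ≤ K * (B * ν B) := by positivity
    linarith [hsum B hB]
  · rw [← rpow_mul hX0, one_div_mul_cancel hr0.ne', rpow_one, mul_add, Finset.mul_sum]
    refine add_le_add (Finset.sum_le_sum fun M hM => ?_) ?_
    · have hM1 := (Finset.mem_Ico.1 hM).1
      have hM0 : (0 : ℝ) < M := by exact_mod_cast hM1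
      have hνM := hpos M hM1
      refine (div_mul_succ_le (by positivity) hM1).trans (le_of_eq ?_)
      rw [abs_of_pos hνM, mul_rpow (by positivity) (by positivity), mul_rpow hM0.le hνM.le,
        sub_eq_add_neg, rpow_add hM0]
      ring
    · rw [abs_of_pos hνB, mul_rpow (by positivity) (by positivity), mul_rpow hB0.le hνB.le,
        rpow_sub_one hB0.ne']
      refine le_of_eq ?_
      ring

/-- The Dirichlet-type block `∑_{n ≤ k < 3n} cos (kx - θ)` in `L_r`. -/
theorem eLpNorm_block_le {r : ℝ} (hr : 1 < r) : ∃ C, 0 < C ∧ ∀ (θ : ℝ) (n : ℕ), 1 ≤ n →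
    eLpNorm (cosSum (fun _ => 1) θ n (3 * n)) (ENNReal.ofReal r) periodMeasure ≤
      ENNReal.ofReal (C * (n : ℝ) ^ (1 - 1 / r)) := by
  have hr0 : 0 < r := by linarith
  have hr1 : 0 < r - 1 := by linarith
  set E : ℝ := 3 ^ r * (2 / (r - 1) + 1) * 3 ^ (r - 1) with hE
  have hE0 : 0 < E := by positivity
  refine ⟨(2 * π * E) ^ (1 / r), by positivity, fun θ n hn => ?_⟩
  have hn0 : (0 : ℝ) < n := by exact_mod_cast hn
  have hvar : ∀ M B, tailVar (fun _ => (1 : ℝ)) M B = 1 := fun M B => by simp [tailVar]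
  -- With the cut at max(M, n) there are at most M terms below it, and a constant sequence has only
  -- its final drop 1 as variation; hence M + 2M.
  refine eLpNorm_cosSum_le (D := fun M => 3 * (M : ℝ)) hr.le θ (by omega)
    (fun M => by positivity) (fun M hM1 hMB => ⟨max M n, le_max_right _ _, ?_, ?_⟩) ?_ hE0.le
    (by positivity) ?_
  · exact max_le hMB.le (by omega)
  · rw [hvar]
    have h1 : max M n - n ≤ M := by omega
    have h2 : ((max M n - n : ℕ) : ℝ) ≤ M := by exact_mod_cast h1
    simp only [abs_one, Finset.sum_const, Nat.card_Ico, nsmul_eq_mul, mul_one]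
    linarith
  · have h1 : 3 * n - n ≤ 3 * (3 * n) := by omega
    simp only [abs_one, Finset.sum_const, Nat.card_Ico, nsmul_eq_mul, mul_one]
    exact_mod_cast h1
  · have hX : ((n : ℝ) ^ (1 - 1 / r)) ^ r = (n : ℝ) ^ (r - 1) := by
      rw [← rpow_mul hn0.le]
      congr 1
      field_simp
    have h3n : (0 : ℝ) < ((3 * n : ℕ) : ℝ) := by positivity
    have hlow : ∑ M ∈ Finset.Ico 1 (3 * n), (3 * (M : ℝ)) ^ r / ((M : ℝ) * (M + 1)) ≤
        3 ^ r * (2 / (r - 1) * ((3 * n : ℕ) : ℝ) ^ (r - 1)) := by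
      calc _ ≤ ∑ M ∈ Finset.Ico 1 (3 * n), 3 ^ r * (M : ℝ) ^ ((r - 1) - 1) := by
            refine Finset.sum_le_sum fun M hM => ?_
            have hM1 := (Finset.mem_Ico.1 hM).1
            have hM0 : (0 : ℝ) < M := by exact_mod_cast hM1
            refine (div_mul_succ_le (by positivity) hM1).trans (le_of_eq ?_)
            rw [mul_rpow (by positivity) hM0.le, mul_assoc, ← rpow_add hM0]
            congr 2
            ring
        _ ≤ _ := by
            rw [← Finset.mul_sum]
            exact mul_le_mul_of_nonneg_left (sum_rpow_le hr1 _) (by positivity)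
    have hlast : (3 * ((3 * n : ℕ) : ℝ)) ^ r / ((3 * n : ℕ) : ℝ) =
        3 ^ r * ((3 * n : ℕ) : ℝ) ^ (r - 1) := by
      rw [mul_rpow (by positivity) h3n.le, rpow_sub_one h3n.ne', mul_div_assoc]
    have e3 : ((3 * n : ℕ) : ℝ) ^ (r - 1) = 3 ^ (r - 1) * (n : ℝ) ^ (r - 1) := by
      push_cast
      rw [mul_rpow (by positivity) hn0.le]
    rw [hX, hlast]
    refine (add_le_add_left hlow _).trans (le_of_eq ?_)
    rw [e3, hE]
    ring

/-! ### Slowly varying sequences and functions -/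

/-- Positive sequences slowly varying in the sense of Zygmund. -/
structure IsSlowSeq (h : ℕ → ℝ) : Prop where
  pos : ∀ k, 1 ≤ k → 0 < h k
  slow : ∀ δ : ℝ, 0 < δ → ∃ T : ℕ, 1 ≤ T ∧ ∀ m k : ℕ, T ≤ m → m ≤ k →
    h m * (m : ℝ) ^ δ ≤ h k * (k : ℝ) ^ δ ∧ h k * (k : ℝ) ^ (-δ) ≤ h m * (m : ℝ) ^ (-δ)

lemma MemZ.isSlowSeq {g : ℝ → ℝ} (hg : MemZ g) : IsSlowSeq fun k => g k where
  pos k hk := hg.2.1 k (by exact_mod_cast hk)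
  slow δ hδ := by
    obtain ⟨T, hT1, h1, h2⟩ := hg.2.2 δ hδ
    refine ⟨⌈T⌉₊, ?_, fun m k hm hk => ?_⟩
    · rw [Nat.one_le_ceil_iff]; linarith
    · have hm' : T ≤ m := Nat.ceil_le.1 hm
      have hk' : (m : ℝ) ≤ k := by exact_mod_cast hk
      exact ⟨h1 hm' (hm'.trans hk') hk', h2 hm' (hm'.trans hk') hk'⟩

lemma IsSlowSeq.rpow {h : ℕ → ℝ} (hh : IsSlowSeq h) {e : ℝ} (he : 0 < e) :
    IsSlowSeq fun k => h k ^ e where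
  pos k hk := rpow_pos_of_pos (hh.pos k hk) _
  slow δ hδ := by
    obtain ⟨T, hT1, hT⟩ := hh.slow (δ / e) (by positivity)
    refine ⟨T, hT1, fun m k hm hk => ?_⟩
    have hm0 := hh.pos m (hT1.trans hm)
    have hk0 := hh.pos k (hT1.trans (hm.trans hk))
    have key : ∀ (j : ℕ) (d : ℝ), 0 ≤ h j → h j ^ e * (j : ℝ) ^ (d * e) = (h j * (j : ℝ) ^ d) ^ e := by
      intro j d hj
      rw [mul_rpow hj (by positivity), ← rpow_mul (by positivity)]
    have e1 : δ = δ / e * e := by field_simp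
    have e2 : -δ = -(δ / e) * e := by field_simp
    rw [e2]
    nth_rewrite 1 2 [e1]
    rw [key _ _ hm0.le, key _ _ hk0.le, key _ _ hm0.le, key _ _ hk0.le]
    obtain ⟨h1, h2⟩ := hT m k hm hk
    exact ⟨rpow_le_rpow (by positivity) h1 he.le, rpow_le_rpow (by positivity) h2 he.le⟩

/-- Hardy–Littlewood estimate for slowly varying coefficients. -/
theorem IsSlowSeq.eLpNorm_le {h : ℕ → ℝ} (hh : IsSlowSeq h) {r : ℝ} (hr : 1 < r) :
    ∃ C, 0 < C ∧ ∀ (θ : ℝ) (B : ℕ), 1 ≤ B →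
      eLpNorm (cosSum (fun k => h k * (k : ℝ) ^ (-1 + 1 / r)) θ 1 B) (ENNReal.ofReal r)
        periodMeasure ≤
          ENNReal.ofReal (C * (∑ k ∈ Finset.Ico 1 B, h k ^ r / k + h B ^ r) ^ (1 / r)) := by
  have hr0 : 0 < r := by linarith
  set ν : ℕ → ℝ := fun k => h k * (k : ℝ) ^ (-1 + 1 / r) with hν
  have hpos : ∀ k, 1 ≤ k → 0 < ν k := fun k hk => by
    have : (0 : ℝ) < k := by exact_mod_cast hk
    have := hh.pos k hk
    positivity
  have hvar : ∃ K, 0 < K ∧ ∀ M, 1 ≤ M → ∀ B, M ≤ B → tailVar ν M B ≤ K * ν M := by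
    -- With this δ the coefficients h(k) k^{-δ} themselves are eventually nonincreasing.
    obtain ⟨T, hT1, hT⟩ := hh.slow (1 - 1 / r) (by
      rw [sub_pos, div_lt_one hr0]
      exact hr)
    refine exists_tailVar_le hpos hT1 fun m k hm hk => ?_
    have := (hT m k hm hk).2
    rwa [show -(1 - 1 / r) = -1 + 1 / r by ring] at this
  have hsum : ∃ K, 0 < K ∧ ∀ M : ℕ, 1 ≤ M → ∑ k ∈ Finset.Ico 1 M, ν k ≤ K * (M * ν M) := by
    -- The exponent -1 + 1/r is split as c + (c - 1): h(k) k^c is eventually nondecreasing and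
    -- leaves the sum, and k^{c-1} sums to a multiple of M^c.
    set c : ℝ := 1 / (2 * r) with hc
    have hc0 : 0 < c := by positivity
    obtain ⟨T, hT1, hT⟩ := hh.slow c hc0
    have hw : ∀ M : ℕ, 1 ≤ M → (M : ℝ) * ν M = h M * (M : ℝ) ^ c * (M : ℝ) ^ c := by
      intro M hM
      have hM0 : (0 : ℝ) < M := by exact_mod_cast hM
      rw [hν, mul_assoc, ← rpow_add hM0]
      simp only
      rw [mul_left_comm, ← rpow_one_add' hM0.le (by rw [add_neg_cancel_left]; positivity)]
      congr 2
      rw [hc]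
      field_simp
      ring
    refine eventually_to_uniform (P := fun M c => ∑ k ∈ Finset.Ico 1 M, ν k ≤ c)
      (fun m a b hab h => h.trans hab) (w := fun M : ℕ => (M : ℝ) * ν M)
      (fun m hm => mul_pos (by exact_mod_cast hm) (hpos m hm)) ?_ fun m _ => ⟨_, le_rfl⟩
    set A := ∑ k ∈ Finset.Ico 1 T, ν k with hA
    have hA0 : 0 ≤ A := Finset.sum_nonneg fun k hk => (hpos k (Finset.mem_Ico.1 hk).1).le
    have hT0 : (0 : ℝ) < T := by exact_mod_cast hT1
    have hwT : 0 < (T : ℝ) * ν T := mul_pos hT0 (hpos T hT1)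
    refine ⟨T, A / (T * ν T) + 2 / c, fun M hM hM1 => ?_⟩
    have hM0 : (0 : ℝ) < M := by exact_mod_cast hM1
    have hhM := hh.pos M hM1
    have hTM : (T : ℝ) ≤ M := by exact_mod_cast hM
    have hmono : (T : ℝ) * ν T ≤ M * ν M := by
      rw [hw T hT1, hw M hM1]
      have h1 := (hT T M le_rfl hM).1
      have h2 : (T : ℝ) ^ c ≤ (M : ℝ) ^ c := rpow_le_rpow hT0.le hTM hc0.le
      have := hh.pos T hT1
      gcongr
    have h1 : A ≤ A / (T * ν T) * (M * ν M) := by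
      rw [div_mul_eq_mul_div, le_div_iff₀ hwT]
      exact mul_le_mul_of_nonneg_left hmono hA0
    have h2 : ∑ k ∈ Finset.Ico T M, ν k ≤ 2 / c * (M * ν M) := by
      calc ∑ k ∈ Finset.Ico T M, ν k
          ≤ ∑ k ∈ Finset.Ico T M, h M * (M : ℝ) ^ c * (k : ℝ) ^ (c - 1) := by
            refine Finset.sum_le_sum fun k hk => ?_
            obtain ⟨hkT, hkM⟩ := Finset.mem_Ico.1 hk
            have hk0 : (0 : ℝ) < k := by exact_mod_cast hT1.trans hkT
            have e : ν k = h k * (k : ℝ) ^ c * (k : ℝ) ^ (c - 1) := by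
              rw [mul_assoc, ← rpow_add hk0]
              simp only [hν]
              congr 2
              rw [hc]
              field_simp
              ring
            rw [e]
            exact mul_le_mul_of_nonneg_right (hT k M hkT hkM.le).1 (by positivity)
        _ ≤ ∑ k ∈ Finset.Ico 1 M, h M * (M : ℝ) ^ c * (k : ℝ) ^ (c - 1) :=
            Finset.sum_le_sum_of_subset_of_nonneg (Finset.Ico_subset_Ico hT1 le_rfl)
              fun _ _ _ => by positivity
        _ ≤ h M * (M : ℝ) ^ c * (2 / c * (M : ℝ) ^ c) := by
            rw [← Finset.mul_sum]
            exact mul_le_mul_of_nonneg_left (sum_rpow_le hc0 M) (by positivity)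
        _ = _ := by
            rw [hw M hM1]
            ring
    rw [← Finset.sum_Ico_consecutive _ hT1 hM, add_mul]
    exact add_le_add h1 h2
  obtain ⟨K₁, hK₁, hvar⟩ := hvar
  obtain ⟨K₂, hK₂, hsum⟩ := hsum
  obtain ⟨C, hC, hmain⟩ := eLpNorm_cosSum_le_of_quasi hr (show 0 < K₁ + K₂ by positivity) hpos
    (fun M hM => (hsum M hM).trans (mul_le_mul_of_nonneg_right (by linarith)
      (mul_nonneg (by positivity) (hpos M hM).le)))
    (fun M hM B hB => (hvar M hM B hB).trans (mul_le_mul_of_nonneg_right (by linarith)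
      (hpos M hM).le))
  refine ⟨C, hC, fun θ B hB => (hmain θ B hB).trans (le_of_eq ?_)⟩
  have e : ∀ k : ℕ, 1 ≤ k → ∀ d : ℝ, ν k ^ r * (k : ℝ) ^ d = h k ^ r * (k : ℝ) ^ (1 - r + d) := by
    intro k hk d
    have hk0 : (0 : ℝ) < k := by exact_mod_cast hk
    simp only [hν]
    rw [mul_rpow (hh.pos k hk).le (by positivity), ← rpow_mul hk0.le, mul_assoc, ← rpow_add hk0]
    congr 2
    field_simp
    ring
  congr 4
  · refine Finset.sum_congr rfl fun k hk => ?_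
    rw [e k (Finset.mem_Ico.1 hk).1, show 1 - r + (r - 2) = -1 by ring, rpow_neg_one, div_eq_mul_inv]
  · rw [e B hB, show 1 - r + (r - 1) = 0 by ring, rpow_zero, mul_one]

/-- Since h(k)/k is almost decreasing, each of the n - 1 terms is at least a constant times h(n)/n,
and n - 1 ≥ n/2. At n = 1 the sum is empty, which is why n ≥ 2 is required. -/
lemma IsSlowSeq.le_sum {h : ℕ → ℝ} (hh : IsSlowSeq h) :
    ∃ C, 0 < C ∧ ∀ n : ℕ, 2 ≤ n → h n ≤ C * ∑ k ∈ Finset.Ico 1 n, h k / k := by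
  obtain ⟨T, hT1, hT⟩ := hh.slow 1 one_pos
  have hpos : ∀ k, 1 ≤ k → 0 < h k / k := fun k hk =>
    div_pos (hh.pos k hk) (by exact_mod_cast hk)
  obtain ⟨K, hK, hanti⟩ := exists_almost_antitone hpos hT1 fun m k hm hk => by
    have := (hT m k hm hk).2
    rwa [rpow_neg_one, rpow_neg_one, ← div_eq_mul_inv, ← div_eq_mul_inv] at this
  refine ⟨2 * K, by positivity, fun n hn => ?_⟩
  have hn0 : (2 : ℝ) ≤ n := by exact_mod_cast hn
  have h1 : ∑ k ∈ Finset.Ico 1 n, h n / n ≤ ∑ k ∈ Finset.Ico 1 n, K * (h k / k) :=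
    Finset.sum_le_sum fun k hk =>
      hanti k n (Finset.mem_Ico.1 hk).1 (Finset.mem_Ico.1 hk).2.le
  rw [← Finset.mul_sum, Finset.sum_const, Nat.card_Ico, nsmul_eq_mul,
    Nat.cast_sub (by omega)] at h1
  have hhn := hh.pos n (by omega)
  have h2 : h n / 2 ≤ ((n : ℝ) - (1 : ℕ)) * (h n / n) := by
    rw [Nat.cast_one, ← mul_div_assoc, div_le_div_iff₀ (by norm_num) (by linarith)]
    nlinarith
  linarith

/-- A slowly varying function is comparable to its values at the integers. -/
lemma MemZ.comparable {g : ℝ → ℝ} (hg : MemZ g) : ∃ K, 0 < K ∧ ∀ k : ℕ, 1 ≤ k →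
    ∀ t ∈ Icc (k : ℝ) (k + 1), g t ≤ K * g k ∧ g k ≤ K * g t := by
  obtain ⟨hcont, hpos, hz⟩ := hg
  have := eventually_to_uniform (w := fun _ => 1) (P := fun k c =>
      ∀ t ∈ Icc (k : ℝ) (k + 1), 1 ≤ (k : ℝ) → g t ≤ c * g k ∧ g k ≤ c * g t) ?_
      (fun _ _ => one_pos) ?_ ?_
  · obtain ⟨K, hK, h⟩ := this
    refine ⟨K, hK, fun k hk t ht => ?_⟩
    have := h k hk t ht (by exact_mod_cast hk)
    rwa [mul_one] at this
  · intro m a b hab h t ht hm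
    have hgm := hpos m hm
    have hgt := hpos t (hm.trans ht.1)
    obtain ⟨h1, h2⟩ := h t ht hm
    exact ⟨h1.trans (by gcongr), h2.trans (by gcongr)⟩
  -- For large m, monotonicity of g(t)t and g(t)/t on [m, m+1] with t ≤ 2m gives the constant 2. The
  -- remaining m are handled by compactness.
  · obtain ⟨T, hT1, h1, h2⟩ := hz 1 one_pos
    refine ⟨⌈T⌉₊, 2, fun m hm hm1 t ht hm1' => ?_⟩
    have hmT : T ≤ m := Nat.ceil_le.1 hm
    have h3 := h1 hmT (hmT.trans ht.1) ht.1
    have h4 := h2 hmT (hmT.trans ht.1) ht.1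
    have hgm := hpos m hm1'
    have hgt := hpos t (hm1'.trans ht.1)
    simp only [rpow_one, rpow_neg_one] at h3 h4
    have hm0 : (0 : ℝ) < m := by linarith
    have ht0 : 0 < t := hm0.trans_le ht.1
    have ht2 : t ≤ 2 * m := by linarith [ht.2]
    rw [← div_eq_mul_inv, ← div_eq_mul_inv, div_le_div_iff₀ ht0 hm0] at h4
    constructor
    · have h5 : g t * m ≤ (2 * 1 * g m) * m := by nlinarith
      exact le_of_mul_le_mul_right h5 hm0 |>.trans (by linarith)
    · have h5 : g m * m ≤ (2 * 1 * g t) * m := by nlinarith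
      exact le_of_mul_le_mul_right h5 hm0 |>.trans (by linarith)
  · intro m hm
    have hm1 : (1 : ℝ) ≤ m := by exact_mod_cast hm
    have hsub : Icc (m : ℝ) (m + 1) ⊆ Ici 1 := fun t ht => hm1.trans ht.1
    have hne : (Icc (m : ℝ) (m + 1)).Nonempty := nonempty_Icc.2 (by linarith)
    obtain ⟨y, hy, hymax⟩ := isCompact_Icc.exists_isMaxOn hne (hcont.mono hsub)
    obtain ⟨z, hz, hzmin⟩ := isCompact_Icc.exists_isMinOn hne (hcont.mono hsub)
    have hgm := hpos m hm1
    have hgy := hpos y (hsub hy)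
    have hgz := hpos z (hsub hz)
    refine ⟨g y / g m + g m / g z, fun t ht _ => ?_⟩
    have h1 : g t ≤ g y := hymax ht
    have h2 : g z ≤ g t := hzmin ht
    constructor
    · rw [add_mul, div_mul_cancel₀ _ hgm.ne']
      have : 0 ≤ g m / g z * g m := by positivity
      linarith
    · have h3 : g m ≤ g m / g z * g t := by
        rw [div_mul_eq_mul_div, le_div_iff₀ hgz]
        gcongr
      have : 0 ≤ g y / g m * g t := by
        have := hpos t (hsub ht)
        positivity
      rw [add_mul]
      linarith

/-- On each interval [k, k+1] the integrand is comparable to its value at k: g by `MemZ.comparable`,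
and 1/t within a factor 2. -/
lemma MemZ.logIntegral_comparable {g : ℝ → ℝ} (hg : MemZ g) {r : ℝ} (hr : 0 < r) :
    ∃ K, 0 < K ∧ ∀ n : ℕ, 1 ≤ n → logIntegral r g n ≤ K * ∑ k ∈ Finset.Ico 1 n, g k ^ r / k ∧
      ∑ k ∈ Finset.Ico 1 n, g k ^ r / k ≤ K * logIntegral r g n := by
  obtain ⟨K, hK, hKg⟩ := hg.comparable
  obtain ⟨hcont, hpos, -⟩ := hg
  have hGc : ContinuousOn (fun t => g t ^ r / t) (Ici 1) :=
    (hcont.rpow_const fun t ht => Or.inl (hpos t ht).ne').div continuousOn_id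
      fun t ht => (lt_of_lt_of_le one_pos ht).ne'
  have hint : ∀ a b : ℝ, 1 ≤ a → a ≤ b →
      IntervalIntegrable (fun t => g t ^ r / t) volume a b := fun a b ha hab =>
    (hGc.mono fun t ht => by
      rw [uIcc_of_le hab] at ht
      exact ha.trans ht.1).intervalIntegrable
  have hsplit : ∀ n : ℕ, 1 ≤ n → logIntegral r g n =
      ∑ k ∈ Finset.Ico 1 n, ∫ t in (k : ℝ)..((k + 1 : ℕ) : ℝ), g t ^ r / t := by
    intro n hn
    rw [intervalIntegral.sum_integral_adjacent_intervals_Ico (a := fun k : ℕ => (k : ℝ)) hn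
      fun k hk => hint _ _ (by exact_mod_cast hk.1) (by push_cast; linarith)]
    simp only [logIntegral, Nat.cast_one]
  have hpt : ∀ k : ℕ, 1 ≤ k → ∀ t ∈ Icc (k : ℝ) (k + 1),
      g t ^ r / t ≤ 2 * K ^ r * (g k ^ r / k) ∧ g k ^ r / k ≤ 2 * K ^ r * (g t ^ r / t) := by
    intro k hk t ht
    have hk1 : (1 : ℝ) ≤ k := by exact_mod_cast hk
    have hk0 : (0 : ℝ) < k := by linarith
    have ht0 : 0 < t := hk0.trans_le ht.1
    have hgk := hpos k hk1
    have hgt := hpos t (hk1.trans ht.1)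
    obtain ⟨h1, h2⟩ := hKg k hk t ht
    have h3 : g t ^ r ≤ K ^ r * g k ^ r := by
      rw [← mul_rpow hK.le hgk.le]
      exact rpow_le_rpow hgt.le h1 hr.le
    have h4 : g k ^ r ≤ K ^ r * g t ^ r := by
      rw [← mul_rpow hK.le hgt.le]
      exact rpow_le_rpow hgk.le h2 hr.le
    constructor
    · rw [← mul_div_assoc]
      refine (div_le_div_of_nonneg_left (by positivity) hk0 ht.1).trans ?_
      refine div_le_div_of_nonneg_right (h3.trans ?_) hk0.le
      have : 0 ≤ K ^ r * g k ^ r := by positivity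
      linarith
    · rw [← mul_div_assoc, div_le_div_iff₀ hk0 ht0]
      have h5 : t ≤ 2 * k := by linarith [ht.2]
      calc g k ^ r * t ≤ (K ^ r * g t ^ r) * (2 * k) := by gcongr
        _ = _ := by ring
  have hconst : ∀ (k : ℕ) (x : ℝ), x = ∫ _ in (k : ℝ)..((k + 1 : ℕ) : ℝ), x := fun k x => by simp
  refine ⟨2 * K ^ r, by positivity, fun n hn => ?_⟩
  rw [hsplit n hn, Finset.mul_sum, Finset.mul_sum]
  constructor
  · refine Finset.sum_le_sum fun k hk => ?_
    have hk1 := (Finset.mem_Ico.1 hk).1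
    rw [hconst k (2 * K ^ r * (g k ^ r / k))]
    refine intervalIntegral.integral_mono_on (by push_cast; linarith)
      (hint _ _ (by exact_mod_cast hk1) (by push_cast; linarith)) (by simp) fun t ht => ?_
    push_cast at ht
    exact (hpt k hk1 t ht).1
  · refine Finset.sum_le_sum fun k hk => ?_
    have hk1 := (Finset.mem_Ico.1 hk).1
    rw [hconst k (g k ^ r / k), ← intervalIntegral.integral_const_mul]
    refine intervalIntegral.integral_mono_on (by push_cast; linarith)
      (by simp) ((hint _ _ (by exact_mod_cast hk1) (by push_cast; linarith)).const_mul _)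
      fun t ht => ?_
    push_cast at ht
    exact (hpt k hk1 t ht).2

/-! ### Order relations and tail sequences -/

lemma bigO_of_le {N : ℕ} {A : ℝ → ℕ → ℝ≥0∞} {b : ℕ → ℝ} {C : ℝ} (hC : 0 < C)
    (h : ∀ β n, N ≤ n → A β n ≤ ENNReal.ofReal (C * b n)) :
    BigO N A fun _ n => ENNReal.ofReal (b n) := by
  refine ⟨C.toNNReal, by simpa using hC, fun β n hn => (h β n hn).trans ?_⟩
  rw [ENNReal.ofReal_mul hC.le]
  rfl

lemma bigO_of_ge {N : ℕ} {A : ℝ → ℕ → ℝ≥0∞} {b : ℕ → ℝ} {c : ℝ} (hc : 0 < c)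
    (h : ∀ β n, N ≤ n → ENNReal.ofReal (c * b n) ≤ A β n) :
    BigO N (fun _ n => ENNReal.ofReal (b n)) A := by
  refine ⟨(1 / c).toNNReal, by simpa using hc, fun β n hn => ?_⟩
  calc ENNReal.ofReal (b n) = ENNReal.ofReal (1 / c * (c * b n)) := by
        rw [← mul_assoc, one_div_mul_cancel hc.ne', one_mul]
    _ = ENNReal.ofReal (1 / c) * ENNReal.ofReal (c * b n) := ENNReal.ofReal_mul (by positivity)
    _ ≤ _ := mul_le_mul_right (h β n hn) _

/-- The rate tends to zero because it is n^α u(n), which is bounded, times n^{-d} with d = α - (1 -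
1/r) > 0. -/
lemma IsTailSeq.exists_hasTailBound {u : ℕ → ℝ} {α K r : ℝ} (h : IsTailSeq u α K) (hr : 1 < r)
    (hα : 1 - 1 / r < α) (hα1 : α < 1) :
    ∃ C, 0 < C ∧ HasTailBound u r fun n => C * (u n * (n : ℝ) ^ (1 - 1 / r)) := by
  obtain ⟨C, hC, hb⟩ := h.eLpNorm_le hr hα hα1
  have hpos : ∀ n : ℕ, 1 ≤ n → 0 ≤ C * (u n * (n : ℝ) ^ (1 - 1 / r)) := fun n hn => by
    have := h.pos n hn
    positivity
  refine ⟨C, hC, ?_, hpos, hb⟩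
  set d := α - (1 - 1 / r) with hd
  have hd0 : 0 < d := by linarith
  have hlim : Tendsto (fun n : ℕ => C * (K * u 1) * (n : ℝ) ^ (-d)) atTop (𝓝 0) := by
    have := ((tendsto_rpow_neg_atTop hd0).comp tendsto_natCast_atTop_atTop).const_mul
      (C * (K * u 1))
    rwa [mul_zero] at this
  refine tendsto_of_tendsto_of_tendsto_of_le_of_le' tendsto_const_nhds hlim
    (eventually_atTop.2 ⟨1, hpos⟩) (eventually_atTop.2 ⟨1, fun n hn => ?_⟩)
  have hn0 : (0 : ℝ) < n := by exact_mod_cast hn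
  have h1 := h.decr 1 n le_rfl hn
  rw [Nat.cast_one, one_rpow, one_mul] at h1
  rw [mul_assoc C]
  refine mul_le_mul_of_nonneg_left ?_ hC.le
  calc u n * (n : ℝ) ^ (1 - 1 / r) = ((n : ℝ) ^ α * u n) * (n : ℝ) ^ (-d) := by
        rw [mul_comm _ (u n), mul_assoc, ← rpow_add hn0]
        congr 2
        rw [hd]
        ring
    _ ≤ _ := mul_le_mul_of_nonneg_right h1 (by positivity)

lemma exists_isTailSeq_of_antitone {u : ℕ → ℝ} (hpos : ∀ k, 1 ≤ k → 0 < u k) {α : ℝ} (hα : 0 ≤ α)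
    {T : ℕ} (hT : 1 ≤ T)
    (hanti : ∀ m k : ℕ, T ≤ m → m ≤ k → (k : ℝ) ^ α * u k ≤ (m : ℝ) ^ α * u m) :
    ∃ K, IsTailSeq u α K := by
  have hpos' : ∀ k : ℕ, 1 ≤ k → 0 < (k : ℝ) ^ α * u k := fun k hk =>
    mul_pos (rpow_pos_of_pos (by exact_mod_cast hk) _) (hpos k hk)
  obtain ⟨K₁, hK₁, h1⟩ := exists_almost_antitone hpos' hT hanti
  obtain ⟨K₂, hK₂, h2⟩ := exists_tailVar_le hpos hT fun m k hm hk => by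
    have hm0 : (0 : ℝ) < m := by exact_mod_cast hT.trans hm
    have hmk : (m : ℝ) ^ α ≤ (k : ℝ) ^ α := rpow_le_rpow hm0.le (by exact_mod_cast hk) hα
    have hk0 := hpos k (hT.trans (hm.trans hk))
    have h3 : (m : ℝ) ^ α * u k ≤ (m : ℝ) ^ α * u m :=
      (mul_le_mul_of_nonneg_right hmk hk0.le).trans (hanti m k hm hk)
    exact le_of_mul_le_mul_left h3 (by positivity)
  refine ⟨K₁ + K₂, by positivity, hpos, fun m k hm hk => (h1 m k hm hk).trans ?_,
    fun M hM B hB => (h2 M hM B hB).trans ?_⟩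
  · exact mul_le_mul_of_nonneg_right (by linarith) (hpos' m hm).le
  · exact mul_le_mul_of_nonneg_right (by linarith) (hpos M hM).le

/-! ### The slowly varying case -/

section Cases

variable {p s : ℝ} {ψ : ℝ → ℝ} {τ : ℕ → ℝ}

lemma one_sub_one_div_conjExponent (hp : 1 < p) : 1 - 1 / p.conjExponent = 1 / p := by
  have := (HolderConjugate.conjExponent hp).inv_add_inv_eq_one
  rw [one_div, one_div]
  linarith

lemma one_lt_conjExponent (hp : 1 < p) : 1 < p.conjExponent :=
  (HolderConjugate.conjExponent hp).symm.lt

lemma eq_gFun_mul (s p : ℝ) (ψ : ℝ → ℝ) {k : ℕ} (hk : 1 ≤ k) (d : ℝ) :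
    ψ k * (k : ℝ) ^ d = gFun ψ s p k * (k : ℝ) ^ (d - (s + 1 / p)) := by
  have hk0 : (0 : ℝ) < k := by exact_mod_cast hk
  rw [gFun, mul_assoc, ← rpow_add hk0]
  congr 2
  ring

/-- Puts the tail on the same scale n^{-s} as the low part. -/
lemma tail_eq (s p : ℝ) (ψ : ℝ → ℝ) {n : ℕ} (hn : 1 ≤ n) :
    ψ n * (n : ℝ) ^ (1 / p) = 1 / (n : ℝ) ^ s * gFun ψ s p n := by
  rw [eq_gFun_mul s p ψ hn, show 1 / p - (s + 1 / p) = -s by ring, rpow_neg (by positivity)]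
  ring

lemma coeff_eq (s p : ℝ) (ψ : ℝ → ℝ) {k : ℕ} (hk : 1 ≤ k) :
    (k : ℝ) ^ s * ψ k = gFun ψ s p k * (k : ℝ) ^ (-(1 / p)) := by
  rw [mul_comm, eq_gFun_mul s p ψ hk]
  congr 2
  ring

lemma cosSum_congr {u v : ℕ → ℝ} (θ : ℝ) {a b : ℕ} (h : ∀ k, a ≤ k → k < b → u k = v k) :
    cosSum u θ a b = cosSum v θ a b := by
  ext x
  exact Finset.sum_congr rfl fun k hk => by
    rw [h k (Finset.mem_Ico.1 hk).1 (Finset.mem_Ico.1 hk).2]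

/-- The trivial lower bound of order `n^{-s}`. -/
lemma exists_le_zygmundError (hp : 1 < p) (hψ : ∀ k : ℕ, 1 ≤ k → 0 < ψ k)
    (hτ : HasTailBound (fun k => ψ k) p.conjExponent τ) :
    BigO 1 (fun _ n => ENNReal.ofReal (1 / (n : ℝ) ^ s)) (zygmundError ψ p s) := by
  obtain ⟨C, hC, hb⟩ := eLpNorm_block_le hp
  have h1 := hψ 1 le_rfl
  have h2 := hψ 2 (by norm_num)
  push_cast at h1 h2
  refine bigO_of_ge (c := ψ 1 / C) (by positivity) fun β n hn => ?_
  -- The block with n = 1 is the test polynomial of frequencies 1 and 2: frequency 1 already has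
  -- multiplier at least n^{-s}, and frequency 2 contributes nonnegatively.
  have hb1 := hb (-(β * π / 2)) 1 le_rfl
  rw [Nat.cast_one, one_rpow, mul_one, mul_one] at hb1
  refine le_trans (ENNReal.ofReal_le_ofReal ?_) (le_zygmundError hp hτ β n hC hb1)
  have hn0 : (0 : ℝ) < n := by exact_mod_cast hn
  have hm2 : 0 ≤ zygmundMult s n 2 := by
    rw [zygmundMult]
    split_ifs <;> positivity
  have hm1 : 1 / (n : ℝ) ^ s ≤ zygmundMult s n 1 := by
    rw [zygmundMult]
    split_ifs with h
    · rw [Nat.cast_one, div_rpow zero_le_one hn0.le, one_rpow]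
    · have : n = 1 := by omega
      simp [this]
  have hsum : ∑ k ∈ Finset.Ico 1 3, zygmundMult s n k * (1 * ψ k) =
      zygmundMult s n 1 * ψ 1 + zygmundMult s n 2 * ψ 2 := by
    rw [Finset.sum_Ico_succ_top (by norm_num), Finset.sum_Ico_succ_top (by norm_num)]
    simp
  rw [hsum, div_mul_eq_mul_div]
  refine div_le_div_of_nonneg_right ?_ hC.le
  have h3 : 1 / (n : ℝ) ^ s * ψ 1 ≤ zygmundMult s n 1 * ψ 1 :=
    mul_le_mul_of_nonneg_right hm1 h1.le
  have h4 : 0 ≤ zygmundMult s n 2 * ψ 2 := by positivity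
  linarith

/-- An admissible decay exponent. -/
lemma exists_exponent (hp : 1 < p) (hs : 0 < s) :
    ∃ α, 1 / p < α ∧ α < 1 ∧ α < s + 1 / p := by
  have h1 : 1 / p < 1 := by
    rw [div_lt_one (by linarith)]
    exact hp
  obtain ⟨α, h2, h3⟩ := exists_between (show 1 / p < min 1 (s + 1 / p) from
    lt_min h1 (by linarith))
  exact ⟨α, h2, h3.trans_le (min_le_left _ _), h3.trans_le (min_le_right _ _)⟩

section Slow

/-- Here ψ(k) k^α = g(k) k^{-(s+1/p-α)} with a positive exponent s + 1/p - α, so slow variation of g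
alone makes it eventually nonincreasing. -/
lemma MemZ.exists_hasTailBound (hp : 1 < p) (hs : 0 < s) (hψ : ∀ k : ℕ, 1 ≤ k → 0 < ψ k)
    (hg : MemZ (gFun ψ s p)) : ∃ C, 0 < C ∧ HasTailBound (fun k => ψ k) p.conjExponent
      fun n => C * (ψ n * (n : ℝ) ^ (1 / p)) := by
  obtain ⟨α, hα1, hα2, hα3⟩ := exists_exponent hp hs
  obtain ⟨T, hT1, hT⟩ := hg.isSlowSeq.slow (s + 1 / p - α) (by linarith)
  obtain ⟨K, hK⟩ := exists_isTailSeq_of_antitone hψ (α := α)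
    (lt_trans (by positivity) hα1).le hT1 fun m k hm hk => by
      have h1 := (hT m k hm hk).2
      rw [mul_comm, eq_gFun_mul s p ψ (hT1.trans (hm.trans hk)), mul_comm ((m : ℝ) ^ α),
        eq_gFun_mul s p ψ (hT1.trans hm)]
      rwa [neg_sub] at h1
  rw [← one_sub_one_div_conjExponent hp] at hα1 ⊢
  exact hK.exists_hasTailBound (one_lt_conjExponent hp) hα1 hα2

/-- The sum `∑_{k < n} g^q(k) / k`. -/
noncomputable def logSum (q : ℝ) (g : ℝ → ℝ) (n : ℕ) : ℝ := ∑ k ∈ Finset.Ico 1 n, g k ^ q / k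

lemma logSum_nonneg {q : ℝ} {g : ℝ → ℝ} (hg : MemZ g) (n : ℕ) : 0 ≤ logSum q g n :=
  Finset.sum_nonneg fun k hk => div_nonneg (rpow_nonneg
    (hg.2.1 k (by exact_mod_cast (Finset.mem_Ico.1 hk).1)).le _) (by positivity)

/-- The low coefficients are g(k) k^{-1+1/q}, to which the Hardy–Littlewood estimate applies. The
tail n^{-s} g(n) is absorbed by the last summand g(n)^q. -/
lemma MemZ.zygmundError_le (hp : 1 < p) (hs : 0 < s) (hψ : ∀ k : ℕ, 1 ≤ k → 0 < ψ k)
    (hg : MemZ (gFun ψ s p)) : ∃ C, 0 < C ∧ ∀ (β : ℝ) (n : ℕ), 1 ≤ n → zygmundError ψ p s β n ≤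
      ENNReal.ofReal (C * (1 / (n : ℝ) ^ s * (logSum p.conjExponent (gFun ψ s p) n +
        gFun ψ s p n ^ p.conjExponent) ^ (1 / p.conjExponent))) := by
  set q := p.conjExponent with hq_def
  have hq : 1 < q := one_lt_conjExponent hp
  obtain ⟨C₁, hC₁, hτ⟩ := hg.exists_hasTailBound hp hs hψ
  obtain ⟨C₂, hC₂, hlow⟩ := hg.isSlowSeq.eLpNorm_le hq
  refine ⟨C₁ + C₂, by positivity, fun β n hn => ?_⟩
  set g := gFun ψ s p
  have hgn : 0 < g n := hg.2.1 n (by exact_mod_cast hn)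
  have hS := logSum_nonneg (q := q) hg n
  set X := (logSum q g n + g n ^ q) ^ (1 / q) with hX
  have hX0 : 0 ≤ X := by positivity
  have hgX : g n ≤ X := by
    calc g n = (g n ^ q) ^ (1 / q) := by
          rw [← rpow_mul hgn.le, mul_one_div_cancel (by linarith), rpow_one]
      _ ≤ X := rpow_le_rpow (by positivity) (by linarith) (by positivity)
  have hl : eLpNorm (cosSum (fun k => (k : ℝ) ^ s * ψ k) (β * π / 2) 1 n) (ENNReal.ofReal q)
      periodMeasure ≤ ENNReal.ofReal (C₂ * X) := by
    rw [cosSum_congr (v := fun k : ℕ => g k * (k : ℝ) ^ (-1 + 1 / q)) _ fun k hk _ => by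
      rw [coeff_eq s p ψ hk, ← one_sub_one_div_conjExponent hp]
      congr 2
      ring]
    exact hlow _ n hn
  refine (ZygmundSums.zygmundError_le hp hτ hn (by positivity) β hl).trans
    (ENNReal.ofReal_le_ofReal ?_)
  rw [tail_eq s p ψ hn]
  have hns : 0 ≤ 1 / (n : ℝ) ^ s := by positivity
  have : C₁ * (1 / (n : ℝ) ^ s * g n) ≤ C₁ * (1 / (n : ℝ) ^ s * X) := by gcongr
  linarith

/-- The test coefficients g^{q-1}(k) k^{-1+1/p} realise equality in the discrete Hölder inequality.
As (q-1)p = q, their polynomial has L_p norm O(S^{1/p}) with S = ∑_{k<n} g^q(k)/k, while the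
deviation at 0 is n^{-s} S before normalisation; the quotient is n^{-s} S^{1/q}. -/
lemma MemZ.le_zygmundError (hp : 1 < p) (hs : 0 < s) (hψ : ∀ k : ℕ, 1 ≤ k → 0 < ψ k)
    (hg : MemZ (gFun ψ s p)) : ∃ c, 0 < c ∧ ∀ (β : ℝ) (n : ℕ), 2 ≤ n →
      ENNReal.ofReal (c * (1 / (n : ℝ) ^ s * (logSum p.conjExponent (gFun ψ s p) n) ^
        (1 / p.conjExponent))) ≤ zygmundError ψ p s β n := by
  set q := p.conjExponent with hq_def
  have hpq : p.HolderConjugate q := HolderConjugate.conjExponent hp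
  have hq : 1 < q := one_lt_conjExponent hp
  have hp0 : 0 < p := by linarith
  obtain ⟨C₁, hC₁, hτ⟩ := hg.exists_hasTailBound hp hs hψ
  obtain ⟨C₂, hC₂, hlow⟩ := (hg.isSlowSeq.rpow (sub_pos.2 hq)).eLpNorm_le hp
  obtain ⟨C₃, hC₃, hle⟩ := (hg.isSlowSeq.rpow (zero_lt_one.trans hq)).le_sum
  set g := gFun ψ s p
  have hgpos : ∀ k : ℕ, 1 ≤ k → 0 < g k := fun k hk => hg.2.1 k (by exact_mod_cast hk)
  have hpow : ∀ k : ℕ, 1 ≤ k → (g k ^ (q - 1)) ^ p = g k ^ q := by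
    intro k hk
    rw [← rpow_mul (hgpos k hk).le]
    congr 1
    linarith [hpq.mul_eq_add]
  set c₀ := C₂ * (1 + C₃) ^ (1 / p) with hc₀
  have hc₀pos : 0 < c₀ := by positivity
  refine ⟨1 / c₀, by positivity, fun β n hn => ?_⟩
  have hn1 : 1 ≤ n := by omega
  have hn0 : (0 : ℝ) < n := by exact_mod_cast hn1
  set S := logSum q g n with hS_def
  have hgn := hgpos n hn1
  have hgS : g n ^ q ≤ C₃ * S := hle n hn
  have hS : 0 < S := by
    have : 0 < g n ^ q := by positivity
    by_contra h
    nlinarith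
  have hφ : eLpNorm (cosSum (fun k => g k ^ (q - 1) * (k : ℝ) ^ (-1 + 1 / p)) (-(β * π / 2)) 1 n)
      (ENNReal.ofReal p) periodMeasure ≤ ENNReal.ofReal (c₀ * S ^ (1 / p)) := by
    refine (hlow _ n hn1).trans (ENNReal.ofReal_le_ofReal ?_)
    rw [hpow n hn1, Finset.sum_congr rfl fun k hk => by rw [hpow k (Finset.mem_Ico.1 hk).1], hc₀,
      mul_assoc, ← mul_rpow (by positivity) hS.le]
    refine mul_le_mul_of_nonneg_left (rpow_le_rpow ?_ ?_ (by positivity)) hC₂.le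
    · have : 0 ≤ logSum q g n := hS.le
      exact add_nonneg this (by positivity)
    · change S + _ ≤ _
      linarith
  refine le_trans (ENNReal.ofReal_le_ofReal (le_of_eq ?_))
    (ZygmundSums.le_zygmundError hp hτ β n (by positivity) hφ)
  have hsum : ∑ k ∈ Finset.Ico 1 n, zygmundMult s n k * (g k ^ (q - 1) *
      (k : ℝ) ^ (-1 + 1 / p) * ψ k) = 1 / (n : ℝ) ^ s * S := by
    rw [hS_def, logSum, Finset.mul_sum]
    refine Finset.sum_congr rfl fun k hk => ?_
    obtain ⟨hk1, hkn⟩ := Finset.mem_Ico.1 hk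
    have hk0 : (0 : ℝ) < k := by exact_mod_cast hk1
    have hgk := hgpos k hk1
    rw [zygmundMult, if_pos hkn, div_rpow hk0.le hn0.le]
    calc (k : ℝ) ^ s / (n : ℝ) ^ s * (g k ^ (q - 1) * (k : ℝ) ^ (-1 + 1 / p) * ψ k)
        = 1 / (n : ℝ) ^ s * (g k ^ (q - 1) * (k : ℝ) ^ (-1 + 1 / p) * ((k : ℝ) ^ s * ψ k)) := by
          ring
      _ = 1 / (n : ℝ) ^ s * ((g k ^ (q - 1) * g k) *
            ((k : ℝ) ^ (-1 + 1 / p) * (k : ℝ) ^ (-(1 / p)))) := by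
          rw [coeff_eq s p ψ hk1]
          ring
      _ = _ := by
          rw [← rpow_add hk0, ← rpow_add_one hgk.ne', sub_add_cancel,
            show -1 + 1 / p + -(1 / p) = (-1 : ℝ) by ring, rpow_neg_one, div_eq_mul_inv (g k ^ q)]
  have hSpow : S ^ (1 / q) = S / S ^ (1 / p) := by
    rw [eq_div_iff (by positivity), ← rpow_add hS]
    have := hpq.inv_add_inv_eq_one
    rw [one_div, one_div, add_comm, this, rpow_one]
  rw [hsum, hSpow]
  field_simp

theorem MemZ.orderEq (hp : 1 < p) (hs : 0 < s) (hψ : ∀ k : ℕ, 1 ≤ k → 0 < ψ k)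
    (hg : MemZ (gFun ψ s p)) : OrderEq 2 (zygmundError ψ p s) (fun _ n =>
      ENNReal.ofReal (1 / (n : ℝ) ^ s * (logIntegral p.conjExponent (gFun ψ s p) n) ^
        (1 / p.conjExponent))) := by
  have hq : 1 < p.conjExponent := one_lt_conjExponent hp
  obtain ⟨C₁, hC₁, hup⟩ := hg.zygmundError_le hp hs hψ
  obtain ⟨c₂, hc₂, hlo⟩ := hg.le_zygmundError hp hs hψ
  obtain ⟨C₃, hC₃, hle⟩ := (hg.isSlowSeq.rpow (zero_lt_one.trans hq)).le_sum
  obtain ⟨K, hK, hcomp⟩ := hg.logIntegral_comparable (zero_lt_one.trans hq)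
  set q := p.conjExponent
  set g := gFun ψ s p
  have hS := logSum_nonneg (q := q) hg
  have hI : ∀ n : ℕ, 1 ≤ n → 0 ≤ logIntegral q g n := fun n hn => by
    have h1 : logSum q g n ≤ K * logIntegral q g n := (hcomp n hn).2
    by_contra h
    nlinarith [hS n]
  constructor
  · refine bigO_of_le (C := C₁ * ((1 + C₃) * K) ^ (1 / q)) (by positivity) fun β n hn =>
      (hup β n (by omega)).trans (ENNReal.ofReal_le_ofReal ?_)
    have hgn : 0 < g n := hg.2.1 n (by exact_mod_cast (by omega : 1 ≤ n))
    have h1 : logSum q g n ≤ K * logIntegral q g n := (hcomp n (by omega)).2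
    have h2 : g n ^ q ≤ C₃ * logSum q g n := hle n hn
    have hIn := hI n (by omega)
    have h3 : (logSum q g n + g n ^ q) ^ (1 / q) ≤
        ((1 + C₃) * K) ^ (1 / q) * logIntegral q g n ^ (1 / q) := by
      rw [← mul_rpow (by positivity) hIn]
      refine rpow_le_rpow (add_nonneg (hS n) (by positivity)) ?_ (by positivity)
      have h4 : C₃ * logSum q g n ≤ C₃ * (K * logIntegral q g n) := by gcongr
      linarith
    calc _ ≤ C₁ * (1 / (n : ℝ) ^ s * (((1 + C₃) * K) ^ (1 / q) * logIntegral q g n ^ (1 / q))) := by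
          gcongr
      _ = _ := by ring
  · refine bigO_of_ge (c := c₂ * (1 / K) ^ (1 / q)) (by positivity) fun β n hn =>
      le_trans (ENNReal.ofReal_le_ofReal ?_) (hlo β n hn)
    have h1 : logIntegral q g n ≤ K * logSum q g n := (hcomp n (by omega)).1
    have hIn := hI n (by omega)
    have h3 : (1 / K) ^ (1 / q) * logIntegral q g n ^ (1 / q) ≤ logSum q g n ^ (1 / q) := by
      rw [← mul_rpow (by positivity) hIn]
      refine rpow_le_rpow (by positivity) ?_ (by positivity)
      rw [div_mul_eq_mul_div, one_mul, div_le_iff₀ hK]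
      linarith
    calc _ = c₂ * (1 / (n : ℝ) ^ s * ((1 / K) ^ (1 / q) * logIntegral q g n ^ (1 / q))) := by ring
      _ ≤ _ := by gcongr

/-- The sum is controlled by the bounded integral and g(n) by g(1), so only n^{-s} remains. -/
theorem MemZMinus.orderEq_of_bounded (hp : 1 < p) (hs : 0 < s) (hψ : ∀ k : ℕ, 1 ≤ k → 0 < ψ k)
    (hg : MemZMinus p.conjExponent (gFun ψ s p))
    (hb : LogIntegralBounded p.conjExponent (gFun ψ s p)) :
    OrderEq 1 (zygmundError ψ p s) (fun _ n => ENNReal.ofReal (1 / (n : ℝ) ^ s)) := by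
  obtain ⟨hgZ, hanti, -⟩ := hg
  have hq : 1 < p.conjExponent := one_lt_conjExponent hp
  obtain ⟨C₁, hC₁, hτ⟩ := hgZ.exists_hasTailBound hp hs hψ
  refine ⟨?_, exists_le_zygmundError hp hψ hτ⟩
  obtain ⟨C₂, hC₂, hup⟩ := hgZ.zygmundError_le hp hs hψ
  obtain ⟨K, hK, hcomp⟩ := hgZ.logIntegral_comparable (zero_lt_one.trans hq)
  obtain ⟨A, hA⟩ := hb
  set q := p.conjExponent
  set g := gFun ψ s p
  have hg1 : 0 < g 1 := hgZ.2.1 1 le_rfl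
  refine bigO_of_le (C := C₂ * (K * |A| + g 1 ^ q) ^ (1 / q)) (by positivity) fun β n hn =>
      (hup β n hn).trans (ENNReal.ofReal_le_ofReal ?_)
  have hn' : (1 : ℝ) ≤ n := by exact_mod_cast hn
  have hgn : 0 < g n := hgZ.2.1 n hn'
  have h1 : logSum q g n ≤ K * logIntegral q g n := (hcomp n hn).2
  have h2 : K * logIntegral q g n ≤ K * |A| :=
    mul_le_mul_of_nonneg_left ((hA n hn).trans (le_abs_self _)) hK.le
  have h3 : g n ^ q ≤ g 1 ^ q := by
    refine rpow_le_rpow hgn.le (hanti self_mem_Ici hn' hn') (by positivity)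
  calc C₂ * (1 / (n : ℝ) ^ s * (logSum q g n + g n ^ q) ^ (1 / q))
      ≤ C₂ * (1 / (n : ℝ) ^ s * (K * |A| + g 1 ^ q) ^ (1 / q)) := by
        have := logSum_nonneg (q := q) hgZ n
        gcongr
        exact h1.trans h2
    _ = _ := by ring

end Slow

end Cases

lemma BigO.trans {N : ℕ} {A B C : ℝ → ℕ → ℝ≥0∞} (h₁ : BigO N A B) (h₂ : BigO N B C) :
    BigO N A C := by
  obtain ⟨K₁, hK₁, h₁⟩ := h₁
  obtain ⟨K₂, hK₂, h₂⟩ := h₂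
  refine ⟨K₁ * K₂, mul_pos hK₁ hK₂, fun β n hn => (h₁ β n hn).trans ?_⟩
  rw [ENNReal.coe_mul, mul_assoc]
  exact mul_le_mul_right (h₂ β n hn) _

/-! ### Power growth and decay: the classes `MemAMinus` and `MemAPlus` -/

/-- Coefficients whose partial sums and variations have power growth. -/
theorem eLpNorm_cosSum_le_of_power {q e : ℝ} (hq : 1 < q) (he : e ≠ 0) :
    ∃ C, 0 < C ∧ ∀ (ν : ℕ → ℝ) (θ : ℝ) (n : ℕ) (A : ℝ), 1 ≤ n → 0 ≤ A →
      (∀ M : ℕ, 1 ≤ M → M ≤ n → ∑ k ∈ Finset.Ico 1 M, |ν k| + 2 * M * tailVar ν M n ≤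
        A * (M : ℝ) ^ (1 / q + e)) →
      eLpNorm (cosSum ν θ 1 n) (ENNReal.ofReal q) periodMeasure ≤
        ENNReal.ofReal (C * (A * (n : ℝ) ^ max e 0)) := by
  have hq0 : 0 < q := by linarith
  -- The annuli contribute ∑ M^{eq-1}, bounded for e < 0 and of order at most n^{eq} for e > 0; e =
  -- 0 would produce a logarithm.
  obtain ⟨c, hc, hsum⟩ : ∃ c, 0 < c ∧ ∀ n : ℕ, 1 ≤ n →
      ∑ M ∈ Finset.Ico 1 n, (M : ℝ) ^ (e * q - 1) ≤ c * (n : ℝ) ^ (max e 0 * q) := by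
    rcases lt_or_gt_of_ne he with h | h
    · have hd : 0 < -(e * q) := by nlinarith
      refine ⟨2 * exp (-(e * q)) / (-(e * q)), by positivity, fun n _ => ?_⟩
      have := sum_rpow_tail_le hd le_rfl n
      rw [neg_neg, Nat.cast_one, one_rpow] at this
      rwa [max_eq_right h.le, zero_mul, rpow_zero]
    · refine ⟨2 / (e * q), by positivity, fun n _ => ?_⟩
      rw [max_eq_left h.le]
      exact sum_rpow_le (by positivity) n
  refine ⟨(2 * π * (c + 1)) ^ (1 / q), by positivity, fun ν θ n A hn hA h => ?_⟩
  have hn0 : (0 : ℝ) < n := by exact_mod_cast hn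
  refine eLpNorm_cosSum_le (D := fun M => A * (M : ℝ) ^ (1 / q + e)) hq.le θ hn
    (fun M => by positivity) (fun M hM1 hMn => ⟨M, hM1, hMn.le, h M hM1 hMn.le⟩)
    (le_trans (le_add_of_nonneg_right (mul_nonneg (by positivity) (tailVar_nonneg _ _ _)))
      (h n hn le_rfl)) (by positivity) (by positivity) ?_
  have hpow : ∀ M : ℕ, (A * (M : ℝ) ^ (1 / q + e)) ^ q = A ^ q * (M : ℝ) ^ (1 + e * q) := by
    intro M
    rw [mul_rpow hA (by positivity), ← rpow_mul (by positivity)]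
    congr 2
    field_simp
  have h1 : ∑ M ∈ Finset.Ico 1 n, (A * (M : ℝ) ^ (1 / q + e)) ^ q / ((M : ℝ) * (M + 1)) ≤
      A ^ q * (c * (n : ℝ) ^ (max e 0 * q)) := by
    calc _ ≤ ∑ M ∈ Finset.Ico 1 n, A ^ q * (M : ℝ) ^ (e * q - 1) := by
          refine Finset.sum_le_sum fun M hM => ?_
          have hM1 := (Finset.mem_Ico.1 hM).1
          have hM0 : (0 : ℝ) < M := by exact_mod_cast hM1
          refine (div_mul_succ_le (by positivity) hM1).trans (le_of_eq ?_)
          rw [hpow, mul_assoc, ← rpow_add hM0]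
          congr 2
          ring
      _ ≤ _ := by
          rw [← Finset.mul_sum]
          exact mul_le_mul_of_nonneg_left (hsum n hn) (by positivity)
  have h2 : (A * (n : ℝ) ^ (1 / q + e)) ^ q / n ≤ A ^ q * (n : ℝ) ^ (max e 0 * q) := by
    rw [hpow, mul_div_assoc, ← rpow_sub_one hn0.ne', add_sub_cancel_left]
    refine mul_le_mul_of_nonneg_left (rpow_le_rpow_of_exponent_le (by exact_mod_cast hn) ?_)
      (by positivity)
    exact mul_le_mul_of_nonneg_right (le_max_left _ _) hq0.le
  have h3 : (A * (n : ℝ) ^ max e 0) ^ q = A ^ q * (n : ℝ) ^ (max e 0 * q) := by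
    rw [mul_rpow hA (by positivity), ← rpow_mul hn0.le]
  rw [h3]
  linarith

section Cases

variable {p s : ℝ} {ψ : ℝ → ℝ}

/-- The decay of g gives k^s ψ(k) ≤ g(1) k^{1/q-1-ε}, and this sequence is nonincreasing, so the low
part is bounded in L_q independently of n. The tail n^{-s} g(n) is at most g(1) n^{-s}. -/
theorem MemAMinus.orderEq (hp : 1 < p) (hs : 0 < s) (hψ : ∀ k : ℕ, 1 ≤ k → 0 < ψ k)
    (hg : MemAMinus (gFun ψ s p)) :
    OrderEq 1 (zygmundError ψ p s) (fun _ n => ENNReal.ofReal (1 / (n : ℝ) ^ s)) := by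
  obtain ⟨hgpos, ε₀, hε₀, hanti⟩ := hg
  have hq : 1 < p.conjExponent := one_lt_conjExponent hp
  have hpq := one_sub_one_div_conjExponent hp
  set q := p.conjExponent
  have hq0 : 0 < q := by linarith
  set g := gFun ψ s p
  have hgk : ∀ k : ℕ, 1 ≤ k → 0 < g k := fun k hk => hgpos k (by exact_mod_cast hk)
  have hG : ∀ d : ℝ, d ≤ ε₀ → ∀ m k : ℕ, 1 ≤ m → m ≤ k →
      g k * (k : ℝ) ^ d ≤ g m * (m : ℝ) ^ d := by
    intro d hd m k hm hk
    have hm1 : (1 : ℝ) ≤ m := by exact_mod_cast hm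
    have hmk : (m : ℝ) ≤ k := by exact_mod_cast hk
    have hm0 : (0 : ℝ) < m := by linarith
    have hk0 : (0 : ℝ) < k := by linarith
    have h1 : g k * (k : ℝ) ^ ε₀ ≤ g m * (m : ℝ) ^ ε₀ := hanti hm1 (hm1.trans hmk) hmk
    have h2 : (k : ℝ) ^ (d - ε₀) ≤ (m : ℝ) ^ (d - ε₀) :=
      rpow_le_rpow_of_nonpos hm0 hmk (by linarith)
    have e : ∀ j : ℕ, (0 : ℝ) < j → g j * (j : ℝ) ^ d =
        g j * (j : ℝ) ^ ε₀ * (j : ℝ) ^ (d - ε₀) := by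
      intro j hj
      rw [mul_assoc, ← rpow_add hj]
      congr 2
      ring
    rw [e k hk0, e m hm0]
    have := hgk m hm
    exact mul_le_mul h1 h2 (by positivity) (by positivity)
  have htail : ∃ C, 0 < C ∧ HasTailBound (fun k => ψ k) q
      fun n => C * (ψ n * (n : ℝ) ^ (1 / p)) := by
    obtain ⟨α, hα1, hα2, hα3⟩ := exists_exponent hp hs
    obtain ⟨K, hK⟩ := exists_isTailSeq_of_antitone hψ (α := α)
      (lt_trans (by positivity) hα1).le le_rfl fun m k hm hk => by
        rw [mul_comm, eq_gFun_mul s p ψ (hm.trans hk), mul_comm ((m : ℝ) ^ α),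
          eq_gFun_mul s p ψ hm]
        exact hG _ (by linarith) m k hm hk
    rw [← hpq] at hα1 ⊢
    exact hK.exists_hasTailBound hq hα1 hα2
  obtain ⟨C₁, hC₁, hτ⟩ := htail
  refine ⟨?_, exists_le_zygmundError hp hψ hτ⟩
  -- Lowering ε below 1/q keeps c = 1/q - ε positive, so that the partial sums of k^{c-1} grow like
  -- M^c.
  set ε := min ε₀ (1 / (2 * q)) with hε
  have hε0 : 0 < ε := lt_min hε₀ (by positivity)
  have hεq : ε < 1 / q := (min_le_right _ _).trans_lt (by
    refine one_div_lt_one_div_of_lt hq0 ?_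
    linarith)
  obtain ⟨C₂, hC₂, hlow⟩ := eLpNorm_cosSum_le_of_power hq (neg_ne_zero.2 hε0.ne')
  set c := 1 / q + -ε with hc
  have hc0 : 0 < c := by linarith
  have hc1 : c < 1 := by
    have : 1 / q < 1 := by
      rw [div_lt_one hq0]
      exact hq
    linarith
  set ν : ℕ → ℝ := fun k => (k : ℝ) ^ s * ψ k with hν
  have hνG : ∀ k : ℕ, 1 ≤ k → ν k = g k * (k : ℝ) ^ ε * (k : ℝ) ^ (c - 1) := by
    intro k hk
    have hk0 : (0 : ℝ) < k := by exact_mod_cast hk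
    simp only [hν]
    rw [coeff_eq s p ψ hk, mul_assoc, ← rpow_add hk0, ← hpq]
    congr 2
    rw [hc]
    ring
  have hνpos : ∀ k : ℕ, 1 ≤ k → 0 < ν k := by
    intro k hk
    have hk0 : (0 : ℝ) < k := by exact_mod_cast hk
    have := hψ k hk
    positivity
  have hg1 : 0 < g 1 := hgpos 1 le_rfl
  have hνle : ∀ k : ℕ, 1 ≤ k → ν k ≤ g 1 * (k : ℝ) ^ (c - 1) := by
    intro k hk
    rw [hνG k hk]
    have := hG ε (min_le_left _ _) 1 k le_rfl hk
    rw [Nat.cast_one, one_rpow, mul_one] at this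
    exact mul_le_mul_of_nonneg_right this (by positivity)
  have hνanti : ∀ m k : ℕ, 1 ≤ m → m ≤ k → ν k ≤ ν m := by
    intro m k hm hk
    have hm0 : (0 : ℝ) < m := by exact_mod_cast hm
    rw [hνG m hm, hνG k (hm.trans hk)]
    have := hgk m hm
    exact mul_le_mul (hG ε (min_le_left _ _) m k hm hk)
      (rpow_le_rpow_of_nonpos hm0 (by exact_mod_cast hk) (by linarith)) (by positivity)
      (by positivity)
  set A := g 1 * (2 / c) + 2 * g 1 with hA
  have hA0 : 0 < A := by positivity
  have hcond : ∀ n M : ℕ, 1 ≤ M → M ≤ n → ∑ k ∈ Finset.Ico 1 M, |ν k| + 2 * M * tailVar ν M n ≤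
      A * (M : ℝ) ^ c := by
    intro n M hM hMn
    have hM0 : (0 : ℝ) < M := by exact_mod_cast hM
    have h1 : ∑ k ∈ Finset.Ico 1 M, |ν k| ≤ g 1 * (2 / c * (M : ℝ) ^ c) := by
      calc _ ≤ ∑ k ∈ Finset.Ico 1 M, g 1 * (k : ℝ) ^ (c - 1) := by
            refine Finset.sum_le_sum fun k hk => ?_
            have hk1 := (Finset.mem_Ico.1 hk).1
            rw [abs_of_pos (hνpos k hk1)]
            exact hνle k hk1
        _ ≤ _ := by
            rw [← Finset.mul_sum]
            exact mul_le_mul_of_nonneg_left (sum_rpow_le hc0 M) hg1.le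
    have h2 : 2 * M * tailVar ν M n ≤ 2 * g 1 * (M : ℝ) ^ c := by
      rw [tailVar_eq_of_antitone (fun k hk => (hνpos k hk).le) hνanti hM hMn]
      calc 2 * M * ν M ≤ 2 * M * (g 1 * (M : ℝ) ^ (c - 1)) := by
            gcongr
            exact hνle M hM
        _ = _ := by
            rw [rpow_sub_one hM0.ne']
            field_simp
    rw [hA, add_mul]
    linarith
  refine bigO_of_le (C := C₁ * g 1 + C₂ * A) (by positivity) fun β n hn => ?_
  have hl := hlow ν (β * π / 2) n A hn hA0.le (hcond n)
  rw [max_eq_right (by linarith), rpow_zero, mul_one] at hl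
  refine (zygmundError_le hp hτ hn (by positivity) β hl).trans (ENNReal.ofReal_le_ofReal ?_)
  rw [tail_eq s p ψ hn]
  have hgn : g n ≤ g 1 := by
    have := hG 0 hε₀.le 1 n le_rfl hn
    simpa using this
  have : C₁ * (1 / (n : ℝ) ^ s * g n) ≤ C₁ * (1 / (n : ℝ) ^ s * g 1) := by gcongr
  linarith

lemma MemTheta.exists_hasTailBound (hp : 1 < p) (hψ : ∀ k : ℕ, 1 ≤ k → 0 < ψ k)
    (h : MemTheta p ψ) : ∃ C, 0 < C ∧ HasTailBound (fun k => ψ k) p.conjExponent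
      fun n => C * (ψ n * (n : ℝ) ^ (1 / p)) := by
  obtain ⟨hanti, α₀, hα₀, K, hK, hdecr⟩ := h
  have h1p : 1 / p < 1 := by
    rw [div_lt_one (by linarith)]
    exact hp
  -- The tail estimate needs α < 1; almost monotonicity passes to smaller exponents.
  obtain ⟨α, hα1, hα2⟩ := exists_between (lt_min hα₀ h1p)
  have hαα₀ : α < α₀ := hα2.trans_le (min_le_left _ _)
  -- The constant is raised to at least 1 to cover equal indices, absent from the strict condition,
  -- and the variation bound, whose constant is 1.
  have hseq : IsTailSeq (fun k => ψ k) α (max K 1) := by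
    refine ⟨by positivity, hψ, fun m k hm hk => ?_, fun M hM B hB => ?_⟩
    · have hm0 : (0 : ℝ) < m := by exact_mod_cast hm
      have hk0 : (0 : ℝ) < k := by exact_mod_cast hm.trans hk
      have hm1 : (1 : ℝ) ≤ m := by exact_mod_cast hm
      have hψm := hψ m hm
      have h1 : (k : ℝ) ^ α₀ * ψ k ≤ max K 1 * ((m : ℝ) ^ α₀ * ψ m) := by
        rcases hk.eq_or_lt with rfl | hlt
        · exact le_mul_of_one_le_left (by positivity) (le_max_right _ _)
        · refine (hdecr k m hm1 (by exact_mod_cast hlt)).trans ?_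
          exact mul_le_mul_of_nonneg_right (le_max_left _ _) (by positivity)
      have h2 : (k : ℝ) ^ (α - α₀) ≤ (m : ℝ) ^ (α - α₀) :=
        rpow_le_rpow_of_nonpos hm0 (by exact_mod_cast hk) (by linarith)
      have e : ∀ j : ℕ, (0 : ℝ) < j → (j : ℝ) ^ α * ψ j =
          (j : ℝ) ^ α₀ * ψ j * (j : ℝ) ^ (α - α₀) := by
        intro j hj
        rw [mul_right_comm, ← rpow_add hj]
        congr 2
        ring
      rw [e k hk0, e m hm0, ← mul_assoc]
      exact mul_le_mul h1 h2 (by positivity) (by positivity)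
    · rw [tailVar_eq_of_antitone (T := 1) (fun k hk => (hψ k hk).le) (fun m k hm hk => ?_) hM hB]
      · exact le_mul_of_one_le_left (hψ M hM).le (le_max_right _ _)
      · have hm1 : (1 : ℝ) ≤ m := by exact_mod_cast hm
        have hmk : (m : ℝ) ≤ k := by exact_mod_cast hk
        exact hanti hm1 (hm1.trans hmk) hmk
  rw [← one_sub_one_div_conjExponent hp] at hα1 ⊢
  exact hseq.exists_hasTailBound (one_lt_conjExponent hp) hα1 (hα2.trans_le (min_le_right _ _))

lemma MemAPlus.monotone_rpow {g : ℝ → ℝ} {ε₀ : ℝ} (hpos : ∀ t, 1 ≤ t → 0 < g t)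
    (hmono : MonotoneOn (fun t : ℝ => g t * t ^ (-ε₀)) (Ici 1)) {d : ℝ} (hd : -ε₀ ≤ d) {m k : ℕ}
    (hm : 1 ≤ m) (hk : m ≤ k) : g m * (m : ℝ) ^ d ≤ g k * (k : ℝ) ^ d := by
  have hm1 : (1 : ℝ) ≤ m := by exact_mod_cast hm
  have hmk : (m : ℝ) ≤ k := by exact_mod_cast hk
  have hm0 : (0 : ℝ) < m := by linarith
  have hk0 : (0 : ℝ) < k := by linarith
  have h1 : g m * (m : ℝ) ^ (-ε₀) ≤ g k * (k : ℝ) ^ (-ε₀) := hmono hm1 (hm1.trans hmk) hmk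
  have h2 : (m : ℝ) ^ (d + ε₀) ≤ (k : ℝ) ^ (d + ε₀) := rpow_le_rpow hm0.le hmk (by linarith)
  have e : ∀ j : ℕ, (0 : ℝ) < j → g j * (j : ℝ) ^ d =
      g j * (j : ℝ) ^ (-ε₀) * (j : ℝ) ^ (d + ε₀) := by
    intro j hj
    rw [mul_assoc, ← rpow_add hj]
    congr 2
    ring
  rw [e k hk0, e m hm0]
  have := hpos k (hm1.trans hmk)
  exact mul_le_mul h1 h2 (by positivity) (by positivity)

/-- The variation of `k^s ψ(k)` for nonincreasing `ψ`. -/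
lemma tailVar_rpow_mul_le (hs : 0 < s) (hψ : ∀ k : ℕ, 1 ≤ k → 0 < ψ k)
    (hanti : AntitoneOn ψ (Ici 1)) {M n : ℕ} (hM : 1 ≤ M) (hMn : M ≤ n) :
    tailVar (fun k : ℕ => (k : ℝ) ^ s * ψ k) M n ≤
      2 * (s * exp s) * ∑ k ∈ Finset.Ico M n, (k : ℝ) ^ (s - 1) * ψ k + (M : ℝ) ^ s * ψ M := by
  -- An increment is a rise caused by k^s minus a drop caused by ψ, so its modulus is at most twice
  -- the rise minus the increment. The increments telescope, and the end term cancels the final drop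
  -- in `tailVar`.
  have hterm : ∀ k ∈ Finset.Ico M n,
      |((k + 1 : ℕ) : ℝ) ^ s * ψ (k + 1 : ℕ) - (k : ℝ) ^ s * ψ k| ≤
      2 * (s * exp s) * ((k : ℝ) ^ (s - 1) * ψ k) -
        (((k + 1 : ℕ) : ℝ) ^ s * ψ (k + 1 : ℕ) - (k : ℝ) ^ s * ψ k) := by
    intro k hk
    have hk1 : 1 ≤ k := hM.trans (Finset.mem_Ico.1 hk).1
    have hk1' : (1 : ℝ) ≤ k := by exact_mod_cast hk1
    have hψk := hψ k hk1
    have hb := rpow_add_one_sub_le hs hk1'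
    have hmono : (k : ℝ) ^ s ≤ ((k : ℝ) + 1) ^ s :=
      rpow_le_rpow (by linarith) (by linarith) hs.le
    push_cast
    have hle : ψ (k + 1) ≤ ψ k := hanti hk1' (show (1 : ℝ) ≤ k + 1 by linarith) (by linarith)
    have h1 : 0 ≤ (((k : ℝ) + 1) ^ s - (k : ℝ) ^ s) * ψ k :=
      mul_nonneg (by linarith) hψk.le
    have h2 : 0 ≤ ((k : ℝ) + 1) ^ s * (ψ k - ψ (k + 1)) :=
      mul_nonneg (by positivity) (by linarith)
    have h3 : (((k : ℝ) + 1) ^ s - (k : ℝ) ^ s) * ψ k ≤ s * exp s * (k : ℝ) ^ (s - 1) * ψ k :=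
      mul_le_mul_of_nonneg_right hb hψk.le
    rw [abs_le]
    constructor <;> nlinarith
  have hsum := Finset.sum_le_sum hterm
  rw [Finset.sum_sub_distrib, ← Finset.mul_sum,
    Finset.sum_Ico_sub (fun k : ℕ => (k : ℝ) ^ s * ψ k) hMn] at hsum
  have hn : 0 ≤ (n : ℝ) ^ s * ψ n := mul_nonneg (by positivity) (hψ n (hM.trans hMn)).le
  rw [tailVar, abs_of_nonneg hn]
  linarith

/-- Monotonicity of g(k) k^{-ε} gives g(k) ≤ g(n) (k/n)^ε for k ≤ n. The low part therefore
satisfies the power estimate with exponent ε, and n^ε n^{-ε} = 1 leaves g(n), the size of the tail.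
Since k^s ψ(k) need not be monotone, its variation is estimated through that of ψ. -/
theorem zygmundError_le_of_memAPlus (hp : 1 < p) (hs : 0 < s) (hψ : ∀ k : ℕ, 1 ≤ k → 0 < ψ k)
    (hθ : MemTheta p ψ) (hg : MemAPlus (gFun ψ s p)) :
    BigO 1 (zygmundError ψ p s) fun _ n => ENNReal.ofReal (ψ n * (n : ℝ) ^ (1 / p)) := by
  obtain ⟨C₁, hC₁, hτ⟩ := hθ.exists_hasTailBound hp hψ
  obtain ⟨hgpos, ε₀, hε₀, hmono⟩ := hg
  have hq : 1 < p.conjExponent := one_lt_conjExponent hp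
  have hpq := one_sub_one_div_conjExponent hp
  set q := p.conjExponent
  have hq0 : 0 < q := by linarith
  have hp0 : 0 < p := by linarith
  set g := gFun ψ s p
  -- Taking ε < 1/p makes d positive, so the sum of k^{-d-1} in the variation bound converges.
  set ε := min ε₀ (1 / (2 * p)) with hε
  have hε0 : 0 < ε := lt_min hε₀ (by positivity)
  have hεp : ε < 1 / p := (min_le_right _ _).trans_lt (by
    refine one_div_lt_one_div_of_lt hp0 ?_
    linarith)
  obtain ⟨C₂, hC₂, hlow⟩ := eLpNorm_cosSum_le_of_power hq hε0.ne'
  set c := 1 / q + ε with hc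
  have hc0 : 0 < c := by positivity
  set d := 1 / p - ε with hd
  have hd0 : 0 < d := by linarith
  set ν : ℕ → ℝ := fun k => (k : ℝ) ^ s * ψ k with hν
  have hGle : ∀ n k : ℕ, 1 ≤ k → k ≤ n → g k * (k : ℝ) ^ (-ε) ≤ g n * (n : ℝ) ^ (-ε) :=
    fun n k hk hkn => MemAPlus.monotone_rpow hgpos hmono (neg_le_neg (min_le_left _ _)) hk hkn
  have hνle : ∀ n k : ℕ, 1 ≤ k → k ≤ n → ν k ≤ g n * (n : ℝ) ^ (-ε) * (k : ℝ) ^ (-d) := by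
    intro n k hk hkn
    have hk0 : (0 : ℝ) < k := by exact_mod_cast hk
    have e : ν k = g k * (k : ℝ) ^ (-ε) * (k : ℝ) ^ (-d) := by
      simp only [hν]
      rw [coeff_eq s p ψ hk, mul_assoc, ← rpow_add hk0]
      congr 2
      rw [hd]
      ring
    rw [e]
    exact mul_le_mul_of_nonneg_right (hGle n k hk hkn) (by positivity)
  have hνpos : ∀ k : ℕ, 1 ≤ k → 0 < ν k := by
    intro k hk
    have hk0 : (0 : ℝ) < k := by exact_mod_cast hk
    have := hψ k hk
    positivity
  set κ := 2 / c + 2 * (2 * (s * exp s) * (2 * exp d / d) + 1) with hκ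
  have hκ0 : 0 < κ := by positivity
  have hcond : ∀ n M : ℕ, 1 ≤ M → M ≤ n → ∑ k ∈ Finset.Ico 1 M, |ν k| + 2 * M * tailVar ν M n ≤
      κ * (g n * (n : ℝ) ^ (-ε)) * (M : ℝ) ^ c := by
    intro n M hM hMn
    have hM0 : (0 : ℝ) < M := by exact_mod_cast hM
    have hgn : 0 < g n := hgpos n (by exact_mod_cast hM.trans hMn)
    set G := g n * (n : ℝ) ^ (-ε) with hG
    have hG0 : 0 ≤ G := by positivity
    have hMc : (M : ℝ) * (M : ℝ) ^ (-d) = (M : ℝ) ^ c := by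
      rw [← rpow_one_add' hM0.le (by linarith)]
      congr 1
      linarith
    have h1 : ∑ k ∈ Finset.Ico 1 M, |ν k| ≤ G * (2 / c * (M : ℝ) ^ c) := by
      calc _ ≤ ∑ k ∈ Finset.Ico 1 M, G * (k : ℝ) ^ (c - 1) := by
            refine Finset.sum_le_sum fun k hk => ?_
            obtain ⟨hk1, hkM⟩ := Finset.mem_Ico.1 hk
            rw [abs_of_pos (hνpos k hk1), show c - 1 = -d by linarith]
            exact hνle n k hk1 (hkM.le.trans hMn)
        _ ≤ _ := by
            rw [← Finset.mul_sum]
            exact mul_le_mul_of_nonneg_left (sum_rpow_le hc0 M) hG0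
    have h2 : ∑ k ∈ Finset.Ico M n, (k : ℝ) ^ (s - 1) * ψ k ≤
        G * (2 * exp d / d * (M : ℝ) ^ (-d)) := by
      calc _ ≤ ∑ k ∈ Finset.Ico M n, G * (k : ℝ) ^ (-d - 1) := by
            refine Finset.sum_le_sum fun k hk => ?_
            obtain ⟨hkM, hkn⟩ := Finset.mem_Ico.1 hk
            have hk0 : (0 : ℝ) < k := by exact_mod_cast hM.trans hkM
            rw [rpow_sub_one hk0.ne', rpow_sub_one hk0.ne', ← mul_div_assoc, div_mul_eq_mul_div]
            exact div_le_div_of_nonneg_right (hνle n k (hM.trans hkM) hkn.le) hk0.le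
        _ ≤ _ := by
            rw [← Finset.mul_sum]
            exact mul_le_mul_of_nonneg_left (sum_rpow_tail_le hd0 hM n) hG0
    have h3 : tailVar ν M n ≤ 2 * (s * exp s) * (G * (2 * exp d / d * (M : ℝ) ^ (-d))) +
        G * (M : ℝ) ^ (-d) :=
      (tailVar_rpow_mul_le hs hψ hθ.1 hM hMn).trans (add_le_add
        (mul_le_mul_of_nonneg_left h2 (by positivity)) (hνle n M hM hMn))
    calc _ ≤ G * (2 / c * (M : ℝ) ^ c) + 2 * M * (2 * (s * exp s) *
          (G * (2 * exp d / d * (M : ℝ) ^ (-d))) + G * (M : ℝ) ^ (-d)) :=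
          add_le_add h1 (mul_le_mul_of_nonneg_left h3 (by positivity))
      _ = G * (2 / c * (M : ℝ) ^ c) + 2 * (2 * (s * exp s) *
          (2 * exp d / d) + 1) * G * (M * (M : ℝ) ^ (-d)) := by ring
      _ = _ := by
          rw [hMc, hκ]
          ring
  refine bigO_of_le (C := C₁ + C₂ * κ) (by positivity) fun β n hn => ?_
  have hn0 : (0 : ℝ) < n := by exact_mod_cast hn
  have hgn : 0 < g n := hgpos n (by exact_mod_cast hn)
  have hl := hlow ν (β * π / 2) n (κ * (g n * (n : ℝ) ^ (-ε))) hn (by positivity) (hcond n)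
  rw [max_eq_left hε0.le, mul_assoc κ, mul_assoc (g n), ← rpow_add hn0, neg_add_cancel, rpow_zero,
    mul_one] at hl
  refine (zygmundError_le hp hτ hn (by positivity) β hl).trans (ENNReal.ofReal_le_ofReal ?_)
  rw [tail_eq s p ψ hn]
  exact le_of_eq (by ring)

/-- Growth of g forbids ψ to fall by more than the factor 3^{-e} between n and 3n, and monotonicity
of ψ carries this to the whole block. With a block norm O(n^{1-1/p}), the duality bound n·m/(2Y) is
of order ψ(n) n^{1/p}. -/
theorem le_bestApprox_of_memAPlus (hp : 1 < p) (hψ : ∀ k : ℕ, 1 ≤ k → 0 < ψ k)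
    (hθ : MemTheta p ψ) (hg : MemAPlus (gFun ψ s p)) :
    BigO 1 (fun _ n => ENNReal.ofReal (ψ n * (n : ℝ) ^ (1 / p))) (bestApprox ψ p) := by
  obtain ⟨C₁, hC₁, hτ⟩ := hθ.exists_hasTailBound hp hψ
  obtain ⟨C₂, hC₂, hblock⟩ := eLpNorm_block_le hp
  obtain ⟨hgpos, ε, hε, hmono⟩ := hg
  set e := s + 1 / p - ε with he
  refine bigO_of_ge (c := 3 ^ (-e) / (2 * C₂)) (by positivity) fun β n hn => ?_
  have hn0 : (0 : ℝ) < n := by exact_mod_cast hn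
  have hn1 : (1 : ℝ) ≤ n := by exact_mod_cast hn
  have hm : ∀ k : ℕ, n ≤ k → k < 3 * n → 3 ^ (-e) * ψ n ≤ ψ k := by
    intro k hk hk3
    have h3n : 1 ≤ 3 * n := by omega
    have hle : ψ (3 * n : ℕ) ≤ ψ k := by
      have hk1 : (1 : ℝ) ≤ k := by exact_mod_cast hn.trans hk
      have hkn : (k : ℝ) ≤ (3 * n : ℕ) := by exact_mod_cast hk3.le
      exact hθ.1 hk1 (hk1.trans hkn) hkn
    refine le_trans ?_ hle
    have h1 := MemAPlus.monotone_rpow hgpos hmono (d := -ε) le_rfl hn (show n ≤ 3 * n by omega)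
    have e1 : ∀ j : ℕ, 1 ≤ j → gFun ψ s p j * (j : ℝ) ^ (-ε) = ψ j * (j : ℝ) ^ e := by
      intro j hj
      rw [eq_gFun_mul s p ψ hj, he]
      congr 2
      ring
    rw [e1 n hn, e1 _ h3n, Nat.cast_mul (3 : ℕ) n, mul_rpow (by positivity) hn0.le,
      ← mul_assoc] at h1
    have h2 := le_of_mul_le_mul_right h1 (by positivity)
    rw [rpow_neg (by norm_num), ← div_eq_inv_mul, div_le_iff₀ (by positivity)]
    exact_mod_cast h2
  refine le_trans (ENNReal.ofReal_le_ofReal (le_of_eq ?_))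
    (le_bestApprox hp hτ β hn (by positivity) hm (hblock _ n hn))
  rw [rpow_sub hn0, rpow_one]
  field_simp

theorem MemAPlus.orderEq (hp : 1 < p) (hs : 0 < s) (hψ : ∀ k : ℕ, 1 ≤ k → 0 < ψ k)
    (hθ : MemTheta p ψ) (hg : MemAPlus (gFun ψ s p)) :
    OrderEq 1 (zygmundError ψ p s) (bestApprox ψ p) ∧
      OrderEq 1 (bestApprox ψ p) fun _ n => ENNReal.ofReal (ψ n * (n : ℝ) ^ (1 / p)) := by
  have h1 := zygmundError_le_of_memAPlus hp hs hψ hθ hg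
  have h2 := le_bestApprox_of_memAPlus hp hψ hθ hg
  have h3 : BigO 1 (bestApprox ψ p) (zygmundError ψ p s) :=
    ⟨1, one_pos, fun β n _ => by
      rw [ENNReal.coe_one, one_mul]
      exact bestApprox_le_zygmundError β n⟩
  exact ⟨⟨h1.trans h2, h3⟩, h3.trans h1, h2⟩

end Cases

end ZygmundSums


theorem mainTheorem2 (p s : ℝ) (hp : 1 < p) (hs : 0 < s) (ψ : ℝ → ℝ)
    (hψc : ContinuousOn ψ (Set.Ici 1)) (hψ : ∀ k : ℕ, 1 ≤ k → 0 < ψ k) :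
    (ZygmundSums.MemTheta p ψ → ZygmundSums.MemAPlus (ZygmundSums.gFun ψ s p) →
      ZygmundSums.OrderEq 1 (ZygmundSums.zygmundError ψ p s) (ZygmundSums.bestApprox ψ p) ∧
      ZygmundSums.OrderEq 1 (ZygmundSums.bestApprox ψ p)
        (fun _ n => ENNReal.ofReal (ψ n * (n : ℝ) ^ (1 / p)))) ∧
    ((ZygmundSums.MemZPlus (Real.conjExponent p) (ZygmundSums.gFun ψ s p) ∨
        (ZygmundSums.MemZMinus (Real.conjExponent p) (ZygmundSums.gFun ψ s p) ∧
          ¬ ZygmundSums.LogIntegralBounded (Real.conjExponent p) (ZygmundSums.gFun ψ s p))) →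
      ZygmundSums.OrderEq 2 (ZygmundSums.zygmundError ψ p s)
        (fun _ n => ENNReal.ofReal (1 / (n : ℝ) ^ s *
          (∫ t in (1 : ℝ)..n, (ψ t * t ^ (s + 1 / p)) ^ Real.conjExponent p / t) ^
            (1 / Real.conjExponent p)))) ∧
    ((ZygmundSums.MemAMinus (ZygmundSums.gFun ψ s p) ∨
        (ZygmundSums.MemZMinus (Real.conjExponent p) (ZygmundSums.gFun ψ s p) ∧
          ZygmundSums.LogIntegralBounded (Real.conjExponent p) (ZygmundSums.gFun ψ s p))) →
      ZygmundSums.OrderEq 1 (ZygmundSums.zygmundError ψ p s)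
        (fun _ n => ENNReal.ofReal (1 / (n : ℝ) ^ s))) := by
  refine ⟨fun hθ hg => hg.orderEq hp hs hψ hθ, ?_, ?_⟩
  · rintro (h | ⟨h, -⟩)
    · exact h.1.orderEq hp hs hψ
    · exact h.1.orderEq hp hs hψ
  · rintro (h | ⟨h, hb⟩)
    · exact h.orderEq hp hs hψ
    · exact h.orderEq_of_bounded hp hs hψ hb
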